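/- Fix an integer $N\ge 3$. For $1<s<2$ and $1\le p<\infty$ let $B(s,p)$ be the space of all (a.e. equivalence classes of) real functions $u\in W^{1,p}(\mathbb{R}^N)$ with finite norm $$\|u\|_{s,p}=\|u\|_{L^p}+\|Du\|_{L^p}+\left(\int_{\mathbb{R}^N}\int_{\mathbb{R}^N}\frac{|Du(x)-Du(y)|^p}{|x-y|^{N+(s-1)p}}\,dx\,dy\right)^{1/p},$$ where $Du$ is the weak gradient, and let $\mathcal{D}'(\mathbb{R}^N)$ be the space of distributions with its usual topology. Then $C_c^2(\mathbb{R}^N)\subset B(2-\tfrac2N,N)$, and there is exactly one continuous map $\mathscr{H}:B(2-\tfrac2N,N)\to\mathcal{D}'(\mathbb{R}^N)$ such that $$\langle\mathscr{H}(u),\varphi\rangle=\int_{\mathbb{R}^N}\det(D^2u)\,\varphi\,dx\qquad\text{for all }u\in C_c^2(\mathbb{R}^N),\ \varphi\in C_c^\infty(\mathbb{R}^N).$$ Moreover, there is a constant $C$ depending only on $N$ such that for all $u_1,u_2\in B(2-\tfrac2N,N)$ and all $\varphi\in C_c^\infty(\mathbb{R}^N)$ $$|\langle\mathscr{H}(u_1)-\mathscr{H}(u_2),\varphi\rangle|\le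 C\,\|u_1-u_2\|_{2-\frac2N,N}\left(\|u_1\|_{2-\frac2N,N}^{N-1}+\|u_2\|_{2-\frac2N,N}^{N-1}\right)\|D^2\varphi\|_{L^\infty(\mathbb{R}^N)}.$$ Each $\mathscr{H}(u)$ is of order at most two, that is, it extends to a continuous linear functional on $C_c^2(\mathbb{R}^N)$, and with these extensions the estimate holds, with the same $C$, for all $\varphi\in C_c^2(\mathbb{R}^N)$. -/

import Mathlib

open MeasureTheory TopologicalSpace
open scoped ENNReal NNReal Distributions

noncomputable section

namespace HessianDet

/-- Euclidean space `ℝ^N`. -/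
abbrev E (N : ℕ) : Type := EuclideanSpace ℝ (Fin N)

/-- `G` is the weak (distributional) gradient of `u` on `ℝ^N`:
`∫ u ∂ᵢφ = - ∫ Gᵢ φ` for all `φ ∈ C_c^∞(ℝ^N)` and all `i`. It is only used for `u`, `G` in `L^p`. -/
def HasWeakGradient {N : ℕ} (u : E N → ℝ) (G : E N → E N) : Prop :=
  ∀ (φ : 𝓓((⊤ : Opens (E N)), ℝ)) (i : Fin N),
    ∫ x, u x * fderiv ℝ φ x (EuclideanSpace.single i 1) = -∫ x, G x i * φ x

/-- The Gagliardo (Slobodeckij) seminorm of order `σ` and exponent `p` of a vector field: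
`(∫∫ |G(x) - G(y)|^p / |x - y|^(N + σ p) dx dy)^(1/p)`, with values in `[0, ∞]`. -/
def gagliardo {N : ℕ} (σ : ℝ) (p : ℝ≥0) (G : E N → E N) : ℝ≥0∞ :=
  (∫⁻ z : E N × E N,
    ‖G z.1 - G z.2‖ₑ ^ (p : ℝ) / ‖z.1 - z.2‖ₑ ^ ((N : ℝ) + σ * (p : ℝ))) ^ (1 / (p : ℝ))

instance instFactOneLeCoe {p : ℝ≥0} [h : Fact (1 ≤ p)] : Fact (1 ≤ (p : ℝ≥0∞)) :=
  ⟨by exact_mod_cast h.out⟩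

instance instFactOneLeNatCast {N : ℕ} [h : Fact (3 ≤ N)] : Fact (1 ≤ (N : ℝ≥0)) :=
  ⟨by exact_mod_cast le_trans (by norm_num) h.out⟩

section Aux

variable {N : ℕ} {σ : ℝ} {p : ℝ≥0}

theorem gagliardo_congr {G G' : E N → E N} (h : G =ᵐ[volume] G') :
    gagliardo σ p G = gagliardo σ p G' := by
  unfold gagliardo
  congr 1
  have h1 : ∀ᵐ z : E N × E N, G z.1 = G' z.1 :=
    Measure.quasiMeasurePreserving_fst.ae h
  have h2 : ∀ᵐ z : E N × E N, G z.2 = G' z.2 :=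
    Measure.quasiMeasurePreserving_snd.ae h
  apply lintegral_congr_ae
  filter_upwards [h1, h2] with z hz1 hz2
  rw [hz1, hz2]

theorem gagliardo_zero [h : Fact (1 ≤ p)] : gagliardo σ p (0 : E N → E N) = 0 := by
  have hp : (0 : ℝ) < p := lt_of_lt_of_le one_pos (by exact_mod_cast h.out)
  simp [gagliardo, hp]

theorem gagliardo_smul [h : Fact (1 ≤ p)] (c : ℝ) (G : E N → E N) :
    gagliardo σ p (c • G) = ‖c‖ₑ * gagliardo σ p G := by
  have hp : (0 : ℝ) < p := lt_of_lt_of_le one_pos (by exact_mod_cast h.out)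
  have key : ∀ z : E N × E N,
      ‖(c • G) z.1 - (c • G) z.2‖ₑ ^ (p : ℝ) / ‖z.1 - z.2‖ₑ ^ ((N : ℝ) + σ * (p : ℝ)) =
      ‖c‖ₑ ^ (p : ℝ) *
        (‖G z.1 - G z.2‖ₑ ^ (p : ℝ) / ‖z.1 - z.2‖ₑ ^ ((N : ℝ) + σ * (p : ℝ))) := by
    intro z
    rw [Pi.smul_apply, Pi.smul_apply, ← smul_sub, enorm_smul,
      ENNReal.mul_rpow_of_nonneg _ _ hp.le, mul_div_assoc]
  unfold gagliardo
  simp_rw [key]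
  rw [lintegral_const_mul' _ _ (ENNReal.rpow_ne_top_of_nonneg hp.le enorm_ne_top),
    ENNReal.mul_rpow_of_nonneg _ _ (by positivity), ← ENNReal.rpow_mul,
    mul_one_div_cancel hp.ne', ENNReal.rpow_one]

theorem gagliardo_add_le [h : Fact (1 ≤ p)] {G G' : E N → E N}
    (hG : AEStronglyMeasurable G volume) (hG' : AEStronglyMeasurable G' volume) :
    gagliardo σ p (G + G') ≤ gagliardo σ p G + gagliardo σ p G' := by
  have hp1 : (1 : ℝ) ≤ p := by exact_mod_cast h.out
  have hp : (0 : ℝ) < p := lt_of_lt_of_le one_pos hp1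
  set w : E N × E N → ℝ≥0∞ := fun z =>
    ((‖z.1 - z.2‖ₑ ^ ((N : ℝ) + σ * (p : ℝ)))⁻¹) ^ (1 / (p : ℝ)) with hw
  have hwm : Measurable w := by
    have : Measurable fun z : E N × E N => ‖z.1 - z.2‖ₑ :=
      (measurable_fst.sub measurable_snd).enorm
    exact ((this.pow_const _).inv).pow_const _
  have key : ∀ (a : ℝ≥0∞) (z : E N × E N),
      a ^ (p : ℝ) / ‖z.1 - z.2‖ₑ ^ ((N : ℝ) + σ * (p : ℝ)) = (a * w z) ^ (p : ℝ) := by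
    intro a z
    rw [ENNReal.mul_rpow_of_nonneg _ _ hp.le, hw, ← ENNReal.rpow_mul,
      one_div_mul_cancel hp.ne', ENNReal.rpow_one, div_eq_mul_inv]
  have hm : ∀ {F : E N → E N}, AEStronglyMeasurable F volume →
      AEMeasurable (fun z : E N × E N => ‖F z.1 - F z.2‖ₑ * w z) volume := by
    intro F hF
    have h1 : AEStronglyMeasurable (fun z : E N × E N => F z.1) volume :=
      hF.comp_quasiMeasurePreserving Measure.quasiMeasurePreserving_fst
    have h2 : AEStronglyMeasurable (fun z : E N × E N => F z.2) volume :=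
      hF.comp_quasiMeasurePreserving Measure.quasiMeasurePreserving_snd
    exact (h1.sub h2).enorm.mul hwm.aemeasurable
  unfold gagliardo
  simp_rw [key]
  refine le_trans ?_ (ENNReal.lintegral_Lp_add_le (hm hG) (hm hG') hp1)
  gcongr with z
  simp only [Pi.add_apply]
  rw [← add_mul]
  gcongr
  calc ‖G z.1 + G' z.1 - (G z.2 + G' z.2)‖ₑ = ‖(G z.1 - G z.2) + (G' z.1 - G' z.2)‖ₑ := by
        congr 1; abel
    _ ≤ _ := enorm_add_le _ _

theorem integrable_mul_of_Lp [h : Fact (1 ≤ p)] {f : E N → ℝ} (hf : MemLp f p volume)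
    {g : E N → ℝ} (hg : Continuous g) (hc : HasCompactSupport g) :
    Integrable (fun x => f x * g x) volume :=
  ((hf.locallyIntegrable (by exact_mod_cast h.out)).integrable_smul_right_of_hasCompactSupport
    hg hc)

theorem integrable_coord_mul_of_Lp [Fact (1 ≤ p)] {G : E N → E N} (hG : MemLp G p volume)
    (φ : 𝓓((⊤ : Opens (E N)), ℝ)) (i : Fin N) :
    Integrable (fun x => G x i * φ x) volume :=
  integrable_mul_of_Lp (hG.continuousLinearMap_comp (EuclideanSpace.proj (𝕜 := ℝ) i))
    φ.continuous φ.hasCompactSupport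

theorem integrable_mul_fderiv_of_Lp [Fact (1 ≤ p)] {u : E N → ℝ} (hu : MemLp u p volume)
    (φ : 𝓓((⊤ : Opens (E N)), ℝ)) (v : E N) :
    Integrable (fun x => u x * fderiv ℝ φ x v) volume :=
  integrable_mul_of_Lp hu
    ((φ.contDiff.continuous_fderiv (by simp)).clm_apply continuous_const)
    (φ.hasCompactSupport.fderiv_apply (𝕜 := ℝ) v)

theorem HasWeakGradient.congr {u u' : E N → ℝ} {G G' : E N → E N} (h : HasWeakGradient u G)
    (hu : u =ᵐ[volume] u') (hG : G =ᵐ[volume] G') : HasWeakGradient u' G' := by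
  intro φ i
  have h1 : ∫ x, u' x * fderiv ℝ φ x (EuclideanSpace.single i 1) =
      ∫ x, u x * fderiv ℝ φ x (EuclideanSpace.single i 1) :=
    integral_congr_ae (by filter_upwards [hu] with x hx; rw [hx])
  have h2 : ∫ x, G' x i * φ x = ∫ x, G x i * φ x :=
    integral_congr_ae (by filter_upwards [hG] with x hx; rw [hx])
  rw [h1, h2, h φ i]

theorem HasWeakGradient.add [Fact (1 ≤ p)] {u u' : E N → ℝ} {G G' : E N → E N}
    (h : HasWeakGradient u G) (h' : HasWeakGradient u' G')
    (hu : MemLp u p volume) (hu' : MemLp u' p volume)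
    (hG : MemLp G p volume) (hG' : MemLp G' p volume) : HasWeakGradient (u + u') (G + G') := by
  intro φ i
  simp only [Pi.add_apply, PiLp.add_apply, add_mul]
  rw [integral_add (integrable_mul_fderiv_of_Lp hu φ _) (integrable_mul_fderiv_of_Lp hu' φ _),
    integral_add (integrable_coord_mul_of_Lp hG φ i) (integrable_coord_mul_of_Lp hG' φ i),
    h φ i, h' φ i, neg_add]

theorem HasWeakGradient.smul {u : E N → ℝ} {G : E N → E N}
    (h : HasWeakGradient u G) (c : ℝ) : HasWeakGradient (c • u) (c • G) := by
  intro φ i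
  simp only [Pi.smul_apply, PiLp.smul_apply, smul_eq_mul, mul_assoc]
  rw [integral_const_mul, integral_const_mul, h φ i, mul_neg]

theorem HasWeakGradient.zero : HasWeakGradient (0 : E N → ℝ) (0 : E N → E N) := by
  intro φ i
  simp

/-- The weak gradient is unique almost everywhere. -/
theorem HasWeakGradient.unique [h1 : Fact (1 ≤ p)] {u : E N → ℝ} {G G' : E N → E N}
    (h : HasWeakGradient u G) (h' : HasWeakGradient u G')
    (hG : MemLp G p volume) (hG' : MemLp G' p volume) : G =ᵐ[volume] G' := by
  have hp : (1 : ℝ≥0∞) ≤ p := by exact_mod_cast h1.out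
  have key : ∀ i : Fin N, ∀ᵐ x, G x i = G' x i := by
    intro i
    have e : ∀ {F : E N → E N}, MemLp F p volume →
        LocallyIntegrable (fun x => F x i) volume := fun hF =>
      (hF.continuousLinearMap_comp (EuclideanSpace.proj (𝕜 := ℝ) i)).locallyIntegrable hp
    refine ae_eq_of_integral_contDiff_smul_eq (e hG) (e hG') ?_
    intro g hg hgc
    have a := h ⟨g, hg, hgc, by simp⟩ i
    have b := h' ⟨g, hg, hgc, by simp⟩ i
    have c := neg_injective (a.symm.trans b)
    simpa [mul_comm] using c
  filter_upwards [ae_all_iff.2 key] with x hx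
  ext i
  exact hx i

end Aux

/-- The functions `u ∈ W^{1,p}(ℝ^N)` (that is, `u ∈ L^p` with a weak gradient in `L^p`) whose
gradient has finite Gagliardo seminorm of order `s - 1`. As a set and vector space this is
`B(s, p)`, for `1 < s < 2` and `1 ≤ p < ∞`. -/
def besovSubmodule (N : ℕ) (s : ℝ) (p : ℝ≥0) [Fact (1 ≤ p)] :
    Submodule ℝ (Lp ℝ p (volume : Measure (E N))) where
  carrier := {u | ∃ G : Lp (E N) p (volume : Measure (E N)),
    HasWeakGradient u G ∧ gagliardo (s - 1) p G < ∞}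
  zero_mem' := ⟨0, HasWeakGradient.zero.congr (Lp.coeFn_zero _ _ _).symm
      (Lp.coeFn_zero _ _ _).symm, by
    rw [gagliardo_congr (Lp.coeFn_zero _ _ _), gagliardo_zero]; exact ENNReal.zero_lt_top⟩
  add_mem' := by
    rintro u v ⟨G, hG, hG'⟩ ⟨K, hK, hK'⟩
    refine ⟨G + K, (hG.add hK (Lp.memLp u) (Lp.memLp v) (Lp.memLp G) (Lp.memLp K)).congr
      (Lp.coeFn_add u v).symm (Lp.coeFn_add G K).symm, ?_⟩
    rw [gagliardo_congr (Lp.coeFn_add G K)]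
    exact (gagliardo_add_le (Lp.aestronglyMeasurable G) (Lp.aestronglyMeasurable K)).trans_lt
      (ENNReal.add_lt_top.2 ⟨hG', hK'⟩)
  smul_mem' := by
    rintro c u ⟨G, hG, hG'⟩
    refine ⟨c • G, (hG.smul c).congr (Lp.coeFn_smul c u).symm (Lp.coeFn_smul c G).symm, ?_⟩
    rw [gagliardo_congr (Lp.coeFn_smul c G), gagliardo_smul]
    exact ENNReal.mul_lt_top enorm_lt_top hG'

/-- The Besov space `B(s, p)` on `ℝ^N`. It is a type of its own so that it does not inherit the
norm of `L^p`; its norm is defined below. -/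
def Besov (N : ℕ) (s : ℝ) (p : ℝ≥0) [Fact (1 ≤ p)] : Type :=
  ↥(besovSubmodule N s p)

namespace Besov

variable {N : ℕ} {s : ℝ} {p : ℝ≥0} [Fact (1 ≤ p)]

instance : AddCommGroup (Besov N s p) :=
  inferInstanceAs (AddCommGroup ↥(besovSubmodule N s p))

instance : Module ℝ (Besov N s p) :=
  inferInstanceAs (Module ℝ ↥(besovSubmodule N s p))

/-- The inclusion `B(s, p) ⊆ L^p`. -/
def toLp : Besov N s p →ₗ[ℝ] Lp ℝ p (volume : Measure (E N)) :=
  (besovSubmodule N s p).subtype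

theorem toLp_injective : Function.Injective (toLp : Besov N s p → _) :=
  Subtype.val_injective

/-- The weak gradient `Du ∈ L^p` of `u ∈ B(s, p)`. -/
def grad (u : Besov N s p) : Lp (E N) p (volume : Measure (E N)) :=
  u.2.choose

theorem hasWeakGradient_grad (u : Besov N s p) : HasWeakGradient (toLp u) (grad u) :=
  u.2.choose_spec.1

theorem gagliardo_grad_lt_top (u : Besov N s p) : gagliardo (s - 1) p (grad u) < ∞ :=
  u.2.choose_spec.2

theorem grad_eq_of_hasWeakGradient (u : Besov N s p) (G : Lp (E N) p (volume : Measure (E N)))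
    (h : HasWeakGradient (toLp u) G) : grad u = G :=
  Lp.ext ((hasWeakGradient_grad u).unique h (Lp.memLp _) (Lp.memLp _))

theorem grad_add (u v : Besov N s p) : grad (u + v) = grad u + grad v := by
  apply grad_eq_of_hasWeakGradient
  rw [map_add]
  exact ((hasWeakGradient_grad u).add (hasWeakGradient_grad v) (Lp.memLp _) (Lp.memLp _)
    (Lp.memLp _) (Lp.memLp _)).congr (Lp.coeFn_add _ _).symm (Lp.coeFn_add _ _).symm

theorem grad_smul (c : ℝ) (u : Besov N s p) : grad (c • u) = c • grad u := by
  apply grad_eq_of_hasWeakGradient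
  rw [map_smul]
  exact ((hasWeakGradient_grad u).smul c).congr (Lp.coeFn_smul _ _).symm
    (Lp.coeFn_smul _ _).symm

/-- The norm of `B(s, p)`: `‖u‖_{s,p} = ‖u‖_{W^{1,p}} + [Du]_{s-1,p}`,
where `‖u‖_{W^{1,p}} = ‖u‖_{L^p} + ‖Du‖_{L^p}`. -/
def besovNorm (u : Besov N s p) : ℝ :=
  (‖toLp u‖ + ‖grad u‖) + (gagliardo (s - 1) p (grad u)).toReal

theorem besovNorm_smul (c : ℝ) (u : Besov N s p) : besovNorm (c • u) = |c| * besovNorm u := by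
  unfold besovNorm
  rw [map_smul, grad_smul, norm_smul, norm_smul, gagliardo_congr (Lp.coeFn_smul c (grad u)),
    gagliardo_smul, ENNReal.toReal_mul, toReal_enorm, Real.norm_eq_abs]
  ring

theorem besovNorm_add_le (u v : Besov N s p) :
    besovNorm (u + v) ≤ besovNorm u + besovNorm v := by
  have h1 := norm_add_le (toLp u) (toLp v)
  have h2 := norm_add_le (grad u) (grad v)
  have h3 : (gagliardo (s - 1) p (grad (u + v))).toReal ≤
      (gagliardo (s - 1) p (grad u)).toReal + (gagliardo (s - 1) p (grad v)).toReal := by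
    rw [grad_add, gagliardo_congr (Lp.coeFn_add (grad u) (grad v)),
      ← ENNReal.toReal_add (gagliardo_grad_lt_top u).ne (gagliardo_grad_lt_top v).ne]
    exact ENNReal.toReal_mono
      (ENNReal.add_lt_top.2 ⟨gagliardo_grad_lt_top u, gagliardo_grad_lt_top v⟩).ne
      (gagliardo_add_le (Lp.aestronglyMeasurable _) (Lp.aestronglyMeasurable _))
  rw [← map_add] at h1
  rw [← grad_add] at h2
  unfold besovNorm
  linarith

theorem besovNorm_zero : besovNorm (0 : Besov N s p) = 0 := by
  have := besovNorm_smul 0 (0 : Besov N s p)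
  simpa using this

theorem eq_zero_of_besovNorm_eq_zero (u : Besov N s p) (h : besovNorm u = 0) : u = 0 := by
  have h1 := norm_nonneg (toLp u)
  have h2 := norm_nonneg (grad u)
  have h3 : 0 ≤ (gagliardo (s - 1) p (grad u)).toReal := ENNReal.toReal_nonneg
  unfold besovNorm at h
  have h4 : ‖toLp u‖ = 0 := by linarith
  exact toLp_injective ((norm_eq_zero.1 h4).trans (map_zero toLp).symm)

instance : NormedAddCommGroup (Besov N s p) :=
  AddGroupNorm.toNormedAddCommGroup
    { toFun := besovNorm
      map_zero' := besovNorm_zero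
      add_le' := besovNorm_add_le
      neg' := fun u => by
        have := besovNorm_smul (-1) u
        simpa using this
      eq_zero_of_map_eq_zero' := eq_zero_of_besovNorm_eq_zero }

theorem norm_def (u : Besov N s p) :
    ‖u‖ = (‖toLp u‖ + ‖grad u‖) + (gagliardo (s - 1) p (grad u)).toReal := rfl

instance : NormedSpace ℝ (Besov N s p) where
  norm_smul_le c u := (besovNorm_smul c u).le

end Besov

/-- The Hessian matrix `D²u(x) = (∂ᵢ∂ⱼu(x))` of a function `u : ℝ^N → ℝ`. -/
def hessian {N : ℕ} (u : E N → ℝ) (x : E N) : Matrix (Fin N) (Fin N) ℝ :=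
  Matrix.of fun i j =>
    iteratedFDeriv ℝ 2 u x ![EuclideanSpace.single i 1, EuclideanSpace.single j 1]

/-- `‖D²φ‖_{L^∞(ℝ^N)}`, with the operator norm of the bilinear form `D²φ(x)`. -/
def supNormD2 {N : ℕ} (φ : E N → ℝ) : ℝ :=
  (eLpNorm (iteratedFDeriv ℝ 2 φ) ∞ (volume : Measure (E N))).toReal

/-- The space `B(2 - 2/N, N)` on `ℝ^N`, `N ≥ 3`. -/
abbrev CriticalBesov (N : ℕ) [Fact (3 ≤ N)] : Type :=
  Besov N (2 - 2 / (N : ℝ)) (N : ℝ≥0)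

/-- `H` extends the operator `u ↦ det(D²u)` from `C_c^2(ℝ^N)` to distributions: every
`u ∈ C_c^2(ℝ^N)` is (represents) an element `w` of `B(2 - 2/N, N)`, necessarily unique, and
`⟨H(w), φ⟩ = ∫ det(D²u) φ` for all test functions `φ`. -/
def ExtendsHessianDet {N : ℕ} [Fact (3 ≤ N)]
    (H : CriticalBesov N → 𝓓'((⊤ : Opens (E N)), ℝ)) : Prop :=
  ∀ u : 𝓓^{2}((⊤ : Opens (E N)), ℝ), ∃ w : CriticalBesov N,
    (Besov.toLp w : E N → ℝ) =ᵐ[volume] u ∧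
    ∀ φ : 𝓓((⊤ : Opens (E N)), ℝ), H w φ = ∫ x, (hessian u x).det * φ x

end HessianDet

end

/-!
Extend a smooth `u` to the half space by its averages `U(t, x)` at scale `t`, and let
`I(t) = ∫ det (D²U(t, ·)) φ`. The cofactors of a Hessian matrix are divergence free, so the
linearization of the Hessian determinant is self-adjoint and `I'(t) = ∫ cof(D²U) : D²φ · ∂_t U`.
Both `|∂_t U|` and `t |D²U|` are bounded by the mean oscillation of `Du` at scale `t`, hence
`|I'(t)| ≲ ‖D²φ‖_∞ t^(1-N) ∫ osc_t(Du)^N`. Integrated over the scales `t`, the right-hand side is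
the Gagliardo seminorm with the critical exponents `s = 2 - 2/N` and `p = N`; since `I(t) → 0` as
`t → ∞`, this bounds `|I(0)| = |∫ det(D²u) φ|` by `C ‖u‖^N ‖D²φ‖_∞`.

For the difference estimate, `θ ↦ ∫ det(D²(u₂ + θ (u₁ - u₂))) φ` is a polynomial of degree at most
`N`, bounded by `C (‖u₂‖ + θ ‖u₁ - u₂‖)^N ‖D²φ‖_∞`; Lagrange interpolation turns this bound into one
of its increment from `0` to `1`. Since mollification and cutoff make `C_c^∞` dense in
`B(2 - 2/N, N)`, the estimate gives both the extension and its uniqueness.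
-/

noncomputable section

namespace HessianDet

section Determinant

variable {n : Type*} [Fintype n] [DecidableEq n]

theorem det_updateRow_eq_sum_adjugate {R : Type*} [CommRing R] (A : Matrix n n R) (i : n)
    (b : n → R) : (A.updateRow i b).det = ∑ j, A.adjugate j i * b j := by
  rw [Matrix.det_eq_sum_mul_adjugate_row _ i]
  refine Finset.sum_congr rfl fun j _ => ?_
  rw [Matrix.updateRow_self, Matrix.adjugate_apply, Matrix.updateRow_idem, ← Matrix.adjugate_apply,
    mul_comm]

theorem det_updateRow_updateRow_swap {R : Type*} [CommRing R] (A : Matrix n n R) {i j : n}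
    (hij : i ≠ j) (a b : n → R) :
    ((A.updateRow i a).updateRow j b).det = -((A.updateRow i b).updateRow j a).det := by
  have hswap : (A.updateRow i a).updateRow j b =
      ((A.updateRow i b).updateRow j a).submatrix (Equiv.swap i j) id := by
    ext k l
    rcases eq_or_ne k i with rfl | hki
    · simp [Matrix.updateRow_apply, hij]
    · rcases eq_or_ne k j with rfl | hkj
      · simp [Matrix.updateRow_apply, hij]
      · simp [Matrix.updateRow_apply, hki, hkj, Equiv.swap_apply_of_ne_of_ne hki hkj]
  rw [hswap, Matrix.det_permute, Equiv.Perm.sign_swap hij]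
  simp

theorem abs_det_le_of_abs_row_le {A : Matrix n n ℝ} {r : n → ℝ} (h : ∀ i j, |A i j| ≤ r i) :
    |A.det| ≤ (Fintype.card n).factorial * ∏ i, r i := by
  have hterm (σ : Equiv.Perm n) : |(σ.sign : ℤ) • ∏ i, A (σ i) i| ≤ ∏ i, r i := by
    rw [zsmul_eq_mul, abs_mul, ← Int.cast_abs, Int.isUnit_iff_abs_eq.1 σ.sign.isUnit, Int.cast_one,
      one_mul, Finset.abs_prod, ← Equiv.prod_comp σ r]
    exact Finset.prod_le_prod (fun _ _ => abs_nonneg _) fun i _ => h (σ i) i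
  rw [Matrix.det_apply]
  calc |∑ σ : Equiv.Perm n, σ.sign • ∏ i, A (σ i) i|
      ≤ ∑ _σ : Equiv.Perm n, ∏ i, r i :=
        (Finset.abs_sum_le_sum_abs _ _).trans (Finset.sum_le_sum fun σ _ => hterm σ)
    _ = _ := by simp [Fintype.card_perm]

theorem abs_det_le {A : Matrix n n ℝ} {r : ℝ} (h : ∀ i j, |A i j| ≤ r) :
    |A.det| ≤ (Fintype.card n).factorial * r ^ Fintype.card n := by
  simpa using abs_det_le_of_abs_row_le (r := fun _ => r) h

theorem abs_sum_det_updateRow_le {A B : Matrix n n ℝ} {r M : ℝ}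
    (hA : ∀ i j, |A i j| ≤ r) (hB : ∀ i j, |B i j| ≤ M) :
    |∑ i, (A.updateRow i (B i)).det| ≤
      Fintype.card n * (Fintype.card n).factorial * r ^ (Fintype.card n - 1) * M := by
  have hrow (i : n) : |(A.updateRow i (B i)).det| ≤
      (Fintype.card n).factorial * (r ^ (Fintype.card n - 1) * M) := by
    have h := abs_det_le_of_abs_row_le (A := A.updateRow i (B i))
      (r := Function.update (fun _ => r) i M) fun k l => by
        rcases eq_or_ne k i with rfl | hk
        · simpa using hB k l
        · simpa [hk] using hA k l
    rwa [Finset.prod_update_of_mem (Finset.mem_univ i), Finset.prod_const,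
      ← Finset.compl_eq_univ_sdiff, Finset.card_compl, Finset.card_singleton, mul_comm M] at h
  calc |∑ i, (A.updateRow i (B i)).det|
      ≤ ∑ _i : n, (Fintype.card n).factorial * (r ^ (Fintype.card n - 1) * M) :=
        (Finset.abs_sum_le_sum_abs _ _).trans (Finset.sum_le_sum fun i _ => hrow i)
    _ = _ := by
      rw [Finset.sum_const, Finset.card_univ, nsmul_eq_mul]
      ring

theorem eval_eq_sum_lagrange {P : Polynomial ℝ} {d : ℕ} (hP : P.natDegree ≤ d) (θ : ℝ) :
    P.eval θ = ∑ k ∈ Finset.range (d + 1), P.eval (k : ℝ) *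
      (Lagrange.basis (Finset.range (d + 1)) (fun k : ℕ => (k : ℝ)) k).eval θ := by
  have hdeg : P.degree < (Finset.range (d + 1)).card := by
    rw [Finset.card_range]
    exact Polynomial.degree_le_natDegree.trans_lt (by exact_mod_cast Nat.lt_succ_of_le hP)
  have hinterp := congrArg (Polynomial.eval θ) (Lagrange.eq_interpolate (v := fun k : ℕ => (k : ℝ))
    Nat.cast_injective.injOn hdeg)
  rw [Lagrange.interpolate_apply, Polynomial.eval_finsetSum] at hinterp
  simpa only [Polynomial.eval_mul, Polynomial.eval_C] using hinterp

theorem det_add_smul_eq_sum_lagrange (A B : Matrix n n ℝ) (θ : ℝ) :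
    (A + θ • B).det = ∑ k ∈ Finset.range (Fintype.card n + 1), (A + (k : ℝ) • B).det *
      (Lagrange.basis (Finset.range (Fintype.card n + 1)) (fun k : ℕ => (k : ℝ)) k).eval θ := by
  have heval (s : ℝ) : ((Polynomial.X : Polynomial ℝ) • B.map Polynomial.C +
      A.map Polynomial.C).det.eval s = (A + s • B).det := by
    rw [← Polynomial.coe_evalRingHom, RingHom.map_det]
    congr 1
    ext i j
    simp [add_comm, mul_comm s]
  simpa only [heval] using eval_eq_sum_lagrange (Polynomial.natDegree_det_X_add_C_le B A) θ

end Determinant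

section DirectionalDerivative

variable {V : Type*} [NormedAddCommGroup V] [NormedSpace ℝ V]

/-- The directional derivative `∂_v f` of a real function; it is `0` where `f` is not
differentiable. -/
def dirDeriv (v : V) (f : V → ℝ) : V → ℝ := fun x => fderiv ℝ f x v

theorem dirDeriv_eq_of_hasDerivAt {f : V → ℝ} {v x : V} {d : ℝ} (hf : DifferentiableAt ℝ f x)
    (h : HasDerivAt (fun s : ℝ => f (x + s • v)) d 0) : dirDeriv v f x = d :=
  (hf.hasFDerivAt.hasLineDerivAt v).unique h

theorem contDiff_dirDeriv {f : V → ℝ} {k m : WithTop ℕ∞} (hf : ContDiff ℝ k f) (hmk : m + 1 ≤ k)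
    (v : V) : ContDiff ℝ m (dirDeriv v f) :=
  (hf.fderiv_right hmk).clm_apply contDiff_const

theorem continuous_dirDeriv {f : V → ℝ} (hf : ContDiff ℝ 1 f) (v : V) :
    Continuous (dirDeriv v f) :=
  (contDiff_dirDeriv (m := 0) hf (by norm_num) v).continuous

theorem dirDeriv_eq_zero_of_notMem_tsupport {f : V → ℝ} {x : V} (hx : x ∉ tsupport f) (v : V) :
    dirDeriv v f x = 0 := by
  rw [dirDeriv, fderiv_of_notMem_tsupport ℝ hx]
  rfl

theorem hasCompactSupport_dirDeriv {f : V → ℝ} (hf : HasCompactSupport f) (v : V) :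
    HasCompactSupport (dirDeriv v f) :=
  hf.fderiv_apply (𝕜 := ℝ) v

theorem dirDeriv_dirDeriv {f : V → ℝ} (hf : ContDiff ℝ 2 f) (v w x : V) :
    dirDeriv v (dirDeriv w f) x = fderiv ℝ (fderiv ℝ f) x v w := by
  have hd : DifferentiableAt ℝ (fderiv ℝ f) x :=
    (hf.fderiv_right (m := 1) (by norm_num)).differentiable (by norm_num) x
  change fderiv ℝ (fun y => fderiv ℝ f y w) x v = _
  rw [fderiv_clm_apply hd (differentiableAt_const w)]
  simp

theorem dirDeriv_comm {f : V → ℝ} (hf : ContDiff ℝ 2 f) (v w : V) :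
    dirDeriv v (dirDeriv w f) = dirDeriv w (dirDeriv v f) := by
  ext x
  rw [dirDeriv_dirDeriv hf, dirDeriv_dirDeriv hf]
  exact hf.contDiffAt.isSymmSndFDerivAt (by simp) v w

theorem dirDeriv_mul {f g : V → ℝ} {x : V} (hf : DifferentiableAt ℝ f x)
    (hg : DifferentiableAt ℝ g x) (v : V) :
    dirDeriv v (fun y => f y * g y) x = dirDeriv v f x * g x + f x * dirDeriv v g x := by
  simp only [dirDeriv, fderiv_fun_mul hf hg, add_apply, smul_apply, smul_eq_mul]
  ring

theorem continuous_sum_mul_dirDeriv {ι : Type*} [Fintype ι] (e : ι → V) {c : ι → V → ℝ}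
    {f : V → ℝ} (hc : ∀ i, Continuous (c i)) (hf : ContDiff ℝ 1 f) :
    Continuous fun x => ∑ i, c i x * dirDeriv (e i) f x :=
  continuous_finsetSum _ fun i _ => (hc i).mul (continuous_dirDeriv hf _)

theorem hasCompactSupport_sum_mul_dirDeriv {ι : Type*} [Fintype ι]
    (e : ι → V) (c : ι → V → ℝ) {f : V → ℝ} (hf : HasCompactSupport f) :
    HasCompactSupport fun x => ∑ i, c i x * dirDeriv (e i) f x :=
  HasCompactSupport.intro hf fun x hx => by
    simp only [dirDeriv_eq_zero_of_notMem_tsupport hx, mul_zero, Finset.sum_const_zero]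

theorem sum_dirDeriv_mul_of_div_eq_zero {ι : Type*} [Fintype ι] {e : ι → V}
    {c : ι → V → ℝ} {f : V → ℝ} {x : V}
    (hc : ∀ i, DifferentiableAt ℝ (c i) x) (hdiv : ∑ i, dirDeriv (e i) (c i) x = 0)
    (hf : DifferentiableAt ℝ f x) :
    ∑ i, dirDeriv (e i) (fun y => c i y * f y) x = ∑ i, c i x * dirDeriv (e i) f x := by
  simp only [dirDeriv_mul (hc _) hf]
  rw [Finset.sum_add_distrib, ← Finset.sum_mul, hdiv, zero_mul, zero_add]

variable {n : Type*} [Fintype n] [DecidableEq n]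

/-- The determinant as a continuous multilinear map of the rows. -/
def detContinuousMultilinear (n : Type*) [Fintype n] [DecidableEq n] :
    ContinuousMultilinearMap ℝ (fun _ : n => n → ℝ) ℝ where
  toMultilinearMap := (Matrix.detRowAlternating : (n → ℝ) [⋀^n]→ₗ[ℝ] ℝ).toMultilinearMap
  cont := Continuous.matrix_det (A := fun B : Matrix n n ℝ => B) continuous_id

theorem hasFDerivAt_det {A : V → Matrix n n ℝ} {x : V}
    (hA : ∀ i j, DifferentiableAt ℝ (fun y => A y i j) x) :
    HasFDerivAt (fun y => (A y).det)
      (∑ i, ((detContinuousMultilinear n).toContinuousLinearMap (A x) i) ∘L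
        (ContinuousLinearMap.pi fun j => fderiv ℝ (fun y => A y i j) x)) x :=
  HasFDerivAt.multilinear_comp (f := detContinuousMultilinear n) (g := fun i y => A y i) fun i =>
    hasFDerivAt_pi.2 fun j => (hA i j).hasFDerivAt

theorem dirDeriv_det {A : V → Matrix n n ℝ} {x : V}
    (hA : ∀ i j, DifferentiableAt ℝ (fun y => A y i j) x) (v : V) :
    dirDeriv v (fun y => (A y).det) x =
      ∑ i, ((A x).updateRow i fun j => dirDeriv v (fun y => A y i j) x).det := by
  rw [dirDeriv, (hasFDerivAt_det hA).fderiv]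
  simp only [_root_.sum_apply, ContinuousLinearMap.comp_apply]
  rfl

theorem contDiff_det {A : V → Matrix n n ℝ} {k : WithTop ℕ∞}
    (hA : ∀ i j, ContDiff ℝ k (fun y => A y i j)) : ContDiff ℝ k fun y => (A y).det := by
  simp only [Matrix.det_apply]
  exact ContDiff.sum fun σ _ => ContDiff.const_smul _ (contDiff_prod fun i _ => hA _ _)

theorem contDiff_adjugate {A : V → Matrix n n ℝ} {k : WithTop ℕ∞}
    (hA : ∀ i j, ContDiff ℝ k (fun y => A y i j)) (i j : n) :
    ContDiff ℝ k fun y => (A y).adjugate i j := by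
  simp only [Matrix.adjugate_apply]
  refine contDiff_det fun a b => ?_
  rcases eq_or_ne a j with rfl | ha
  · simpa only [Matrix.updateRow_self] using contDiff_const
  · simpa only [Matrix.updateRow_ne ha] using hA a b

end DirectionalDerivative

section Piola

variable {V : Type*} [NormedAddCommGroup V] [NormedSpace ℝ V]
variable {n : Type*} [Fintype n]

theorem sum_sum_mul_eq_zero_of_symm_of_antisymm {s d : n → n → ℝ} (hs : ∀ i j, s i j = s j i)
    (hd : ∀ i j, d i j = -d j i) : ∑ i, ∑ j, s i j * d i j = 0 := by
  have h : ∑ i, ∑ j, s i j * d i j = -∑ i, ∑ j, s i j * d i j := by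
    conv_lhs => rw [Finset.sum_comm]
    simp only [← Finset.sum_neg_distrib]
    exact Finset.sum_congr rfl fun i _ => Finset.sum_congr rfl fun j _ => by
      rw [hs j i, hd j i, mul_neg]
  linarith

variable [DecidableEq n] {A : V → Matrix n n ℝ}

theorem dirDeriv_adjugate {x : V} (hA : ∀ i j, DifferentiableAt ℝ (fun y => A y i j) x)
    (v : V) (i j : n) :
    dirDeriv v (fun y => (A y).adjugate i j) x =
      ∑ k ∈ Finset.univ.erase j, ∑ l, dirDeriv v (fun y => A y k l) x *
        (((A x).updateRow j (Pi.single i 1)).updateRow k (Pi.single l 1)).det := by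
  have hdiff (a b : n) :
      DifferentiableAt ℝ (fun y => (A y).updateRow j (Pi.single i 1) a b) x := by
    rcases eq_or_ne a j with rfl | ha
    · simp only [Matrix.updateRow_self, differentiableAt_const]
    · simpa only [Matrix.updateRow_ne ha] using hA a b
  have hconst : (((A x).updateRow j (Pi.single i 1)).updateRow j fun l =>
      dirDeriv v (fun y => (A y).updateRow j (Pi.single i 1) j l) x).det = 0 :=
    Matrix.det_eq_zero_of_row_eq_zero j fun l => by simp [Matrix.updateRow_self, dirDeriv]
  simp only [Matrix.adjugate_apply]
  rw [dirDeriv_det hdiff, ← Finset.add_sum_erase _ _ (Finset.mem_univ j), hconst, zero_add]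
  refine Finset.sum_congr rfl fun k hk => ?_
  simp only [Matrix.updateRow_ne (Finset.ne_of_mem_erase hk)]
  rw [det_updateRow_eq_sum_adjugate]
  exact Finset.sum_congr rfl fun l _ => by rw [Matrix.adjugate_apply, mul_comm]

/-- **Piola identity**: if the rows of `A` are gradients, its cofactor matrix is divergence free. -/
theorem sum_dirDeriv_adjugate_eq_zero {e : n → V} {x : V}
    (hA : ∀ i j, DifferentiableAt ℝ (fun y => A y i j) x)
    (hcurl : ∀ k i l, dirDeriv (e i) (fun y => A y k l) x = dirDeriv (e l) (fun y => A y k i) x)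
    (j : n) : ∑ i, dirDeriv (e i) (fun y => (A y).adjugate i j) x = 0 := by
  simp only [dirDeriv_adjugate hA]
  rw [Finset.sum_comm]
  exact Finset.sum_eq_zero fun k hk => sum_sum_mul_eq_zero_of_symm_of_antisymm
    (fun i l => hcurl k i l)
    fun i l => det_updateRow_updateRow_swap _ (Finset.ne_of_mem_erase hk).symm _ _

end Piola

section IntegrationByParts

variable {V : Type*} [NormedAddCommGroup V] [NormedSpace ℝ V] [MeasurableSpace V] [BorelSpace V]
  {μ : Measure V} {ι : Type*} [Fintype ι]

theorem integrable_sum_mul_dirDeriv_mul [IsFiniteMeasureOnCompacts μ] (e : ι → V)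
    {c : ι → V → ℝ} {f g : V → ℝ} (hc : ∀ i, Continuous (c i)) (hf : ContDiff ℝ 1 f)
    (hg : Continuous g) (hfg : HasCompactSupport f ∨ HasCompactSupport g) :
    Integrable (fun x => (∑ i, c i x * dirDeriv (e i) f x) * g x) μ := by
  refine ((continuous_sum_mul_dirDeriv e hc hf).mul hg).integrable_of_hasCompactSupport ?_
  rcases hfg with hfc | hgc
  · exact (hasCompactSupport_sum_mul_dirDeriv e c hfc).mul_right
  · exact hgc.mul_left

variable [FiniteDimensional ℝ V] [μ.IsAddHaarMeasure]

theorem integral_dirDeriv_eq_zero {f : V → ℝ} (hf : ContDiff ℝ 1 f) (hfc : HasCompactSupport f)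
    (v : V) : ∫ x, dirDeriv v f x ∂μ = 0 := by
  have hint : Integrable (dirDeriv v f) μ :=
    (continuous_dirDeriv hf v).integrable_of_hasCompactSupport (hasCompactSupport_dirDeriv hfc v)
  change ∫ x, fderiv ℝ f x v ∂μ = 0
  simpa using integral_mul_fderiv_eq_neg_fderiv_mul_of_integrable (f := fun _ => (1 : ℝ)) (g := f)
    (v := v) (μ := μ) (by simp) (by simp only [one_mul]; exact hint)
    (by simpa using hf.continuous.integrable_of_hasCompactSupport hfc)
    (fun _ _ => differentiableAt_const 1) fun x _ => hf.differentiable one_ne_zero x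

theorem integral_mul_dirDeriv {f g : V → ℝ} (hf : ContDiff ℝ 1 f) (hg : ContDiff ℝ 1 g)
    (hfc : HasCompactSupport f) (v : V) :
    ∫ x, f x * dirDeriv v g x ∂μ = -∫ x, dirDeriv v f x * g x ∂μ := by
  refine integral_mul_fderiv_eq_neg_fderiv_mul_of_integrable ?_ ?_ ?_
    (fun x _ => hf.differentiable one_ne_zero x) fun x _ => hg.differentiable one_ne_zero x
  · exact ((continuous_dirDeriv hf v).mul hg.continuous).integrable_of_hasCompactSupport
      (hasCompactSupport_dirDeriv hfc v).mul_right
  · exact (hf.continuous.mul (continuous_dirDeriv hg v)).integrable_of_hasCompactSupport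
      hfc.mul_right
  · exact (hf.continuous.mul hg.continuous).integrable_of_hasCompactSupport hfc.mul_right

theorem integral_sum_mul_dirDeriv_mul_of_div_eq_zero {e : ι → V} {c : ι → V → ℝ} {w φ : V → ℝ}
    (hc : ∀ i, ContDiff ℝ 1 (c i)) (hdiv : ∀ x, ∑ i, dirDeriv (e i) (c i) x = 0)
    (hw : ContDiff ℝ 1 w) (hφ : ContDiff ℝ 1 φ) (hφc : HasCompactSupport φ) :
    ∫ x, (∑ i, c i x * dirDeriv (e i) w x) * φ x ∂μ =
      -∫ x, (∑ i, c i x * dirDeriv (e i) φ x) * w x ∂μ := by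
  have hprod (i : ι) : ContDiff ℝ 1 fun x => c i x * (φ x * w x) := (hc i).mul (hφ.mul hw)
  have hprodc (i : ι) : HasCompactSupport fun x => c i x * (φ x * w x) := hφc.mul_right.mul_left
  have hleibniz (x : V) : ∑ i, dirDeriv (e i) (fun y => c i y * (φ y * w y)) x =
      (∑ i, c i x * dirDeriv (e i) w x) * φ x + (∑ i, c i x * dirDeriv (e i) φ x) * w x := by
    have hd {f : V → ℝ} (hf : ContDiff ℝ 1 f) : DifferentiableAt ℝ f x :=
      hf.differentiable one_ne_zero x
    rw [sum_dirDeriv_mul_of_div_eq_zero (fun i => hd (hc i)) (hdiv x) (hd (hφ.mul hw))]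
    simp only [dirDeriv_mul (hd hφ) (hd hw), Finset.sum_mul, ← Finset.sum_add_distrib]
    exact Finset.sum_congr rfl fun i _ => by ring
  rw [eq_neg_iff_add_eq_zero, ← integral_add]
  · simp only [← hleibniz]
    rw [integral_finsetSum _ fun i _ => (continuous_dirDeriv (hprod i) _)
      |>.integrable_of_hasCompactSupport (hasCompactSupport_dirDeriv (hprodc i) _)]
    exact Finset.sum_eq_zero fun i _ => integral_dirDeriv_eq_zero (hprod i) (hprodc i) _
  · exact integrable_sum_mul_dirDeriv_mul e (fun i => (hc i).continuous) hw hφ.continuous (.inr hφc)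
  · exact integrable_sum_mul_dirDeriv_mul e (fun i => (hc i).continuous) hφ hw.continuous (.inl hφc)

theorem integral_sum_mul_dirDeriv_dirDeriv_mul {e : ι → V} {c : ι → ι → V → ℝ} {w φ : V → ℝ}
    (hc : ∀ i j, ContDiff ℝ 1 (c i j))
    (hcol : ∀ j x, ∑ i, dirDeriv (e i) (c i j) x = 0)
    (hrow : ∀ i x, ∑ j, dirDeriv (e j) (c i j) x = 0)
    (hw : ContDiff ℝ 2 w) (hφ : ContDiff ℝ 2 φ) (hφc : HasCompactSupport φ) :
    ∫ x, (∑ i, ∑ j, c i j x * dirDeriv (e i) (dirDeriv (e j) w) x) * φ x ∂μ =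
      ∫ x, (∑ i, ∑ j, c i j x * dirDeriv (e j) (dirDeriv (e i) φ) x) * w x ∂μ := by
  have hdw (j : ι) : ContDiff ℝ 1 (dirDeriv (e j) w) := contDiff_dirDeriv hw (by norm_num) _
  have hdφ (i : ι) : ContDiff ℝ 1 (dirDeriv (e i) φ) := contDiff_dirDeriv hφ (by norm_num) _
  have hdφc (i : ι) : HasCompactSupport (dirDeriv (e i) φ) := hasCompactSupport_dirDeriv hφc _
  have hw₁ : ContDiff ℝ 1 w := hw.of_le one_le_two
  have hφ₁ : ContDiff ℝ 1 φ := hφ.of_le one_le_two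
  have hcc (i j : ι) : Continuous (c i j) := (hc i j).continuous
  calc ∫ x, (∑ i, ∑ j, c i j x * dirDeriv (e i) (dirDeriv (e j) w) x) * φ x ∂μ
      = ∑ j, ∫ x, (∑ i, c i j x * dirDeriv (e i) (dirDeriv (e j) w) x) * φ x ∂μ := by
        rw [← integral_finsetSum _ fun j _ => integrable_sum_mul_dirDeriv_mul e
          (fun i => hcc i j) (hdw j) hφ.continuous (.inr hφc)]
        congr 1 with x
        rw [Finset.sum_comm, Finset.sum_mul]
    _ = -∑ j, ∫ x, (∑ i, c i j x * dirDeriv (e i) φ x) * dirDeriv (e j) w x ∂μ := by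
        rw [← Finset.sum_neg_distrib]
        exact Finset.sum_congr rfl fun j _ => integral_sum_mul_dirDeriv_mul_of_div_eq_zero
          (fun i => hc i j) (hcol j) (hdw j) hφ₁ hφc
    _ = -∑ i, ∫ x, (∑ j, c i j x * dirDeriv (e j) w x) * dirDeriv (e i) φ x ∂μ := by
        rw [← integral_finsetSum _ fun j _ => integrable_sum_mul_dirDeriv_mul e
            (fun i => hcc i j) hφ₁ (hdw j).continuous (.inl hφc),
          ← integral_finsetSum _ fun i _ => integrable_sum_mul_dirDeriv_mul e (hcc i) hw₁
            (hdφ i).continuous (.inr (hdφc i))]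
        congr 2 with x
        simp only [Finset.sum_mul]
        rw [Finset.sum_comm]
        exact Finset.sum_congr rfl fun i _ => Finset.sum_congr rfl fun j _ => by ring
    _ = ∑ i, ∫ x, (∑ j, c i j x * dirDeriv (e j) (dirDeriv (e i) φ) x) * w x ∂μ := by
        rw [← Finset.sum_neg_distrib]
        exact Finset.sum_congr rfl fun i _ => by
          rw [integral_sum_mul_dirDeriv_mul_of_div_eq_zero (hc i) (hrow i) hw₁ (hdφ i) (hdφc i),
            neg_neg]
    _ = _ := by
        rw [← integral_finsetSum _ fun i _ => integrable_sum_mul_dirDeriv_mul e (hcc i) (hdφ i)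
          hw.continuous (.inl (hdφc i))]
        simp only [Finset.sum_mul]

end IntegrationByParts

section Hessian

variable {N : ℕ}

/-- The standard basis vectors of `ℝ^N`. -/
abbrev stdVec (i : Fin N) : E N := EuclideanSpace.single i 1

theorem hessian_apply {u : E N → ℝ} (hu : ContDiff ℝ 2 u) (x : E N) (i j : Fin N) :
    hessian u x i j = dirDeriv (stdVec i) (dirDeriv (stdVec j) u) x := by
  rw [dirDeriv_dirDeriv hu, hessian, Matrix.of_apply, iteratedFDeriv_two_apply]
  simp

theorem transpose_hessian {u : E N → ℝ} (hu : ContDiff ℝ 2 u) (x : E N) :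
    (hessian u x).transpose = hessian u x := by
  ext i j
  rw [Matrix.transpose_apply, hessian_apply hu, hessian_apply hu, dirDeriv_comm hu]

theorem contDiff_hessian {u : E N → ℝ} {k m : WithTop ℕ∞} (hu : ContDiff ℝ k u) (hmk : m + 2 ≤ k)
    (i j : Fin N) : ContDiff ℝ m fun x => hessian u x i j := by
  have hmk' : m + 1 + 1 ≤ k := by rwa [add_assoc, one_add_one_eq_two]
  simp only [hessian_apply (hu.of_le (le_trans le_add_self hmk))]
  exact contDiff_dirDeriv (contDiff_dirDeriv hu hmk' _) le_rfl _

theorem sum_dirDeriv_adjugate_hessian_eq_zero {v : E N → ℝ} (hv : ContDiff ℝ 3 v) (j : Fin N)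
    (x : E N) : ∑ i, dirDeriv (stdVec i) (fun y => (hessian v y).adjugate i j) x = 0 := by
  have hv₂ : ContDiff ℝ 2 v := hv.of_le (by norm_num)
  refine sum_dirDeriv_adjugate_eq_zero (fun i j =>
    (contDiff_hessian (m := 1) hv (by norm_num) i j).differentiable one_ne_zero x) ?_ j
  intro k i l
  simp only [hessian_apply hv₂]
  rw [dirDeriv_comm hv₂ (stdVec k) (stdVec l), dirDeriv_comm hv₂ (stdVec k) (stdVec i)]
  exact congrFun (dirDeriv_comm (contDiff_dirDeriv hv (by norm_num) _) _ _) x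

theorem integral_sum_det_updateRow_hessian_mul_comm {v w φ : E N → ℝ} (hv : ContDiff ℝ 3 v)
    (hw : ContDiff ℝ 2 w) (hφ : ContDiff ℝ 2 φ) (hφc : HasCompactSupport φ) :
    ∫ x, (∑ i, ((hessian v x).updateRow i (hessian w x i)).det) * φ x =
      ∫ x, (∑ i, ((hessian v x).updateRow i (hessian φ x i)).det) * w x := by
  have hv₂ : ContDiff ℝ 2 v := hv.of_le (by norm_num)
  have hsymm (x : E N) (i j : Fin N) :
      (hessian v x).adjugate i j = (hessian v x).adjugate j i := by
    conv_rhs => rw [← transpose_hessian hv₂, ← Matrix.adjugate_transpose, Matrix.transpose_apply]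
  have hparts := integral_sum_mul_dirDeriv_dirDeriv_mul (e := stdVec) (μ := volume)
    (c := fun i j x => (hessian v x).adjugate j i)
    (fun i j => contDiff_adjugate (contDiff_hessian hv (by norm_num)) j i)
    (fun j x => by simpa only [hsymm _ j] using sum_dirDeriv_adjugate_hessian_eq_zero hv j x)
    (fun i x => sum_dirDeriv_adjugate_hessian_eq_zero hv i x) hw hφ hφc
  simp only [det_updateRow_eq_sum_adjugate, hessian_apply hw, hessian_apply hφ]
  rw [hparts]
  simp only [dirDeriv_comm hφ]

end Hessian

section ParametricIntegral

theorem fderiv_eq_zero_of_forall_notMem {P V : Type*} [NormedAddCommGroup P] [NormedSpace ℝ P]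
    [NormedAddCommGroup V] [NormedSpace ℝ V] {Φ : P × V → ℝ} {K : Set V} (hK : IsClosed K)
    (hzero : ∀ p, ∀ z ∉ K, Φ (p, z) = 0) (p : P) {z : V} (hz : z ∉ K) :
    fderiv ℝ Φ (p, z) = 0 := by
  have h : Φ =ᶠ[nhds (p, z)] 0 := Filter.mem_of_superset
    ((hK.isOpen_compl.preimage continuous_snd).mem_nhds hz) fun q hq => hzero q.1 q.2 hq
  simpa using h.fderiv_eq (𝕜 := ℝ)

variable {V P : Type*} [NormedAddCommGroup V] [NormedSpace ℝ V] [FiniteDimensional ℝ V]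
  [MeasurableSpace V] [BorelSpace V] {μ : Measure V} [μ.IsAddHaarMeasure]
  [NormedAddCommGroup P] [NormedSpace ℝ P] {Φ : P × V → ℝ} {K : Set V}

theorem contDiff_integral_of_compact (hK : IsCompact K)
    (hzero : ∀ p, ∀ z ∉ K, Φ (p, z) = 0) {k : ℕ∞} (hΦ : ContDiff ℝ k Φ) :
    ContDiff ℝ k fun p => ∫ z, Φ (p, z) ∂μ := by
  have h := contDiffOn_convolution_right_with_param_comp (𝕜 := ℝ) (μ := μ)
    (n := k) (ContinuousLinearMap.lsmul ℝ ℝ) (s := (Set.univ : Set P)) (v := fun _ => (0 : V))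
    contDiffOn_const (f := fun _ => (1 : ℝ)) (g := fun p y => Φ (p, -y)) (k := -K)
    isOpen_univ hK.neg (fun p x _ hx => hzero p (-x) (by simpa using hx))
    (locallyIntegrable_const _) (by
      rw [Set.univ_prod_univ, contDiffOn_univ]
      exact hΦ.comp (contDiff_fst.prodMk contDiff_snd.neg))
  simpa [convolution, contDiffOn_univ] using h

theorem dirDeriv_integral_of_compact (hK : IsCompact K)
    (hzero : ∀ p, ∀ z ∉ K, Φ (p, z) = 0) (hΦ : ContDiff ℝ 1 Φ) (v p : P) :
    dirDeriv v (fun p => ∫ z, Φ (p, z) ∂μ) p = ∫ z, dirDeriv (v, 0) Φ (p, z) ∂μ := by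
  have hneg (z : V) : fderiv ℝ (fun q : P × V => Φ (q.1, -q.2)) (p, -z) (v, 0) =
      dirDeriv (v, 0) Φ (p, z) := by
    have hΦd : HasFDerivAt Φ (fderiv ℝ Φ (p, z)) (p, - -z) := by
      simpa using (hΦ.differentiable one_ne_zero (p, z)).hasFDerivAt
    have hcomp : HasFDerivAt (fun q : P × V => Φ (q.1, -q.2)) _ (p, -z) :=
      hΦd.comp (p, -z) (hasFDerivAt_fst.prodMk hasFDerivAt_snd.neg)
    rw [hcomp.fderiv]
    simp [dirDeriv]
  have hzero' (p : P) (z : V) (hz : z ∉ -K) : Φ (p, -z) = 0 := hzero p (-z) (by simpa using hz)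
  have hΦneg : ContDiff ℝ 1 fun q : P × V => Φ (q.1, -q.2) :=
    hΦ.comp (contDiff_fst.prodMk contDiff_snd.neg)
  have hint : Integrable (fun z => fderiv ℝ (fun q : P × V => Φ (q.1, -q.2)) (p, -z)) μ :=
    ((hΦneg.continuous_fderiv one_ne_zero).comp (by fun_prop)).integrable_of_hasCompactSupport
      (HasCompactSupport.intro hK fun z hz => fderiv_eq_zero_of_forall_notMem hK.neg.isClosed
        hzero' p (by simpa using hz))
  have hconv := (hasFDerivAt_convolution_right_with_param (𝕜 := ℝ) (μ := μ)
    (f := fun _ => (1 : ℝ)) (g := fun p y => Φ (p, -y)) (ContinuousLinearMap.lsmul ℝ ℝ)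
    (s := Set.univ) isOpen_univ hK.neg (fun p z _ hz => hzero' p z hz)
    (locallyIntegrable_const _) hΦneg.contDiffOn (p, 0) (Set.mem_univ _)).comp p
    (f := fun p : P => (p, (0 : V))) (hasFDerivAt_prodMk_left p (0 : V))
  simp only [convolution, Function.comp_def, ContinuousLinearMap.lsmul_apply, one_smul, zero_sub,
    neg_neg] at hconv
  rw [dirDeriv, hconv.fderiv]
  have hone (T : P × V →L[ℝ] ℝ) :
    (((ContinuousLinearMap.lsmul ℝ ℝ : ℝ →L[ℝ] ℝ →L[ℝ] ℝ).precompR (P × V)) 1) T = T := by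
    ext <;> simp
  simp only [hone, ContinuousLinearMap.comp_apply, ContinuousLinearMap.inl_apply]
  exact (ContinuousLinearMap.integral_apply hint (v, 0)).trans
    (integral_congr_ae (.of_forall hneg))

end ParametricIntegral

section ScaleAvg

variable {V : Type*} [NormedAddCommGroup V] [NormedSpace ℝ V]

theorem contDiff_mul_comp_sub_smul {k : WithTop ℕ∞} {ψ F : V → ℝ}
    (hψ : ContDiff ℝ k ψ) (hF : ContDiff ℝ k F) :
    ContDiff ℝ k fun q : (ℝ × V) × V => ψ q.2 * F (q.1.2 - q.1.1 • q.2) :=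
  (hψ.comp contDiff_snd).mul <| hF.comp <| (contDiff_snd.comp contDiff_fst).sub
    ((contDiff_fst.comp contDiff_fst).smul contDiff_snd)

variable [MeasureSpace V]

/-- The average `∫ ψ(z) F(x - t z) dz` of `F` at scale `t` around `x`, as a function of the pair
`(t, x)`. -/
def scaleAvg (ψ F : V → ℝ) (p : ℝ × V) : ℝ := ∫ z, ψ z * F (p.2 - p.1 • z)

variable [BorelSpace V] [FiniteDimensional ℝ V] [(volume : Measure V).IsAddHaarMeasure]
  {ψ F : V → ℝ}

theorem contDiff_scaleAvg {k : ℕ∞} (hψ : ContDiff ℝ k ψ) (hψc : HasCompactSupport ψ)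
    (hF : ContDiff ℝ k F) : ContDiff ℝ k (scaleAvg ψ F) :=
  contDiff_integral_of_compact (Φ := fun q : (ℝ × V) × V => ψ q.2 * F (q.1.2 - q.1.1 • q.2)) hψc
    (fun _ _ hz => by rw [image_eq_zero_of_notMem_tsupport hz, zero_mul])
    (contDiff_mul_comp_sub_smul hψ hF)

theorem dirDeriv_scaleAvg (hψ : ContDiff ℝ 1 ψ) (hψc : HasCompactSupport ψ)
    (hF : ContDiff ℝ 1 F) (τ t : ℝ) (v x : V) :
    dirDeriv (τ, v) (scaleAvg ψ F) (t, x) = ∫ z, ψ z * fderiv ℝ F (x - t • z) (v - τ • z) := by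
  have hΦ := contDiff_mul_comp_sub_smul hψ hF
  refine (dirDeriv_integral_of_compact (μ := volume) hψc
    (fun _ _ hz => by rw [image_eq_zero_of_notMem_tsupport hz, zero_mul]) hΦ (τ, v) (t, x)).trans
    (integral_congr_ae (.of_forall fun z => ?_))
  refine dirDeriv_eq_of_hasDerivAt (hΦ.differentiable one_ne_zero _) ?_
  have hcurve : HasDerivAt (fun s : ℝ => x + s • v - (t + s * τ) • z) (v - τ • z) 0 := by
    have hx := ((hasDerivAt_id (0 : ℝ)).smul_const v).const_add x
    have ht := (((hasDerivAt_id (0 : ℝ)).mul_const τ).const_add t).smul_const z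
    simpa using hx.fun_sub ht
  have hFd : HasFDerivAt F (fderiv ℝ F (x - t • z)) (x + (0 : ℝ) • v - (t + 0 * τ) • z) := by
    simpa using (hF.differentiable one_ne_zero (x - t • z)).hasFDerivAt
  simpa using (hFd.comp_hasDerivAt (0 : ℝ) hcurve).const_mul (ψ z)

theorem dirDeriv_scaleAvg_space (hψ : ContDiff ℝ 1 ψ) (hψc : HasCompactSupport ψ)
    (hF : ContDiff ℝ 1 F) (v : V) :
    dirDeriv ((0 : ℝ), v) (scaleAvg ψ F) = scaleAvg ψ (dirDeriv v F) := by
  ext ⟨t, x⟩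
  rw [dirDeriv_scaleAvg hψ hψc hF]
  simp only [scaleAvg, dirDeriv, zero_smul, sub_zero]

theorem mul_scaleAvg_dirDeriv (hψ : ContDiff ℝ 1 ψ) (hψc : HasCompactSupport ψ)
    (hF : ContDiff ℝ 1 F) (v : V) (t : ℝ) (x : V) :
    t * scaleAvg ψ (dirDeriv v F) (t, x) = ∫ z, dirDeriv v ψ z * (F (x - t • z) - F x) := by
  have hh : ContDiff ℝ 1 fun z => F (x - t • z) - F x :=
    (hF.comp (contDiff_const.sub (contDiff_id.const_smul t))).sub contDiff_const
  have hd (z : V) : dirDeriv v (fun z => F (x - t • z) - F x) z =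
      -(t * dirDeriv v F (x - t • z)) := by
    refine dirDeriv_eq_of_hasDerivAt (hh.differentiable one_ne_zero z) ?_
    have hcurve : HasDerivAt (fun s : ℝ => x - t • (z + s • v)) (-(t • v)) 0 := by
      simpa using ((((hasDerivAt_id (0 : ℝ)).smul_const v).const_add z).const_smul t).const_sub x
    have hFd : HasFDerivAt F (fderiv ℝ F (x - t • z)) (x - t • (z + (0 : ℝ) • v)) := by
      simpa using (hF.differentiable one_ne_zero (x - t • z)).hasFDerivAt
    simpa [dirDeriv] using (hFd.comp_hasDerivAt (0 : ℝ) hcurve).sub_const (F x)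
  have hparts := integral_mul_dirDeriv (μ := volume) hψ hh hψc v
  simp only [hd] at hparts
  rw [← neg_inj, ← hparts, scaleAvg, ← integral_const_mul, ← integral_neg]
  exact integral_congr_ae (.of_forall fun z => by ring)

end ScaleAvg

section Jensen

theorem lintegral_rpow_le {α : Type*} [MeasurableSpace α] (ν : Measure α) {p : ℝ} (hp : 1 ≤ p)
    {f : α → ℝ≥0∞} (hf : AEMeasurable f ν) :
    (∫⁻ a, f a ∂ν) ^ p ≤ ν Set.univ ^ (p - 1) * ∫⁻ a, f a ^ p ∂ν := by
  have hp0 : 0 < p := by linarith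
  have h := eLpNorm'_le_eLpNorm'_mul_rpow_measure_univ (μ := ν) (f := f) one_pos hp
    hf.aestronglyMeasurable
  simp only [eLpNorm', enorm_eq_self, ENNReal.rpow_one, div_one] at h
  calc (∫⁻ a, f a ∂ν) ^ p
      ≤ ((∫⁻ a, f a ^ p ∂ν) ^ (1 / p) * ν Set.univ ^ (1 - 1 / p)) ^ p := by gcongr
    _ = _ := by
      rw [ENNReal.mul_rpow_of_nonneg _ _ hp0.le, ← ENNReal.rpow_mul, ← ENNReal.rpow_mul,
        one_div_mul_cancel hp0.ne', ENNReal.rpow_one, mul_comm]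
      congr 2
      field_simp

end Jensen

section Scaling

open Module (finrank)

variable {V : Type*} [NormedAddCommGroup V] [NormedSpace ℝ V] [FiniteDimensional ℝ V]
  [MeasureSpace V] [BorelSpace V]

theorem measurable_indicator_Ici_norm_sub {g : ℝ → ℝ≥0∞} (hg : Measurable g) :
    Measurable fun q : ℝ × (V × V) => (Set.Ici ‖q.2.1 - q.2.2‖).indicator g q.1 := by
  have heq : (fun q : ℝ × (V × V) => (Set.Ici ‖q.2.1 - q.2.2‖).indicator g q.1) =
      {q | ‖q.2.1 - q.2.2‖ ≤ q.1}.indicator fun q => g q.1 := by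
    ext q
    simp [Set.indicator_apply]
  rw [heq]
  exact (hg.comp measurable_fst).indicator (measurableSet_le (by fun_prop) (by fun_prop))

variable [(volume : Measure V).IsAddHaarMeasure]

theorem lintegral_comp_smul {t : ℝ} (ht : t ≠ 0) (h : V → ℝ≥0∞) :
    ∫⁻ z, h (t • z) = ENNReal.ofReal |(t ^ finrank ℝ V)⁻¹| * ∫⁻ y, h y := by
  have he : MeasurableEmbedding fun z : V => t • z :=
    (Homeomorph.smulOfNeZero t ht).measurableEmbedding
  rw [← he.lintegral_map, Measure.map_addHaar_smul _ ht, lintegral_smul_measure, smul_eq_mul]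

theorem lintegral_closedBall_comp_sub_smul {t : ℝ} (ht : 0 < t) (x : V) (h : V → ℝ≥0∞) :
    ∫⁻ z in Metric.closedBall 0 1, h (x - t • z) =
      ENNReal.ofReal (t ^ finrank ℝ V)⁻¹ *
        ∫⁻ y, (Set.Ici ‖x - y‖).indicator (fun _ => h y) t := by
  rw [← abs_of_pos (inv_pos.2 (pow_pos ht (finrank ℝ V))),
    ← lintegral_sub_left_eq_self (fun y => (Set.Ici ‖x - y‖).indicator (fun _ => h y) t) x,
    ← lintegral_comp_smul ht.ne', ← lintegral_indicator Metric.isClosed_closedBall.measurableSet]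
  refine lintegral_congr fun z => ?_
  classical
  simp only [Set.indicator_apply, Metric.mem_closedBall, dist_zero_right, Set.mem_Ici,
    sub_sub_cancel, norm_smul, Real.norm_eq_abs, abs_of_pos ht, mul_le_iff_le_one_right ht]

theorem lintegral_rpow_Ici_le {a r : ℝ} (ha : a ≤ -2) (hr : 0 ≤ r) :
    ∫⁻ t in Set.Ioi 0, (Set.Ici r).indicator (fun t => ENNReal.ofReal (t ^ a)) t ≤
      (ENNReal.ofReal r ^ (-a - 1))⁻¹ := by
  rcases hr.eq_or_lt with rfl | hr
  · rw [ENNReal.ofReal_zero, ENNReal.zero_rpow_of_pos (by linarith), ENNReal.inv_zero]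
    exact le_top
  have hpos : 0 < r ^ (a + 1) := Real.rpow_pos_of_pos hr _
  calc ∫⁻ t in Set.Ioi 0, (Set.Ici r).indicator (fun t => ENNReal.ofReal (t ^ a)) t
      ≤ ∫⁻ t in Set.Ici r, ENNReal.ofReal (t ^ a) := by
        rw [← lintegral_indicator measurableSet_Ici]
        exact setLIntegral_le_lintegral _ _
    _ = ENNReal.ofReal (∫ t in Set.Ioi r, t ^ a) := by
        rw [setLIntegral_congr (Ioi_ae_eq_Ici (a := r)).symm]
        exact (ofReal_integral_eq_lintegral_ofReal (integrableOn_Ioi_rpow_of_lt (by linarith) hr)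
          ((ae_restrict_iff' measurableSet_Ioi).2 (.of_forall fun t ht =>
            Real.rpow_nonneg (hr.le.trans (le_of_lt ht)) _))).symm
    _ ≤ ENNReal.ofReal (r ^ (a + 1)) := by
        rw [integral_Ioi_rpow_of_lt (by linarith) hr, neg_div, ← div_neg]
        exact ENNReal.ofReal_le_ofReal (div_le_self hpos.le (by linarith))
    _ = (ENNReal.ofReal r ^ (-a - 1))⁻¹ := by
        rw [ENNReal.ofReal_rpow_of_pos hr, ← ENNReal.ofReal_inv_of_pos (Real.rpow_pos_of_pos hr _),
          ← Real.rpow_neg hr.le, neg_sub, sub_neg_eq_add, add_comm]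

theorem lintegral_lintegral_closedBall_comp_sub_smul {f : V × V → ℝ≥0∞} (hf : Measurable f)
    (a : ℝ) {t : ℝ} (ht : 0 < t) :
    ENNReal.ofReal (t ^ a) * ∫⁻ x, ∫⁻ z in Metric.closedBall 0 1, f (x, x - t • z) =
      ∫⁻ z : V × V, f z * (Set.Ici ‖z.1 - z.2‖).indicator
        (fun t => ENNReal.ofReal (t ^ (a - finrank ℝ V))) t := by
  have hpow : t ^ a * (t ^ finrank ℝ V)⁻¹ = t ^ (a - finrank ℝ V) := by
    rw [← Real.rpow_natCast, ← Real.rpow_neg ht.le, ← Real.rpow_add ht, sub_eq_add_neg]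
  have hmeas : Measurable fun z : V × V => f z * (Set.Ici ‖z.1 - z.2‖).indicator
      (fun t => ENNReal.ofReal (t ^ (a - finrank ℝ V))) t :=
    hf.mul ((measurable_indicator_Ici_norm_sub
      (g := fun t => ENNReal.ofReal (t ^ (a - finrank ℝ V))) (by fun_prop)).comp
        measurable_prodMk_left)
  rw [Measure.volume_eq_prod, lintegral_prod _ hmeas.aemeasurable,
    ← lintegral_const_mul' _ _ ENNReal.ofReal_ne_top]
  refine lintegral_congr fun x => ?_
  rw [lintegral_closedBall_comp_sub_smul ht x (fun y => f (x, y)), ← mul_assoc,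
    ← ENNReal.ofReal_mul (Real.rpow_nonneg ht.le _), hpow,
    ← lintegral_const_mul' _ _ ENNReal.ofReal_ne_top]
  refine lintegral_congr fun y => ?_
  by_cases hy : t ∈ Set.Ici ‖x - y‖
  · simp only [Set.indicator_of_mem hy, mul_comm]
  · simp only [Set.indicator_of_notMem hy, mul_zero]

theorem lintegral_scales_le {f : V × V → ℝ≥0∞} (hf : Measurable f) {a : ℝ}
    (ha : a ≤ finrank ℝ V - 2) :
    ∫⁻ t in Set.Ioi (0 : ℝ), ENNReal.ofReal (t ^ a) *
        ∫⁻ x, ∫⁻ z in Metric.closedBall 0 1, f (x, x - t • z) ≤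
      ∫⁻ z : V × V, f z / ‖z.1 - z.2‖ₑ ^ (finrank ℝ V - a - 1) := by
  rw [setLIntegral_congr_fun measurableSet_Ioi fun t ht =>
      lintegral_lintegral_closedBall_comp_sub_smul hf a ht,
    lintegral_lintegral_swap ((hf.comp measurable_snd).mul
      (measurable_indicator_Ici_norm_sub (by fun_prop))).aemeasurable]
  refine lintegral_mono fun z => ?_
  have hm : Measurable ((Set.Ici ‖z.1 - z.2‖).indicator
      fun t : ℝ => ENNReal.ofReal (t ^ (a - finrank ℝ V))) :=
    Measurable.indicator (by fun_prop) measurableSet_Ici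
  rw [lintegral_const_mul _ hm, div_eq_mul_inv]
  gcongr
  refine (lintegral_rpow_Ici_le (by linarith) (norm_nonneg _)).trans_eq ?_
  rw [ofReal_norm, neg_sub]

end Scaling

section Mollifier

variable {V : Type*} [NormedAddCommGroup V] [NormedSpace ℝ V] [MeasureSpace V]

/-- The mean oscillation of `Du` at scale `t` around `x`. -/
def osc (u : V → ℝ) (t : ℝ) (x : V) : ℝ≥0∞ :=
  ∫⁻ z in Metric.closedBall 0 1, ‖fderiv ℝ u x - fderiv ℝ u (x - t • z)‖ₑ

variable {u : V → ℝ} {K : ℝ}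

theorem enorm_integral_mul_le_osc [BorelSpace V] {k q : V → ℝ} {t : ℝ} {x : V}
    (hk : ∀ z, |k z| ≤ K) (hk₀ : ∀ z ∉ Metric.closedBall (0 : V) 1, k z = 0)
    (hq : ∀ z ∈ Metric.closedBall (0 : V) 1,
      ‖q z‖ₑ ≤ ‖fderiv ℝ u x - fderiv ℝ u (x - t • z)‖ₑ) :
    ‖∫ z, k z * q z‖ₑ ≤ ENNReal.ofReal K * osc u t x := by
  refine (enorm_integral_le_lintegral_enorm _).trans ?_
  rw [osc, ← lintegral_const_mul' _ _ ENNReal.ofReal_ne_top,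
    ← lintegral_indicator Metric.isClosed_closedBall.measurableSet]
  refine lintegral_mono fun z => ?_
  by_cases hz : z ∈ Metric.closedBall (0 : V) 1
  · simp only [Set.indicator_of_mem hz]
    rw [enorm_mul, Real.enorm_eq_ofReal_abs]
    exact mul_le_mul' (ENNReal.ofReal_le_ofReal (hk z)) (hq z hz)
  · simp [Set.indicator_of_notMem hz, hk₀ z hz]

variable [FiniteDimensional ℝ V]

variable (V) in
/-- A bump function supported in the closed unit ball. -/
def unitBump : ContDiffBump (0 : V) := ⟨1 / 2, 1, by norm_num, by norm_num⟩

variable (V) in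
/-- A smooth even probability density supported in the closed unit ball. -/
def mollifier : V → ℝ := (unitBump V).normed volume

theorem contDiff_mollifier {k : ℕ∞} : ContDiff ℝ k (mollifier V) := (unitBump V).contDiff_normed

theorem mollifier_neg (z : V) : mollifier V (-z) = mollifier V z := (unitBump V).normed_neg z

variable [BorelSpace V] [(volume : Measure V).IsAddHaarMeasure]

theorem hasCompactSupport_mollifier : HasCompactSupport (mollifier V) :=
  (unitBump V).hasCompactSupport_normed

theorem integral_mollifier : ∫ z, mollifier V z = 1 := (unitBump V).integral_normed

theorem tsupport_mollifier : tsupport (mollifier V) = Metric.closedBall 0 1 :=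
  (unitBump V).tsupport_normed_eq

theorem scaleAvg_mollifier_zero (F : V → ℝ) (x : V) : scaleAvg (mollifier V) F (0, x) = F x := by
  simp only [scaleAvg, zero_smul, sub_zero, integral_mul_const, integral_mollifier, one_mul]

variable (V) in
theorem exists_mollifier_bound :
    ∃ K : ℝ, 0 ≤ K ∧ (∀ z, |mollifier V z| ≤ K) ∧ ∀ z, ‖fderiv ℝ (mollifier V) z‖ ≤ K := by
  obtain ⟨K₀, hK₀⟩ := (contDiff_mollifier (V := V) (k := 0)).continuous
    |>.bounded_above_of_compact_support hasCompactSupport_mollifier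
  obtain ⟨K₁, hK₁⟩ := ((contDiff_mollifier (V := V) (k := 1)).continuous_fderiv one_ne_zero)
    |>.bounded_above_of_compact_support (hasCompactSupport_mollifier.fderiv ℝ)
  exact ⟨max K₀ K₁, (norm_nonneg _).trans ((hK₀ 0).trans (le_max_left _ _)),
    fun z => (hK₀ z).trans (le_max_left _ _), fun z => (hK₁ z).trans (le_max_right _ _)⟩

theorem integral_mollifier_mul_clm (T : V →L[ℝ] ℝ) : ∫ z, mollifier V z * T z = 0 := by
  have h := integral_neg_eq_self (fun z => mollifier V z * T z) volume
  simp only [mollifier_neg, map_neg, mul_neg, integral_neg] at h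
  linarith

theorem enorm_dirDeriv_scaleAvg_mollifier_le (hu : ContDiff ℝ 1 u)
    (hK : ∀ z, |mollifier V z| ≤ K) (t : ℝ) (x : V) :
    ‖dirDeriv ((1 : ℝ), (0 : V)) (scaleAvg (mollifier V) u) (t, x)‖ₑ ≤
      ENNReal.ofReal K * osc u t x := by
  have hmc : Continuous (mollifier V) := (contDiff_mollifier (k := 0)).continuous
  have hint {g : V → ℝ} (hg : Continuous g) : Integrable fun z => mollifier V z * g z :=
    (hmc.mul hg).integrable_of_hasCompactSupport hasCompactSupport_mollifier.mul_right
  have hcd : Continuous fun z => fderiv ℝ u (x - t • z) z :=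
    ((hu.continuous_fderiv one_ne_zero).comp (by fun_prop)).clm_apply continuous_id
  -- The mollifier is even, so `Du(x)` may be subtracted from `Du(x - t z)`.
  have hodd : ∫ z, mollifier V z * fderiv ℝ u (x - t • z) (0 - (1 : ℝ) • z) =
      ∫ z, mollifier V z * (fderiv ℝ u x z - fderiv ℝ u (x - t • z) z) := by
    simp only [one_smul, zero_sub, map_neg, mul_neg, integral_neg, mul_sub]
    rw [integral_sub (hint (fderiv ℝ u x).continuous) (hint hcd), integral_mollifier_mul_clm,
      zero_sub]
  rw [dirDeriv_scaleAvg (contDiff_mollifier (k := 1)) hasCompactSupport_mollifier hu, hodd]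
  refine enorm_integral_mul_le_osc hK
    (fun z hz => image_eq_zero_of_notMem_tsupport (by rwa [tsupport_mollifier])) fun z hz => ?_
  rw [← _root_.sub_apply, enorm_le_iff_norm_le]
  exact ContinuousLinearMap.unit_le_opNorm _ _ (by simpa using hz)

theorem enorm_mul_scaleAvg_dirDeriv_dirDeriv_le (hu : ContDiff ℝ 2 u)
    (hK : ∀ z, ‖fderiv ℝ (mollifier V) z‖ ≤ K) {v w : V} (hv : ‖v‖ ≤ 1) (hw : ‖w‖ ≤ 1) (t : ℝ)
    (x : V) :
    ‖t * scaleAvg (mollifier V) (dirDeriv v (dirDeriv w u)) (t, x)‖ₑ ≤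
      ENNReal.ofReal K * osc u t x := by
  rw [mul_scaleAvg_dirDeriv (contDiff_mollifier (k := 1)) hasCompactSupport_mollifier
    (contDiff_dirDeriv hu (by norm_num) _)]
  refine enorm_integral_mul_le_osc
    (fun z => (ContinuousLinearMap.unit_le_opNorm _ _ hv).trans (hK z))
    (fun z hz => dirDeriv_eq_zero_of_notMem_tsupport (by rwa [tsupport_mollifier]) v)
    fun z _ => ?_
  rw [dirDeriv, dirDeriv, ← _root_.sub_apply, enorm_le_iff_norm_le, norm_sub_rev]
  exact ContinuousLinearMap.unit_le_opNorm _ _ hw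

end Mollifier

section Evolution

section

variable {V : Type*} [NormedAddCommGroup V] [NormedSpace ℝ V]

theorem dirDeriv_slice {F : ℝ × V → ℝ} {t : ℝ} {x : V} (hF : DifferentiableAt ℝ F (t, x))
    (v : V) : dirDeriv v (fun y => F (t, y)) x = dirDeriv ((0 : ℝ), v) F (t, x) := by
  have h : HasFDerivAt (fun y => F (t, y))
      (fderiv ℝ F (t, x) ∘L ContinuousLinearMap.inr ℝ ℝ V) x :=
    HasFDerivAt.comp x (g := F) hF.hasFDerivAt (hasFDerivAt_prodMk_right t x)
  simp [dirDeriv, h.fderiv]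

theorem dirDeriv_comp_snd {φ : V → ℝ} {t : ℝ} {x : V} (hφ : DifferentiableAt ℝ φ x) :
    dirDeriv ((1 : ℝ), (0 : V)) (fun q => φ q.2) (t, x) = 0 :=
  dirDeriv_eq_of_hasDerivAt (DifferentiableAt.comp (t, x) (g := φ) hφ differentiableAt_snd)
    (by simpa using hasDerivAt_const (0 : ℝ) (φ x))

end

variable {N : ℕ} {U : ℝ × E N → ℝ}

/-- The Hessian of the slice `U(t, ·)` at `x`, as a function of `(t, x)`. -/
def sliceHessian (U : ℝ × E N → ℝ) (p : ℝ × E N) : Matrix (Fin N) (Fin N) ℝ :=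
  hessian (fun y => U (p.1, y)) p.2

theorem sliceHessian_apply (hU : ContDiff ℝ 2 U) (p : ℝ × E N) (i j : Fin N) :
    sliceHessian U p i j =
      dirDeriv ((0 : ℝ), stdVec i) (dirDeriv ((0 : ℝ), stdVec j) U) p := by
  have hj : dirDeriv (stdVec j) (fun y => U (p.1, y)) =
      fun y => dirDeriv ((0 : ℝ), stdVec j) U (p.1, y) :=
    funext fun y => dirDeriv_slice (hU.differentiable two_ne_zero _) _
  have hs : ContDiff ℝ 2 fun y => U (p.1, y) := hU.comp (contDiff_prodMk_right p.1)
  rw [sliceHessian, hessian_apply hs, hj]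
  exact dirDeriv_slice
    ((contDiff_dirDeriv hU (m := 1) (by norm_num) _).differentiable one_ne_zero _) _

theorem contDiff_sliceHessian (hU : ContDiff ℝ 3 U) (i j : Fin N) :
    ContDiff ℝ 1 fun p => sliceHessian U p i j := by
  simp only [sliceHessian_apply (hU.of_le (by norm_num))]
  exact contDiff_dirDeriv (contDiff_dirDeriv hU (m := 2) (by norm_num) _) (by norm_num) _

theorem sliceHessian_dirDeriv (hU : ContDiff ℝ 3 U) (p w : ℝ × E N) (i j : Fin N) :
    sliceHessian (dirDeriv w U) p i j = dirDeriv w (fun q => sliceHessian U q i j) p := by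
  have hU₂ : ContDiff ℝ 2 U := hU.of_le (by norm_num)
  have hd (v) : ContDiff ℝ 2 (dirDeriv v U) := contDiff_dirDeriv hU (by norm_num) v
  rw [sliceHessian_apply (hd _), dirDeriv_comm hU₂, dirDeriv_comm (hd _)]
  exact congrArg (dirDeriv w · p) (funext fun q => (sliceHessian_apply hU₂ q i j).symm)

theorem contDiff_det_sliceHessian_mul (hU : ContDiff ℝ 3 U) {φ : E N → ℝ} (hφ : ContDiff ℝ 1 φ) :
    ContDiff ℝ 1 fun q : ℝ × E N => (sliceHessian U q).det * φ q.2 :=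
  (contDiff_det (contDiff_sliceHessian hU)).mul (hφ.comp contDiff_snd)

theorem dirDeriv_det_sliceHessian_mul (hU : ContDiff ℝ 3 U) {φ : E N → ℝ} (t : ℝ) {x : E N}
    (hφ : DifferentiableAt ℝ φ x) :
    dirDeriv ((1 : ℝ), (0 : E N)) (fun q => (sliceHessian U q).det * φ q.2) (t, x) =
      (∑ i, ((sliceHessian U (t, x)).updateRow i
        (sliceHessian (dirDeriv ((1 : ℝ), (0 : E N)) U) (t, x) i)).det) * φ x := by
  have hA := contDiff_sliceHessian hU
  have hφ' : DifferentiableAt ℝ (fun q : ℝ × E N => φ q.2) (t, x) :=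
    DifferentiableAt.comp (t, x) (g := φ) hφ differentiableAt_snd
  rw [dirDeriv_mul ((contDiff_det hA).differentiable one_ne_zero _) hφ', dirDeriv_comp_snd hφ,
    mul_zero, add_zero, dirDeriv_det fun i j => (hA i j).differentiable one_ne_zero _]
  simp only [← sliceHessian_dirDeriv hU]

variable {φ : E N → ℝ}

theorem contDiff_integral_det_sliceHessian_mul (hU : ContDiff ℝ 3 U) (hφ : ContDiff ℝ 1 φ)
    (hφc : HasCompactSupport φ) :
    ContDiff ℝ 1 fun t => ∫ x, (sliceHessian U (t, x)).det * φ x :=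
  contDiff_integral_of_compact (k := 1) (Φ := fun q => (sliceHessian U q).det * φ q.2) hφc
    (fun _ _ hx => by rw [image_eq_zero_of_notMem_tsupport hx, mul_zero])
    (contDiff_det_sliceHessian_mul hU hφ)

theorem deriv_integral_det_sliceHessian_mul (hU : ContDiff ℝ 3 U) (hφ : ContDiff ℝ 2 φ)
    (hφc : HasCompactSupport φ) (t : ℝ) :
    deriv (fun t => ∫ x, (sliceHessian U (t, x)).det * φ x) t =
      ∫ x, (∑ i, ((sliceHessian U (t, x)).updateRow i (hessian φ x i)).det) *
        dirDeriv ((1 : ℝ), (0 : E N)) U (t, x) := by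
  have hφ₁ : ContDiff ℝ 1 φ := hφ.of_le one_le_two
  have hslice : ContDiff ℝ 3 fun y : E N => U (t, y) := hU.comp (contDiff_prodMk_right t)
  have hslice' : ContDiff ℝ 2 fun y : E N => dirDeriv ((1 : ℝ), (0 : E N)) U (t, y) :=
    (contDiff_dirDeriv hU (by norm_num) _).comp (contDiff_prodMk_right t)
  have hdiff := dirDeriv_integral_of_compact (μ := volume)
    (Φ := fun q => (sliceHessian U q).det * φ q.2) hφc
    (fun _ _ hx => by rw [image_eq_zero_of_notMem_tsupport hx, mul_zero])
    (contDiff_det_sliceHessian_mul hU hφ₁) (1 : ℝ) t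
  rw [dirDeriv, fderiv_apply_one_eq_deriv] at hdiff
  calc deriv (fun t => ∫ x, (sliceHessian U (t, x)).det * φ x) t
      = ∫ x, dirDeriv ((1 : ℝ), (0 : E N)) (fun q => (sliceHessian U q).det * φ q.2) (t, x) :=
        hdiff
    _ = ∫ x, (∑ i, ((sliceHessian U (t, x)).updateRow i
          (sliceHessian (dirDeriv ((1 : ℝ), (0 : E N)) U) (t, x) i)).det) * φ x := by
        congr with x
        exact dirDeriv_det_sliceHessian_mul hU t (hφ₁.differentiable one_ne_zero x)
    _ = _ := integral_sum_det_updateRow_hessian_mul_comm (v := fun y => U (t, y))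
        (w := fun y => dirDeriv ((1 : ℝ), (0 : E N)) U (t, y)) hslice hslice' hφ hφc

end Evolution

section Oscillation

variable {V : Type*} [NormedAddCommGroup V] [NormedSpace ℝ V] [MeasureSpace V] {u : V → ℝ}

theorem osc_le {L : ℝ} (hL : ∀ x, ‖fderiv ℝ u x‖ ≤ L) (t : ℝ) (x : V) :
    osc u t x ≤ ENNReal.ofReal (2 * L) * volume (Metric.closedBall (0 : V) 1) := by
  rw [osc, ← setLIntegral_const]
  refine lintegral_mono fun z => ?_
  rw [← ofReal_norm]
  refine ENNReal.ofReal_le_ofReal ((norm_sub_le _ _).trans ?_)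
  linarith [hL x, hL (x - t • z)]

theorem rpow_osc_le [BorelSpace V] {p : ℝ} (hp : 1 ≤ p) (hu : ContDiff ℝ 1 u) (t : ℝ) (x : V) :
    osc u t x ^ p ≤ volume (Metric.closedBall (0 : V) 1) ^ (p - 1) *
      ∫⁻ z in Metric.closedBall 0 1, ‖fderiv ℝ u x - fderiv ℝ u (x - t • z)‖ₑ ^ p := by
  have hc : Continuous fun z : V => ‖fderiv ℝ u x - fderiv ℝ u (x - t • z)‖ₑ :=
    (continuous_const.sub ((hu.continuous_fderiv one_ne_zero).comp (by fun_prop))).enorm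
  simpa [osc] using
    lintegral_rpow_le (volume.restrict (Metric.closedBall 0 1)) hp hc.measurable.aemeasurable

theorem exists_osc_le [ProperSpace V] [IsFiniteMeasureOnCompacts (volume : Measure V)]
    (hu : ContDiff ℝ 1 u) (huc : HasCompactSupport u) : ∃ R : ℝ≥0, ∀ t x, osc u t x ≤ R := by
  obtain ⟨L, hL⟩ := (hu.continuous_fderiv one_ne_zero).bounded_above_of_compact_support
    (huc.fderiv ℝ)
  have hR : ENNReal.ofReal (2 * L) * volume (Metric.closedBall (0 : V) 1) ≠ ∞ :=
    ENNReal.mul_ne_top ENNReal.ofReal_ne_top measure_closedBall_lt_top.ne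
  exact ⟨_, fun t x => (osc_le hL t x).trans_eq (ENNReal.coe_toNNReal hR).symm⟩

end Oscillation

section Diagonal

open Filter Topology

theorem abs_le_of_enorm_le_ofReal_mul {a K : ℝ} {m : ℝ≥0∞} (hK : 0 ≤ K) (hm : m ≠ ∞)
    (h : ‖a‖ₑ ≤ ENNReal.ofReal K * m) : |a| ≤ K * m.toReal := by
  have := ENNReal.toReal_mono (ENNReal.mul_ne_top ENNReal.ofReal_ne_top hm) h
  rwa [ENNReal.toReal_mul, ENNReal.toReal_ofReal hK, toReal_enorm, Real.norm_eq_abs] at this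

theorem enorm_le_lintegral_deriv_of_tendsto_zero {g : ℝ → ℝ} (hg : ContDiff ℝ 1 g)
    (h₀ : Tendsto g atTop (𝓝 0)) : ‖g 0‖ₑ ≤ ∫⁻ t in Set.Ioi (0 : ℝ), ‖deriv g t‖ₑ := by
  have hle (b : ℝ) (hb : 0 ≤ b) : ‖g b - g 0‖ₑ ≤ ∫⁻ t in Set.Ioi (0 : ℝ), ‖deriv g t‖ₑ := by
    rw [← intervalIntegral.integral_deriv_eq_sub (fun t _ => hg.differentiable one_ne_zero t)
        ((hg.continuous_deriv le_rfl).intervalIntegrable _ _),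
      intervalIntegral.integral_of_le hb]
    exact (enorm_integral_le_lintegral_enorm _).trans
      (lintegral_mono_set Set.Ioc_subset_Ioi_self)
  have hlim : Tendsto (fun b => ‖g b - g 0‖ₑ) atTop (𝓝 ‖g 0‖ₑ) := by
    simpa using (h₀.sub_const (g 0)).enorm
  exact le_of_tendsto hlim ((eventually_ge_atTop 0).mono hle)

variable {N : ℕ} {u φ : E N → ℝ} {K : ℝ}

theorem contDiff_scaleAvg_mollifier {k : ℕ∞} (hu : ContDiff ℝ k u) :
    ContDiff ℝ k (scaleAvg (mollifier (E N)) u) :=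
  contDiff_scaleAvg contDiff_mollifier hasCompactSupport_mollifier hu

theorem abs_sliceHessian_scaleAvg_mollifier_le (hu : ContDiff ℝ 2 u) (hK₀ : 0 ≤ K)
    (hK : ∀ z, ‖fderiv ℝ (mollifier (E N)) z‖ ≤ K) {t : ℝ} (ht : 0 < t) {x : E N}
    (hfin : osc u t x ≠ ∞) (i j : Fin N) :
    |sliceHessian (scaleAvg (mollifier (E N)) u) (t, x) i j| ≤ K * (osc u t x).toReal / t := by
  have hψ : ContDiff ℝ 1 (mollifier (E N)) := contDiff_mollifier (k := 1)
  rw [sliceHessian_apply (contDiff_scaleAvg_mollifier (k := 2) hu),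
    dirDeriv_scaleAvg_space hψ hasCompactSupport_mollifier (hu.of_le one_le_two),
    dirDeriv_scaleAvg_space hψ hasCompactSupport_mollifier
      (contDiff_dirDeriv hu (by norm_num) _), le_div_iff₀ ht, ← abs_of_pos ht, ← abs_mul, mul_comm,
    abs_of_pos ht]
  exact abs_le_of_enorm_le_ofReal_mul hK₀ hfin
    (enorm_mul_scaleAvg_dirDeriv_dirDeriv_le hu hK (by simp) (by simp) t x)

theorem tendsto_integral_det_sliceHessian_scaleAvg (hN : N ≠ 0) (hu : ContDiff ℝ 2 u)
    (huc : HasCompactSupport u) (hφ : Integrable φ) :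
    Tendsto (fun t => ∫ x, (sliceHessian (scaleAvg (mollifier (E N)) u) (t, x)).det * φ x)
      atTop (𝓝 0) := by
  obtain ⟨K, hK₀, -, hK⟩ := exists_mollifier_bound (E N)
  obtain ⟨R, hR⟩ := exists_osc_le (hu.of_le one_le_two) huc
  have hH (t : ℝ) (ht : 0 < t) (x : E N) (i j : Fin N) :
      |sliceHessian (scaleAvg (mollifier (E N)) u) (t, x) i j| ≤ K * R / t := by
    refine (abs_sliceHessian_scaleAvg_mollifier_le hu hK₀ hK ht
      (ne_top_of_le_ne_top ENNReal.coe_ne_top (hR t x)) i j).trans ?_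
    gcongr
    exact ENNReal.toReal_mono ENNReal.coe_ne_top (hR t x)
  refine squeeze_zero_norm' (a := fun t => (N.factorial * (K * R / t) ^ N) * ∫ x, ‖φ x‖) ?_ ?_
  · filter_upwards [eventually_gt_atTop 0] with t ht
    rw [← integral_const_mul]
    refine norm_integral_le_of_norm_le (hφ.norm.const_mul _) (.of_forall fun x => ?_)
    rw [norm_mul]
    gcongr
    simpa using abs_det_le (hH t ht x)
  · have hlim : Tendsto (fun t : ℝ => K * R / t) atTop (𝓝 0) :=
      tendsto_const_nhds.div_atTop tendsto_id
    simpa [hN] using ((hlim.pow N).const_mul (N.factorial : ℝ)).mul_const (∫ x, ‖φ x‖)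

theorem abs_evolution_integrand_le (hN : N ≠ 0) (hu : ContDiff ℝ 2 u) (hK₀ : 0 ≤ K)
    (hK : ∀ z, |mollifier (E N) z| ≤ K) (hK' : ∀ z, ‖fderiv ℝ (mollifier (E N)) z‖ ≤ K)
    {M t : ℝ} {x : E N} (hM : ∀ i j, |hessian φ x i j| ≤ M) (ht : 0 < t)
    (hfin : osc u t x ≠ ∞) :
    |(∑ i, ((sliceHessian (scaleAvg (mollifier (E N)) u) (t, x)).updateRow i
        (hessian φ x i)).det) *
      dirDeriv ((1 : ℝ), (0 : E N)) (scaleAvg (mollifier (E N)) u) (t, x)| ≤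
    N * N.factorial * K ^ N * M * (t ^ (1 - N : ℝ) * (osc u t x).toReal ^ N) := by
  have hvelocity := abs_le_of_enorm_le_ofReal_mul hK₀ hfin
    (enorm_dirDeriv_scaleAvg_mollifier_le (hu.of_le one_le_two) hK t x)
  have hsum := abs_sum_det_updateRow_le
    (abs_sliceHessian_scaleAvg_mollifier_le hu hK₀ hK' ht hfin) hM
  rw [Fintype.card_fin] at hsum
  rw [abs_mul]
  refine (mul_le_mul hsum hvelocity (abs_nonneg _) ((abs_nonneg _).trans hsum)).trans_eq ?_
  obtain ⟨n, rfl⟩ := Nat.exists_eq_add_one_of_ne_zero hN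
  have ht' : t ^ (1 - (n + 1 : ℕ) : ℝ) = (t ^ n)⁻¹ := by
    rw [← Real.rpow_natCast, ← Real.rpow_neg ht.le]
    push_cast
    ring_nf
  rw [ht', Nat.add_sub_cancel, div_pow]
  ring

theorem enorm_deriv_integral_det_sliceHessian_le (hN : N ≠ 0) (hu : ContDiff ℝ 3 u)
    (huc : HasCompactSupport u) (hφ : ContDiff ℝ 2 φ) (hφc : HasCompactSupport φ) (hK₀ : 0 ≤ K)
    (hK : ∀ z, |mollifier (E N) z| ≤ K) (hK' : ∀ z, ‖fderiv ℝ (mollifier (E N)) z‖ ≤ K)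
    {M t : ℝ} (hM : ∀ᵐ x, ∀ i j, |hessian φ x i j| ≤ M) (ht : 0 < t) :
    ‖deriv (fun t => ∫ x, (sliceHessian (scaleAvg (mollifier (E N)) u) (t, x)).det * φ x) t‖ₑ ≤
      ENNReal.ofReal (N * N.factorial * K ^ N) *
        volume (Metric.closedBall (0 : E N) 1) ^ (N - 1 : ℝ) * ENNReal.ofReal M *
        (ENNReal.ofReal (t ^ (1 - N : ℝ)) * ∫⁻ x, ∫⁻ z in Metric.closedBall 0 1,
          ‖fderiv ℝ u x - fderiv ℝ u (x - t • z)‖ₑ ^ (N : ℝ)) := by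
  have hN₁ : (1 : ℝ) ≤ N := by exact_mod_cast Nat.one_le_iff_ne_zero.2 hN
  have hu₁ : ContDiff ℝ 1 u := hu.of_le (by norm_num)
  obtain ⟨R, hR⟩ := exists_osc_le hu₁ huc
  have hfin (x : E N) : osc u t x ≠ ∞ := ne_top_of_le_ne_top ENNReal.coe_ne_top (hR t x)
  have hvol : volume (Metric.closedBall (0 : E N) 1) ^ (N - 1 : ℝ) ≠ ∞ :=
    ENNReal.rpow_ne_top_of_nonneg (by linarith) measure_closedBall_lt_top.ne
  rw [deriv_integral_det_sliceHessian_mul (contDiff_scaleAvg_mollifier (k := 3) hu) hφ hφc]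
  calc _ ≤ ∫⁻ x, ENNReal.ofReal (N * N.factorial * K ^ N) * ENNReal.ofReal M *
          (ENNReal.ofReal (t ^ (1 - N : ℝ)) * osc u t x ^ (N : ℝ)) := by
        refine (enorm_integral_le_lintegral_enorm _).trans
          (lintegral_mono_ae (hM.mono fun x hx => ?_))
        rw [Real.enorm_eq_ofReal_abs, ENNReal.rpow_natCast, ← ENNReal.ofReal_toReal (hfin x),
          ← ENNReal.ofReal_pow ENNReal.toReal_nonneg,
          ← ENNReal.ofReal_mul (Real.rpow_nonneg ht.le _), ← ENNReal.ofReal_mul (by positivity),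
          ← ENNReal.ofReal_mul' (by positivity)]
        exact ENNReal.ofReal_le_ofReal
          (abs_evolution_integrand_le hN (hu.of_le (by norm_num)) hK₀ hK hK' hx ht (hfin x))
    _ ≤ ∫⁻ x, ENNReal.ofReal (N * N.factorial * K ^ N) * ENNReal.ofReal M *
          (ENNReal.ofReal (t ^ (1 - N : ℝ)) *
            (volume (Metric.closedBall (0 : E N) 1) ^ (N - 1 : ℝ) *
              ∫⁻ z in Metric.closedBall (0 : E N) 1,
                ‖fderiv ℝ u x - fderiv ℝ u (x - t • z)‖ₑ ^ (N : ℝ))) := by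
        gcongr with x
        exact rpow_osc_le hN₁ hu₁ t x
    _ = _ := by
        rw [lintegral_const_mul' _ _ (ENNReal.mul_ne_top ENNReal.ofReal_ne_top
            ENNReal.ofReal_ne_top), lintegral_const_mul' _ _ ENNReal.ofReal_ne_top,
          lintegral_const_mul' _ _ hvol]
        ring

theorem exists_enorm_integral_det_hessian_le (hN : 2 ≤ N) : ∃ C : ℝ≥0∞, C ≠ ∞ ∧
    ∀ (u φ : E N → ℝ) (M : ℝ), ContDiff ℝ 3 u → HasCompactSupport u → ContDiff ℝ 2 φ →
      HasCompactSupport φ → (∀ᵐ x, ∀ i j, |hessian φ x i j| ≤ M) →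
      ‖∫ x, (hessian u x).det * φ x‖ₑ ≤ C * ENNReal.ofReal M *
        ∫⁻ z : E N × E N, ‖fderiv ℝ u z.1 - fderiv ℝ u z.2‖ₑ ^ (N : ℝ) /
          ‖z.1 - z.2‖ₑ ^ (2 * N - 2 : ℝ) := by
  have hN₀ : N ≠ 0 := by omega
  have hN₂ : (2 : ℝ) ≤ N := by exact_mod_cast hN
  obtain ⟨K, hK₀, hK, hK'⟩ := exists_mollifier_bound (E N)
  have hC : ENNReal.ofReal (N * N.factorial * K ^ N) *
      volume (Metric.closedBall (0 : E N) 1) ^ (N - 1 : ℝ) ≠ ∞ :=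
    ENNReal.mul_ne_top ENNReal.ofReal_ne_top
      (ENNReal.rpow_ne_top_of_nonneg (by linarith) measure_closedBall_lt_top.ne)
  refine ⟨_, hC, fun u φ M hu huc hφ hφc hM => ?_⟩
  set g : ℝ → ℝ := fun t =>
    ∫ x, (sliceHessian (scaleAvg (mollifier (E N)) u) (t, x)).det * φ x with hg
  have hg₀ : g 0 = ∫ x, (hessian u x).det * φ x := by
    simp only [hg, sliceHessian, scaleAvg_mollifier_zero]
  have hg₁ : ContDiff ℝ 1 g := contDiff_integral_det_sliceHessian_mul
    (contDiff_scaleAvg_mollifier (k := 3) hu) (hφ.of_le one_le_two) hφc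
  have hlim : Tendsto g atTop (𝓝 0) := tendsto_integral_det_sliceHessian_scaleAvg hN₀
    (hu.of_le (by norm_num)) huc (hφ.continuous.integrable_of_hasCompactSupport hφc)
  have hDu : Continuous (fderiv ℝ u) := hu.continuous_fderiv (by norm_num)
  have hmeas : Measurable fun z : E N × E N => ‖fderiv ℝ u z.1 - fderiv ℝ u z.2‖ₑ ^ (N : ℝ) :=
    ((hDu.comp continuous_fst).sub (hDu.comp continuous_snd)).enorm.measurable.pow_const _
  have hscales := lintegral_scales_le hmeas (a := 1 - N)
    (by rw [finrank_euclideanSpace_fin]; linarith)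
  rw [finrank_euclideanSpace_fin, show (N - (1 - N) - 1 : ℝ) = 2 * N - 2 by ring] at hscales
  rw [← hg₀]
  refine (enorm_le_lintegral_deriv_of_tendsto_zero hg₁ hlim).trans (le_trans ?_
    (mul_le_mul_right hscales _))
  rw [← lintegral_const_mul' _ _ (ENNReal.mul_ne_top hC ENNReal.ofReal_ne_top)]
  exact setLIntegral_mono' measurableSet_Ioi fun t ht =>
    enorm_deriv_integral_det_sliceHessian_le hN₀ hu huc hφ hφc hK₀ hK hK' hM ht

end Diagonal

section Minkowski

variable {X Z : Type*} [MeasurableSpace X] [MeasurableSpace Z]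

theorem lintegral_rpow_lintegral_le (μ : Measure X) [SFinite μ] (ν : Measure Z) [SFinite ν]
    {p : ℝ} (hp : 1 ≤ p) {f : X × Z → ℝ≥0∞} (hf : Measurable f) :
    ∫⁻ x, (∫⁻ z, f (x, z) ∂ν) ^ p ∂μ ≤
      ν Set.univ ^ (p - 1) * ∫⁻ z, ∫⁻ x, f (x, z) ^ p ∂μ ∂ν := by
  have hm : Measurable fun x => ∫⁻ z, f (x, z) ^ p ∂ν :=
    (hf.pow_const p).lintegral_prod_right'
  calc ∫⁻ x, (∫⁻ z, f (x, z) ∂ν) ^ p ∂μ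
      ≤ ∫⁻ x, ν Set.univ ^ (p - 1) * ∫⁻ z, f (x, z) ^ p ∂ν ∂μ :=
        lintegral_mono fun x => lintegral_rpow_le ν hp
          (hf.comp measurable_prodMk_left).aemeasurable
    _ = ν Set.univ ^ (p - 1) * ∫⁻ x, ∫⁻ z, f (x, z) ^ p ∂ν ∂μ := lintegral_const_mul _ hm
    _ = _ := by
        rw [lintegral_lintegral_swap (hf.pow_const p).aemeasurable]

end Minkowski

section Translation

variable {X : Type*} [NormedAddCommGroup X] [MeasurableSpace X] [BorelSpace X]
variable {F : Type*} [NormedAddCommGroup F]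

theorem exists_forall_eLpNorm_translate_sub_le (μ : Measure X) [μ.IsAddRightInvariant]
    [IsLocallyFiniteMeasure μ] [μ.InnerRegularCompactLTTop] {p : ℝ≥0∞} [Fact (1 ≤ p)]
    (hp : p ≠ ∞) {f : X → F} (hf : MemLp f p μ) {ε : ℝ} (hε : 0 < ε) :
    ∃ δ > 0, ∀ z : X, ‖z‖ < δ →
      eLpNorm (fun x => f (x - z) - f x) p μ ≤ ENNReal.ofReal ε := by
  set g : C(X, C(X, X)) :=
    (ContinuousMap.mk (fun a : X × X => a.2 - a.1) (by fun_prop)).curry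
  have hgm : ∀ z, MeasurePreserving (g z) μ μ := fun z => measurePreserving_sub_right μ z
  have hcont : Continuous fun z => Lp.compMeasurePreserving (g z) (hgm z) (hf.toLp f) :=
    continuous_const.compMeasurePreservingLp g.continuous hgm hp
  have hzero : Lp.compMeasurePreserving (g 0) (hgm 0) (hf.toLp f) = hf.toLp f := by
    refine Lp.ext ((Lp.coeFn_compMeasurePreserving _ (hgm 0)).trans ?_)
    exact .of_forall fun x => congrArg (hf.toLp f) (sub_zero x)
  obtain ⟨δ, hδ, hclose⟩ := Metric.continuous_iff.1 hcont 0 ε hε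
  refine ⟨δ, hδ, fun z hz => ?_⟩
  have hdist := hclose z (by rwa [dist_zero_right])
  rw [hzero, dist_eq_norm, Lp.norm_def] at hdist
  have hrep : (fun x => f (x - z) - f x) =ᵐ[μ]
      (Lp.compMeasurePreserving (g z) (hgm z) (hf.toLp f) - hf.toLp f : Lp F p μ) := by
    filter_upwards [Lp.coeFn_sub (Lp.compMeasurePreserving (g z) (hgm z) (hf.toLp f)) (hf.toLp f),
      Lp.coeFn_compMeasurePreserving (hf.toLp f) (hgm z), hf.coeFn_toLp,
      (hgm z).quasiMeasurePreserving.ae_eq_comp hf.coeFn_toLp] with x hsub hcomp htoLp htranslate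
    rw [hsub, Pi.sub_apply, hcomp, htranslate, htoLp]
    rfl
  rw [eLpNorm_congr_ae hrep]
  exact (ENNReal.le_ofReal_iff_toReal_le (Lp.eLpNorm_ne_top _) hε.le).2 hdist.le

end Translation

section GagliardoBound

theorem integrableOn_min_one_rpow_mul_rpow {p σ : ℝ} (hp : 0 < p) (hσ : 0 < σ) (hσ' : σ < 1) :
    IntegrableOn (fun y : ℝ => min 1 y ^ p * y ^ (-1 - σ * p)) (Set.Ioi 0) := by
  rw [← Set.Ioc_union_Ioi_eq_Ioi (zero_le_one' ℝ), integrableOn_union]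
  constructor
  · have hnear : IntegrableOn (fun y : ℝ => y ^ (p - 1 - σ * p)) (Set.Ioc 0 1) := by
      rw [← intervalIntegrable_iff_integrableOn_Ioc_of_le zero_le_one]
      exact intervalIntegral.intervalIntegrable_rpow' (by nlinarith)
    refine hnear.congr_fun (fun y hy => ?_) measurableSet_Ioc
    simp only [min_eq_right hy.2, ← Real.rpow_add hy.1]
    ring_nf
  · have hfar : IntegrableOn (fun y : ℝ => y ^ (-1 - σ * p)) (Set.Ioi 1) :=
      integrableOn_Ioi_rpow_of_lt (by nlinarith) one_pos
    refine hfar.congr_fun (fun y hy => ?_) measurableSet_Ioi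
    simp only [min_eq_left (Set.mem_Ioi.1 hy).le, Real.one_rpow, one_mul]

section

variable {V : Type*} [NormedAddCommGroup V] {F : Type*} [NormedAddCommGroup F] {p : ℝ}

theorem lintegral_rpow_enorm_sub_translate_le [MeasurableSpace V] [MeasurableAdd V]
    {μ : Measure V} [μ.IsAddRightInvariant] (hp : 1 ≤ p) {G : V → F}
    (hG : AEStronglyMeasurable G μ) (h : V) :
    ∫⁻ x, ‖G x - G (x + h)‖ₑ ^ p ∂μ ≤ 2 ^ p * ∫⁻ x, ‖G x‖ₑ ^ p ∂μ := by
  calc ∫⁻ x, ‖G x - G (x + h)‖ₑ ^ p ∂μ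
      ≤ ∫⁻ x, 2 ^ (p - 1) * (‖G x‖ₑ ^ p + ‖G (x + h)‖ₑ ^ p) ∂μ := by
        refine lintegral_mono fun x => le_trans ?_ (ENNReal.rpow_add_le_mul_rpow_add_rpow _ _ hp)
        gcongr
        exact enorm_sub_le
    _ = 2 ^ (p - 1) * ((∫⁻ x, ‖G x‖ₑ ^ p ∂μ) + ∫⁻ x, ‖G x‖ₑ ^ p ∂μ) := by
        rw [lintegral_const_mul' _ _ (ENNReal.rpow_ne_top_of_nonneg (by linarith) (by norm_num)),
          lintegral_add_left' (hG.enorm.pow_const p),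
          lintegral_add_right_eq_self (fun x => ‖G x‖ₑ ^ p) h]
    _ = 2 ^ p * ∫⁻ x, ‖G x‖ₑ ^ p ∂μ := by
        rw [← two_mul, ← mul_assoc]
        nth_rewrite 2 [← ENNReal.rpow_one 2]
        rw [← ENNReal.rpow_add _ _ (by norm_num) (by norm_num), sub_add_cancel]

variable [NormedSpace ℝ V] [NormedSpace ℝ F] [CompleteSpace F] {G : V → F}

theorem enorm_sub_translate_le_lintegral_fderiv (hG : ContDiff ℝ 1 G) (x h : V) :
    ‖G x - G (x + h)‖ₑ ≤ ∫⁻ s in Set.Ioc (0 : ℝ) 1, ‖h‖ₑ * ‖fderiv ℝ G (x + s • h)‖ₑ := by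
  have hline (s : ℝ) : HasDerivAt (fun s : ℝ => x + s • h) h s := by
    simpa using ((hasDerivAt_id s).smul_const h).const_add x
  have hderiv (s : ℝ) : HasDerivAt (fun s : ℝ => G (x + s • h)) (fderiv ℝ G (x + s • h) h) s :=
    HasFDerivAt.comp_hasDerivAt (l := G) s (hG.differentiable one_ne_zero _).hasFDerivAt (hline s)
  have hcont : Continuous fun s : ℝ => fderiv ℝ G (x + s • h) h :=
    ((hG.continuous_fderiv one_ne_zero).comp (by fun_prop)).clm_apply continuous_const
  have hftc := intervalIntegral.integral_eq_sub_of_hasDerivAt (a := 0) (b := 1)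
    (fun s _ => hderiv s) (hcont.intervalIntegrable _ _)
  simp only [one_smul, zero_smul, add_zero] at hftc
  rw [← enorm_neg, neg_sub, ← hftc, intervalIntegral.integral_of_le zero_le_one]
  refine (enorm_integral_le_lintegral_enorm _).trans (lintegral_mono fun s => ?_)
  rw [mul_comm]
  exact ContinuousLinearMap.le_opENorm _ _

variable [FiniteDimensional ℝ V] [MeasurableSpace V] [BorelSpace V] {μ : Measure V}
  [μ.IsAddHaarMeasure]

theorem lintegral_rpow_enorm_sub_translate_le_fderiv (hp : 1 ≤ p) (hG : ContDiff ℝ 1 G) (h : V) :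
    ∫⁻ x, ‖G x - G (x + h)‖ₑ ^ p ∂μ ≤ ‖h‖ₑ ^ p * ∫⁻ x, ‖fderiv ℝ G x‖ₑ ^ p ∂μ := by
  have hp₀ : 0 ≤ p := zero_le_one.trans hp
  have hmeas : Measurable fun q : V × ℝ => ‖h‖ₑ * ‖fderiv ℝ G (q.1 + q.2 • h)‖ₑ :=
    measurable_const.mul ((hG.continuous_fderiv one_ne_zero).comp
      (by fun_prop : Continuous fun q : V × ℝ => q.1 + q.2 • h)).enorm.measurable
  have hslice (s : ℝ) : ∫⁻ x, (‖h‖ₑ * ‖fderiv ℝ G (x + s • h)‖ₑ) ^ p ∂μ =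
      ‖h‖ₑ ^ p * ∫⁻ x, ‖fderiv ℝ G x‖ₑ ^ p ∂μ := by
    simp only [ENNReal.mul_rpow_of_nonneg _ _ hp₀]
    rw [lintegral_const_mul' _ _ (ENNReal.rpow_ne_top_of_nonneg hp₀ enorm_ne_top),
      lintegral_add_right_eq_self (fun x => ‖fderiv ℝ G x‖ₑ ^ p) (s • h)]
  calc ∫⁻ x, ‖G x - G (x + h)‖ₑ ^ p ∂μ
      ≤ ∫⁻ x, (∫⁻ s in Set.Ioc (0 : ℝ) 1, ‖h‖ₑ * ‖fderiv ℝ G (x + s • h)‖ₑ) ^ p ∂μ := by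
        gcongr with x
        exact enorm_sub_translate_le_lintegral_fderiv hG x h
    _ ≤ _ := lintegral_rpow_lintegral_le μ (volume.restrict (Set.Ioc (0 : ℝ) 1)) hp hmeas
    _ = _ := by simp [hslice]

theorem lintegral_rpow_enorm_sub_translate_le_min (hp : 1 ≤ p) (hG : ContDiff ℝ 1 G) (h : V) :
    ∫⁻ x, ‖G x - G (x + h)‖ₑ ^ p ∂μ ≤ ENNReal.ofReal (min 1 ‖h‖ ^ p) *
      (2 ^ p * ((∫⁻ x, ‖G x‖ₑ ^ p ∂μ) + ∫⁻ x, ‖fderiv ℝ G x‖ₑ ^ p ∂μ)) := by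
  have hp₀ : 0 < p := zero_lt_one.trans_le hp
  rcases le_total 1 ‖h‖ with hh | hh
  · rw [min_eq_left hh, Real.one_rpow, ENNReal.ofReal_one, one_mul]
    refine (lintegral_rpow_enorm_sub_translate_le hp
      hG.continuous.aestronglyMeasurable h).trans ?_
    gcongr
    exact le_self_add
  · rw [min_eq_right hh, ← ENNReal.ofReal_rpow_of_nonneg (norm_nonneg h) hp₀.le, ofReal_norm]
    refine (lintegral_rpow_enorm_sub_translate_le_fderiv hp hG h).trans ?_
    gcongr
    rw [← one_mul (∫⁻ x, ‖fderiv ℝ G x‖ₑ ^ p ∂μ)]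
    exact mul_le_mul' (ENNReal.one_le_rpow one_le_two hp₀) (by rw [one_mul]; exact le_add_self)

theorem lintegral_prod_eq_lintegral_lintegral_add {f : V × V → ℝ≥0∞} (hf : Measurable f) :
    ∫⁻ z, f z ∂μ.prod μ = ∫⁻ h, ∫⁻ x, f (x, x + h) ∂μ ∂μ := by
  rw [lintegral_prod _ hf.aemeasurable,
    lintegral_congr fun x => (lintegral_add_left_eq_self (fun y => f (x, y)) x).symm,
    lintegral_lintegral_swap]
  exact (hf.comp (by fun_prop : Measurable fun q : V × V => (q.1, q.1 + q.2))).aemeasurable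

end

open Module (finrank)

variable {V : Type*} [NormedAddCommGroup V] [NormedSpace ℝ V] [FiniteDimensional ℝ V]
  [Nontrivial V] [MeasureSpace V] [BorelSpace V] [(volume : Measure V).IsAddHaarMeasure] {p σ : ℝ}

variable (V) in
theorem lintegral_min_one_norm_rpow_mul_lt_top (hp : 0 < p) (hσ : 0 < σ) (hσ' : σ < 1) :
    ∫⁻ h : V, ENNReal.ofReal (min 1 ‖h‖ ^ p * ‖h‖ ^ (-(finrank ℝ V + σ * p))) < ∞ := by
  have hradial (y : ℝ) (hy : y ∈ Set.Ioi (0 : ℝ)) :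
      y ^ (finrank ℝ V - 1) * (min 1 y ^ p * y ^ (-(finrank ℝ V + σ * p))) =
        min 1 y ^ p * y ^ (-1 - σ * p) := by
    rw [← Real.rpow_natCast, Nat.cast_sub Module.finrank_pos, mul_left_comm, ← Real.rpow_add hy]
    push_cast
    ring_nf
  have hint : Integrable fun h : V => min 1 ‖h‖ ^ p * ‖h‖ ^ (-(finrank ℝ V + σ * p)) := by
    rw [integrable_fun_norm_addHaar volume
      (f := fun y => min 1 y ^ p * y ^ (-(finrank ℝ V + σ * p)))]
    simp only [smul_eq_mul]
    rw [integrableOn_congr_fun hradial measurableSet_Ioi]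
    exact integrableOn_min_one_rpow_mul_rpow hp hσ hσ'
  exact (hasFiniteIntegral_iff_ofReal (.of_forall fun h => by positivity)).1 hint.hasFiniteIntegral

variable (V) in
theorem exists_lintegral_gagliardo_le (hp : 1 ≤ p) (hσ : 0 < σ) (hσ' : σ < 1) (F : Type*)
    [NormedAddCommGroup F] [NormedSpace ℝ F] [CompleteSpace F] :
    ∃ C : ℝ≥0∞, C ≠ ∞ ∧ ∀ G : V → F, ContDiff ℝ 1 G →
      ∫⁻ z : V × V, ‖G z.1 - G z.2‖ₑ ^ p / ‖z.1 - z.2‖ₑ ^ (finrank ℝ V + σ * p) ≤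
        C * ((∫⁻ x, ‖G x‖ₑ ^ p) + ∫⁻ x, ‖fderiv ℝ G x‖ₑ ^ p) := by
  have hp₀ : 0 < p := zero_lt_one.trans_le hp
  have hexp : 0 < finrank ℝ V + σ * p := by positivity
  refine ⟨(∫⁻ h : V, ENNReal.ofReal (min 1 ‖h‖ ^ p * ‖h‖ ^ (-(finrank ℝ V + σ * p)))) * 2 ^ p,
    ENNReal.mul_ne_top (lintegral_min_one_norm_rpow_mul_lt_top V hp₀ hσ hσ').ne
      (ENNReal.rpow_ne_top_of_nonneg hp₀.le (by norm_num)), fun G hG => ?_⟩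
  have hmeas : Measurable fun z : V × V =>
      ‖G z.1 - G z.2‖ₑ ^ p / ‖z.1 - z.2‖ₑ ^ (finrank ℝ V + σ * p) :=
    (((hG.continuous.comp continuous_fst).sub
      (hG.continuous.comp continuous_snd)).enorm.measurable.pow_const _).div
        ((measurable_fst.sub measurable_snd).enorm.pow_const _)
  rw [Measure.volume_eq_prod, lintegral_prod_eq_lintegral_lintegral_add hmeas, mul_assoc,
    ← lintegral_mul_const'' _ (by fun_prop)]
  refine lintegral_mono_ae ?_
  filter_upwards [Measure.ae_ne volume (0 : V)] with h hh
  have hpos : 0 < ‖h‖ := norm_pos_iff.2 hh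
  simp only [div_eq_mul_inv, sub_add_cancel_left, enorm_neg]
  rw [lintegral_mul_const' _ _ (by simp [ENNReal.inv_eq_top, hh, ENNReal.rpow_eq_zero_iff, hexp]),
    ENNReal.ofReal_mul (by positivity), Real.rpow_neg hpos.le,
    ENNReal.ofReal_inv_of_pos (Real.rpow_pos_of_pos hpos _), ← ENNReal.ofReal_rpow_of_pos hpos,
    ofReal_norm, mul_right_comm]
  gcongr
  exact lintegral_rpow_enorm_sub_translate_le_min hp hG h

end GagliardoBound

section SobolevInt

variable {V : Type*} [NormedAddCommGroup V] [MeasureSpace V]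

theorem lintegral_rpow_lt_top_of_hasCompactSupport [OpensMeasurableSpace V]
    [IsFiniteMeasureOnCompacts (volume : Measure V)] {F : Type*} [NormedAddCommGroup F]
    {f : V → F} (hf : Continuous f) (hc : HasCompactSupport f) {p : ℝ} (hp : 0 < p) :
    ∫⁻ x, ‖f x‖ₑ ^ p < ∞ := by
  have h : MemLp f (ENNReal.ofReal p) volume := hf.memLp_of_hasCompactSupport hc
  have hlt := lintegral_rpow_enorm_lt_top_of_eLpNorm_lt_top (by simpa using hp) (by simp) h.2
  rwa [ENNReal.toReal_ofReal hp.le] at hlt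

variable [NormedSpace ℝ V]

/-- The `p`-th power of a `W^{2,p}` norm. -/
def sobolevInt (p : ℝ) (v : V → ℝ) : ℝ≥0∞ :=
  (∫⁻ x, ‖v x‖ₑ ^ p) + (∫⁻ x, ‖fderiv ℝ v x‖ₑ ^ p) + ∫⁻ x, ‖fderiv ℝ (fderiv ℝ v) x‖ₑ ^ p

theorem sobolevInt_lt_top_of_hasCompactSupport [OpensMeasurableSpace V]
    [IsFiniteMeasureOnCompacts (volume : Measure V)] {v : V → ℝ} (hv : ContDiff ℝ 2 v)
    (hc : HasCompactSupport v) {p : ℝ} (hp : 0 < p) : sobolevInt p v < ∞ := by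
  have hd : ContDiff ℝ 1 (fderiv ℝ v) := hv.fderiv_right (by norm_num)
  refine ENNReal.add_lt_top.2 ⟨ENNReal.add_lt_top.2 ⟨?_, ?_⟩, ?_⟩
  · exact lintegral_rpow_lt_top_of_hasCompactSupport hv.continuous hc hp
  · exact lintegral_rpow_lt_top_of_hasCompactSupport hd.continuous (hc.fderiv ℝ) hp
  · exact lintegral_rpow_lt_top_of_hasCompactSupport (hd.continuous_fderiv one_ne_zero)
      ((hc.fderiv ℝ).fderiv ℝ) hp

end SobolevInt

section SmoothBesov

section

variable {H : Type*} [NormedAddCommGroup H] [InnerProductSpace ℝ H] [CompleteSpace H] {u : H → ℝ}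

theorem norm_gradient (u : H → ℝ) (x : H) : ‖gradient u x‖ = ‖fderiv ℝ u x‖ := by
  rw [gradient, LinearIsometryEquiv.norm_map]

theorem norm_gradient_sub (u : H → ℝ) (x y : H) :
    ‖gradient u x - gradient u y‖ = ‖fderiv ℝ u x - fderiv ℝ u y‖ := by
  rw [gradient, gradient, ← map_sub, LinearIsometryEquiv.norm_map]

theorem continuous_gradient (hu : ContDiff ℝ 1 u) : Continuous (gradient u) :=
  (LinearIsometryEquiv.continuous _).comp (hu.continuous_fderiv one_ne_zero)

end

variable {N : ℕ} {s : ℝ} {p : ℝ≥0} {u : E N → ℝ}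

theorem gradient_coord (u : E N → ℝ) (x : E N) (i : Fin N) :
    gradient u x i = dirDeriv (stdVec i) u x := by
  rw [dirDeriv, ← inner_gradient_left, EuclideanSpace.inner_single_right]
  simp

theorem hasWeakGradient_gradient (hu : ContDiff ℝ 1 u) : HasWeakGradient u (gradient u) := by
  intro φ i
  have h := integral_mul_dirDeriv (μ := volume) (φ.contDiff.of_le (by simp)) hu
    φ.hasCompactSupport (stdVec i)
  simp only [gradient_coord, mul_comm _ (φ _), h, neg_neg]
  simp only [dirDeriv, mul_comm]

theorem gagliardo_gradient {σ : ℝ} (u : E N → ℝ) :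
    gagliardo σ p (gradient u) = (∫⁻ z : E N × E N,
      ‖fderiv ℝ u z.1 - fderiv ℝ u z.2‖ₑ ^ (p : ℝ) /
        ‖z.1 - z.2‖ₑ ^ ((N : ℝ) + σ * (p : ℝ))) ^ (1 / (p : ℝ)) := by
  simp only [gagliardo, ← ofReal_norm, norm_gradient_sub]

theorem exists_gagliardo_gradient_le (hN : N ≠ 0) (hp : 1 ≤ p) {σ : ℝ} (hσ : 0 < σ) (hσ' : σ < 1) :
    ∃ C : ℝ≥0∞, C ≠ ∞ ∧ ∀ v : E N → ℝ, ContDiff ℝ 2 v →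
      gagliardo σ p (gradient v) ≤ C * sobolevInt p v ^ (1 / (p : ℝ)) := by
  have : NeZero N := ⟨hN⟩
  obtain ⟨C, hC, h⟩ := exists_lintegral_gagliardo_le (E N) (p := p) (by exact_mod_cast hp) hσ hσ'
    (E N →L[ℝ] ℝ)
  refine ⟨C ^ (1 / (p : ℝ)), ENNReal.rpow_ne_top_of_nonneg (by positivity) hC, fun v hv => ?_⟩
  rw [gagliardo_gradient, ← ENNReal.mul_rpow_of_nonneg _ _ (by positivity)]
  have hv' := h _ (hv.fderiv_right (m := 1) (by norm_num))
  rw [finrank_euclideanSpace_fin] at hv'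
  gcongr
  refine hv'.trans ?_
  gcongr
  rw [sobolevInt, add_assoc]
  exact le_add_self

theorem eLpNorm_le_sobolevInt (hp : p ≠ 0) (v : E N → ℝ) :
    eLpNorm v p volume ≤ sobolevInt p v ^ (1 / (p : ℝ)) := by
  rw [eLpNorm_nnreal_eq_lintegral hp]
  gcongr
  exact le_self_add.trans le_self_add

theorem eLpNorm_gradient_le_sobolevInt (hp : p ≠ 0) (v : E N → ℝ) :
    eLpNorm (gradient v) p volume ≤ sobolevInt p v ^ (1 / (p : ℝ)) := by
  rw [eLpNorm_nnreal_eq_lintegral hp]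
  simp only [← ofReal_norm, norm_gradient]
  simp only [ofReal_norm]
  gcongr
  exact le_add_self.trans le_self_add

variable [Fact (1 ≤ p)]

theorem Besov.exists_of_hasWeakGradient {f : E N → ℝ} {G : E N → E N} (hf : MemLp f p volume)
    (hG : MemLp G p volume) (h : HasWeakGradient f G) (hg : gagliardo (s - 1) p G < ∞) :
    ∃ w : Besov N s p, (Besov.toLp w : E N → ℝ) =ᵐ[volume] f ∧
      (Besov.grad w : E N → E N) =ᵐ[volume] G := by
  have h' : HasWeakGradient (hf.toLp f) (hG.toLp G) :=
    h.congr hf.coeFn_toLp.symm hG.coeFn_toLp.symm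
  let w : Besov N s p := ⟨hf.toLp f, hG.toLp G, h', by rwa [gagliardo_congr hG.coeFn_toLp]⟩
  refine ⟨w, hf.coeFn_toLp, ?_⟩
  rw [Besov.grad_eq_of_hasWeakGradient w (hG.toLp G) h']
  exact hG.coeFn_toLp

theorem Besov.enorm_eq {w : Besov N s p} {f : E N → ℝ} {G : E N → E N}
    (hf : (Besov.toLp w : E N → ℝ) =ᵐ[volume] f) (hG : (Besov.grad w : E N → E N) =ᵐ[volume] G) :
    ‖w‖ₑ = eLpNorm f p volume + eLpNorm G p volume + gagliardo (s - 1) p G := by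
  rw [← ofReal_norm, Besov.norm_def, ENNReal.ofReal_add (by positivity) ENNReal.toReal_nonneg,
    ENNReal.ofReal_add (norm_nonneg _) (norm_nonneg _),
    ENNReal.ofReal_toReal (Besov.gagliardo_grad_lt_top w).ne, gagliardo_congr hG, ofReal_norm,
    ofReal_norm, Lp.enorm_def, Lp.enorm_def, eLpNorm_congr_ae hf, eLpNorm_congr_ae hG]

theorem Besov.exists_of_sobolevInt (hN : N ≠ 0) (hs : 1 < s) (hs' : s < 2) :
    ∃ C : ℝ≥0∞, C ≠ ∞ ∧ ∀ v : E N → ℝ, ContDiff ℝ 2 v → sobolevInt p v < ∞ →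
      ∃ w : Besov N s p, (Besov.toLp w : E N → ℝ) =ᵐ[volume] v ∧
        (Besov.grad w : E N → E N) =ᵐ[volume] gradient v ∧
        ‖w‖ₑ ≤ C * sobolevInt p v ^ (1 / (p : ℝ)) := by
  have hp : 1 ≤ p := Fact.out
  have hp₀ : p ≠ 0 := (zero_lt_one.trans_le hp).ne'
  obtain ⟨C, hC, h⟩ := exists_gagliardo_gradient_le hN hp (σ := s - 1) (by linarith) (by linarith)
  refine ⟨1 + 1 + C, by simpa using hC, fun v hv hfin => ?_⟩
  have hv₁ : ContDiff ℝ 1 v := hv.of_le one_le_two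
  have hfin' : sobolevInt p v ^ (1 / (p : ℝ)) < ∞ :=
    ENNReal.rpow_lt_top_of_nonneg (by positivity) hfin.ne
  have hLp := eLpNorm_le_sobolevInt hp₀ v
  have hgrad := eLpNorm_gradient_le_sobolevInt hp₀ v
  obtain ⟨w, hw, hw'⟩ := Besov.exists_of_hasWeakGradient (s := s)
    ⟨hv.continuous.aestronglyMeasurable, hLp.trans_lt hfin'⟩
    ⟨(continuous_gradient hv₁).aestronglyMeasurable, hgrad.trans_lt hfin'⟩
    (hasWeakGradient_gradient hv₁) ((h v hv).trans_lt (ENNReal.mul_lt_top hC.lt_top hfin'))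
  refine ⟨w, hw, hw', ?_⟩
  rw [Besov.enorm_eq hw hw', add_mul, add_mul, one_mul]
  exact add_le_add (add_le_add hLp hgrad) (h v hv)

end SmoothBesov

section Young

variable {V : Type*} [NormedAddCommGroup V] [MeasurableSpace V] {μ : Measure V}

section

variable [BorelSpace V] [SecondCountableTopology V] [SFinite μ]

theorem lintegral_rpow_lintegral_sub_le [μ.IsAddRightInvariant] (ν : Measure V) [SFinite ν] {p : ℝ}
    (hp : 1 ≤ p) {g : V → ℝ≥0∞} (hg : Measurable g) :
    ∫⁻ x, (∫⁻ z, g (x - z) ∂ν) ^ p ∂μ ≤ ν Set.univ ^ p * ∫⁻ x, g x ^ p ∂μ := by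
  calc ∫⁻ x, (∫⁻ z, g (x - z) ∂ν) ^ p ∂μ
      ≤ ν Set.univ ^ (p - 1) * ∫⁻ z, ∫⁻ x, g (x - z) ^ p ∂μ ∂ν :=
        lintegral_rpow_lintegral_le μ ν hp (f := fun q => g (q.1 - q.2))
          (hg.comp (measurable_fst.sub measurable_snd))
    _ = ν Set.univ ^ (p - 1) * ν Set.univ ^ (1 : ℝ) * ∫⁻ x, g x ^ p ∂μ := by
        simp only [lintegral_sub_right_eq_self (μ := μ) (fun x => g x ^ p), lintegral_const]
        rw [ENNReal.rpow_one, mul_assoc, mul_comm (ν Set.univ)]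
    _ = ν Set.univ ^ p * ∫⁻ x, g x ^ p ∂μ := by
        rw [← ENNReal.rpow_add_of_nonneg _ _ (by linarith) zero_le_one, sub_add_cancel]

end

variable {F₀ F F₁ : Type*} [NormedAddCommGroup F₀] [NormedSpace ℝ F₀] [NormedAddCommGroup F]
  [NormedSpace ℝ F] [NormedAddCommGroup F₁] [NormedSpace ℝ F₁] {k : V → F₀} {f : V → F}
  (L : F₀ →L[ℝ] F →L[ℝ] F₁)

theorem enorm_convolution_le (k : V → F₀) (f : V → F) (x : V) :
    ‖convolution k f L μ x‖ₑ ≤ ∫⁻ z, ‖L‖ₑ * ‖k z‖ₑ * ‖f (x - z)‖ₑ ∂μ := by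
  refine (enorm_integral_le_lintegral_enorm _).trans (lintegral_mono fun z => ?_)
  calc ‖L (k z) (f (x - z))‖ₑ ≤ ‖L (k z)‖ₑ * ‖f (x - z)‖ₑ := ContinuousLinearMap.le_opENorm _ _
    _ ≤ ‖L‖ₑ * ‖k z‖ₑ * ‖f (x - z)‖ₑ := by
      gcongr
      exact ContinuousLinearMap.le_opENorm _ _

variable [BorelSpace V] [SecondCountableTopology V] [SFinite μ] [IsFiniteMeasureOnCompacts μ]
  [μ.IsAddRightInvariant]

theorem lintegral_rpow_convolution_lt_top (hk : Continuous k)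
    (hkc : HasCompactSupport k) (hf : Measurable fun x => ‖f x‖ₑ) {p : ℝ} (hp : 1 ≤ p)
    (hfin : ∫⁻ x, ‖f x‖ₑ ^ p ∂μ < ∞) :
    ∫⁻ x, ‖convolution k f L μ x‖ₑ ^ p ∂μ < ∞ := by
  set ν : Measure V := μ.withDensity fun z => ‖L‖ₑ * ‖k z‖ₑ with hν
  have hνfin : ν Set.univ < ∞ := by
    rw [hν, withDensity_apply _ MeasurableSet.univ, Measure.restrict_univ,
      lintegral_const_mul' _ _ enorm_ne_top]
    exact ENNReal.mul_lt_top enorm_lt_top (hk.integrable_of_hasCompactSupport hkc).hasFiniteIntegral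
  have : IsFiniteMeasure ν := ⟨hνfin⟩
  have hle (x : V) : ‖convolution k f L μ x‖ₑ ≤ ∫⁻ z, ‖f (x - z)‖ₑ ∂ν := by
    rw [hν, lintegral_withDensity_eq_lintegral_mul μ (f := fun z => ‖L‖ₑ * ‖k z‖ₑ)
      (measurable_const.mul hk.enorm.measurable) (g := fun z => ‖f (x - z)‖ₑ)
      (hf.comp (measurable_const.sub measurable_id))]
    exact enorm_convolution_le L k f x
  calc ∫⁻ x, ‖convolution k f L μ x‖ₑ ^ p ∂μ ≤ ∫⁻ x, (∫⁻ z, ‖f (x - z)‖ₑ ∂ν) ^ p ∂μ := by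
        gcongr with x
        exact hle x
    _ ≤ ν Set.univ ^ p * ∫⁻ x, ‖f x‖ₑ ^ p ∂μ := lintegral_rpow_lintegral_sub_le ν hp hf
    _ < ∞ := ENNReal.mul_lt_top
        (ENNReal.rpow_lt_top_of_nonneg (zero_le_one.trans hp) hνfin.ne) hfin

end Young

section Mollify

variable {V : Type*} [NormedAddCommGroup V] [NormedSpace ℝ V] [FiniteDimensional ℝ V]
  [MeasureSpace V] {F : Type*} [NormedAddCommGroup F] [NormedSpace ℝ F] {f : V → F}
  (b : ContDiffBump (0 : V))

/-- The mollification `ρ ⋆ f` by a normalized bump function. -/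
def mollify (f : V → F) : V → F :=
  convolution (b.normed volume) f (ContinuousLinearMap.lsmul ℝ ℝ) volume

theorem mollify_apply (f : V → F) (x : V) :
    mollify b f x = ∫ z, b.normed volume z • f (x - z) := rfl

/-- The probability measure with density a normalized bump function, against which mollification
averages. -/
def bumpMeasure : Measure V :=
  volume.withDensity fun z => ‖b.normed volume z‖ₑ

variable [BorelSpace V]

theorem enorm_integral_bump_smul_le {g : V → F} (hg : StronglyMeasurable g) :
    ‖∫ z, b.normed volume z • g z‖ₑ ≤ ∫⁻ z, ‖g z‖ₑ ∂(bumpMeasure b) := by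
  rw [bumpMeasure, lintegral_withDensity_eq_lintegral_mul _
    b.continuous_normed.enorm.measurable hg.enorm]
  refine (enorm_integral_le_lintegral_enorm _).trans (le_of_eq ?_)
  simp only [enorm_smul, Pi.mul_apply]

variable [(volume : Measure V).IsAddHaarMeasure]

theorem integrable_bump_smul (hf : LocallyIntegrable f) (x : V) :
    Integrable fun z => b.normed volume z • f (x - z) :=
  b.hasCompactSupport_normed.convolutionExists_left (ContinuousLinearMap.lsmul ℝ ℝ)
    b.continuous_normed hf x

theorem integrable_bump_smul_sub (hf : LocallyIntegrable f) (x : V) :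
    Integrable fun z => b.normed volume z • (f (x - z) - f x) := by
  simp only [smul_sub]
  exact (integrable_bump_smul b hf x).sub (b.integrable_normed.smul_const _)

theorem contDiff_mollify {n : ℕ∞} (hf : LocallyIntegrable f) : ContDiff ℝ n (mollify b f) :=
  b.hasCompactSupport_normed.contDiff_convolution_left (ContinuousLinearMap.lsmul ℝ ℝ)
    b.contDiff_normed hf

theorem mollify_sub_self [CompleteSpace F] (hf : LocallyIntegrable f) (x : V) :
    mollify b f x - f x = ∫ z, b.normed volume z • (f (x - z) - f x) := by
  simp only [smul_sub]
  rw [integral_sub (integrable_bump_smul b hf x) (b.integrable_normed.smul_const _),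
    b.integral_normed_smul, mollify_apply]

theorem clm_mollify [CompleteSpace F] {F' : Type*} [NormedAddCommGroup F'] [NormedSpace ℝ F']
    [CompleteSpace F'] (L : F →L[ℝ] F') (hf : LocallyIntegrable f) (x : V) :
    L (mollify b f x) = mollify b (fun y => L (f y)) x := by
  rw [mollify_apply, mollify_apply, ← L.integral_comp_comm (integrable_bump_smul b hf x)]
  simp only [map_smul]

theorem dirDeriv_mollify_eq_integral {f : V → ℝ} (hf : LocallyIntegrable f) (v x : V) :
    dirDeriv v (mollify b f) x = ∫ z, dirDeriv v (b.normed volume) z * f (x - z) := by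
  have hρ : ContDiff ℝ 1 (b.normed volume) := b.contDiff_normed
  have hc : HasCompactSupport (b.normed volume) := b.hasCompactSupport_normed
  have hintegrable := (hc.fderiv ℝ).convolutionExists_left
    ((ContinuousLinearMap.lsmul ℝ ℝ).precompL V) (hρ.continuous_fderiv one_ne_zero) hf x
  rw [dirDeriv, mollify, (hc.hasFDerivAt_convolution_left _ hρ hf x).fderiv, convolution,
    ContinuousLinearMap.integral_apply hintegrable]
  rfl

theorem sobolevInt_mollify_lt_top {f : V → ℝ} (hf : LocallyIntegrable f) (hfm : Measurable f)
    {p : ℝ} (hp : 1 ≤ p) (hfin : ∫⁻ x, ‖f x‖ₑ ^ p < ∞) : sobolevInt p (mollify b f) < ∞ := by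
  have hρ : ContDiff ℝ 2 (b.normed volume) := b.contDiff_normed
  have hρ' : ContDiff ℝ 1 (fderiv ℝ (b.normed volume)) := hρ.fderiv_right (by norm_num)
  have hc : HasCompactSupport (b.normed volume) := b.hasCompactSupport_normed
  set L := ContinuousLinearMap.lsmul ℝ ℝ (E := ℝ)
  have hfderiv : fderiv ℝ (convolution (b.normed volume) f L volume) =
      convolution (fderiv ℝ (b.normed volume)) f (L.precompL V) volume :=
    funext fun x => (hc.hasFDerivAt_convolution_left L (hρ.of_le one_le_two) hf x).fderiv
  have hfderiv₂ : fderiv ℝ (convolution (fderiv ℝ (b.normed volume)) f (L.precompL V) volume) = _ :=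
    funext fun x => ((hc.fderiv ℝ).hasFDerivAt_convolution_left (L.precompL V) hρ' hf x).fderiv
  rw [sobolevInt, mollify, hfderiv, hfderiv₂]
  refine ENNReal.add_lt_top.2 ⟨ENNReal.add_lt_top.2 ⟨?_, ?_⟩, ?_⟩
  · exact lintegral_rpow_convolution_lt_top _ hρ.continuous hc hfm.enorm hp hfin
  · exact lintegral_rpow_convolution_lt_top _ hρ'.continuous (hc.fderiv ℝ) hfm.enorm hp hfin
  · exact lintegral_rpow_convolution_lt_top _ (hρ'.continuous_fderiv one_ne_zero)
      ((hc.fderiv ℝ).fderiv ℝ) hfm.enorm hp hfin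

instance : IsProbabilityMeasure (bumpMeasure b) := by
  constructor
  rw [bumpMeasure, withDensity_apply _ MeasurableSet.univ, Measure.restrict_univ,
    lintegral_congr fun z => Real.enorm_of_nonneg (b.nonneg_normed z),
    ← ofReal_integral_eq_lintegral_ofReal b.integrable_normed (.of_forall b.nonneg_normed),
    b.integral_normed, ENNReal.ofReal_one]

theorem bumpMeasure_ae_norm_lt : ∀ᵐ z ∂(bumpMeasure b), ‖z‖ < b.rOut := by
  rw [bumpMeasure, ae_withDensity_iff b.continuous_normed.enorm.measurable]
  refine .of_forall fun z hz => ?_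
  have hz' : z ∈ Function.support (b.normed volume) := enorm_ne_zero.1 hz
  rwa [b.support_normed_eq, mem_ball_zero_iff] at hz'

theorem enorm_mollify_sub_self_le [CompleteSpace F] (hfm : StronglyMeasurable f)
    (hf : LocallyIntegrable f) (x : V) :
    ‖mollify b f x - f x‖ₑ ≤ ∫⁻ z, ‖f (x - z) - f x‖ₑ ∂(bumpMeasure b) := by
  rw [mollify_sub_self b hf]
  exact enorm_integral_bump_smul_le b
    ((hfm.comp_measurable (measurable_const.sub measurable_id)).sub stronglyMeasurable_const)

end Mollify

section MollifyGradient

variable {N : ℕ} (b : ContDiffBump (0 : E N)) {f : E N → ℝ} {G : E N → E N}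

/-- The kernel `y ↦ ρ (x - y)` of the mollification at `x`, as a test function. -/
def mollifyKernel (x : E N) : 𝓓((⊤ : Opens (E N)), ℝ) :=
  ⟨fun y => b.normed volume (x - y), b.contDiff_normed.comp (contDiff_const.sub contDiff_id),
    b.hasCompactSupport_normed.comp_homeomorph (Homeomorph.subLeft x), by simp⟩

theorem mollifyKernel_apply (x y : E N) : mollifyKernel b x y = b.normed volume (x - y) := rfl

theorem fderiv_mollifyKernel (x y v : E N) :
    fderiv ℝ (mollifyKernel b x) y v = -dirDeriv v (b.normed volume) (x - y) := by
  have hρ : DifferentiableAt ℝ (b.normed volume) (x - y) :=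
    (b.contDiff_normed (n := 1)).differentiable (by norm_num) _
  have hsub : HasFDerivAt (fun y : E N => x - y) (-ContinuousLinearMap.id ℝ (E N)) y :=
    (hasFDerivAt_id y).const_sub x
  have hcomp := HasFDerivAt.comp y (g := b.normed volume) hρ.hasFDerivAt hsub
  change fderiv ℝ (b.normed volume ∘ fun y : E N => x - y) y v = _
  rw [hcomp.fderiv]
  simp [dirDeriv]

theorem HasWeakGradient.gradient_mollify (h : HasWeakGradient f G) (hf : LocallyIntegrable f)
    (hG : LocallyIntegrable G) : gradient (mollify b f) = mollify b G := by
  ext x i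
  calc gradient (mollify b f) x i
      = ∫ z, dirDeriv (stdVec i) (b.normed volume) z * f (x - z) := by
        rw [gradient_coord, dirDeriv_mollify_eq_integral b hf]
    _ = -∫ y, f y * fderiv ℝ (mollifyKernel b x) y (stdVec i) := by
        rw [← integral_sub_left_eq_self _ volume x, ← integral_neg]
        simp only [fderiv_mollifyKernel, sub_sub_cancel, mul_neg, neg_neg, mul_comm]
    _ = ∫ y, G y i * mollifyKernel b x y := by
        rw [h (mollifyKernel b x) i, neg_neg]
    _ = mollify b (fun y => G y i) x := by
        rw [mollify_apply, ← integral_sub_left_eq_self _ volume x]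
        simp only [mollifyKernel_apply, sub_sub_cancel, smul_eq_mul, mul_comm]
    _ = mollify b G x i := (clm_mollify b (EuclideanSpace.proj (𝕜 := ℝ) i) hG x).symm

end MollifyGradient

section DiffQuot

theorem eLpNorm_le_of_enorm_le_lintegral {X Z F F' : Type*} [MeasurableSpace X] [MeasurableSpace Z]
    [NormedAddCommGroup F] [NormedAddCommGroup F'] {p : ℝ≥0} (hp : 1 ≤ p) (μ : Measure X)
    [SFinite μ] (ν : Measure Z) [IsProbabilityMeasure ν] {H : X → F'} {Φ : X × Z → F}
    (hΦ : StronglyMeasurable Φ) (hH : ∀ x, ‖H x‖ₑ ≤ ∫⁻ z, ‖Φ (x, z)‖ₑ ∂ν) {ε : ℝ≥0∞}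
    (hε : ∀ᵐ z ∂ν, eLpNorm (fun x => Φ (x, z)) p μ ≤ ε) : eLpNorm H p μ ≤ ε := by
  have hp₀ : p ≠ 0 := (zero_lt_one.trans_le hp).ne'
  have hp' : 0 < (p : ℝ) := by positivity
  rw [← ENNReal.rpow_le_rpow_iff hp', eLpNorm_nnreal_pow_eq_lintegral hp₀]
  calc ∫⁻ x, ‖H x‖ₑ ^ (p : ℝ) ∂μ ≤ ∫⁻ x, (∫⁻ z, ‖Φ (x, z)‖ₑ ∂ν) ^ (p : ℝ) ∂μ := by
        gcongr with x
        exact hH x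
    _ ≤ ∫⁻ z, ∫⁻ x, ‖Φ (x, z)‖ₑ ^ (p : ℝ) ∂μ ∂ν := by
        have hle := lintegral_rpow_lintegral_le μ ν (p := p) (by exact_mod_cast hp) hΦ.enorm
        rwa [measure_univ, ENNReal.one_rpow, one_mul] at hle
    _ ≤ ∫⁻ _, ε ^ (p : ℝ) ∂ν := by
        refine lintegral_mono_ae (hε.mono fun z hz => ?_)
        rw [← eLpNorm_nnreal_pow_eq_lintegral hp₀]
        gcongr
    _ = ε ^ (p : ℝ) := by simp

variable {V F : Type*} [NormedAddCommGroup V] [NormedAddCommGroup F] [NormedSpace ℝ F]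

/-- The difference quotient `(G(x) - G(y)) / |x - y|^a`, whose `L^p` norm is a Gagliardo
seminorm of `G`. -/
def diffQuot (a : ℝ) (G : V → F) (q : V × V) : F :=
  ‖q.1 - q.2‖ ^ (-a) • (G q.1 - G q.2)

theorem enorm_diffQuot_rpow {p : ℝ} (hp : 0 < p) (a : ℝ) (G : V → F) (q : V × V) :
    ‖diffQuot a G q‖ₑ ^ p = ‖G q.1 - G q.2‖ₑ ^ p / ‖q.1 - q.2‖ₑ ^ (a * p) := by
  rw [diffQuot, enorm_smul, ENNReal.mul_rpow_of_nonneg _ _ hp.le]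
  rcases eq_or_ne q.1 q.2 with hq | hq
  · simp [hq, hp]
  · have hpos : 0 < ‖q.1 - q.2‖ := norm_pos_iff.2 (sub_ne_zero.2 hq)
    rw [Real.enorm_of_nonneg (by positivity), ← ENNReal.ofReal_rpow_of_pos hpos, ofReal_norm,
      ← ENNReal.rpow_mul, neg_mul, ENNReal.rpow_neg, div_eq_mul_inv, mul_comm]

theorem gagliardo_eq_eLpNorm_diffQuot {N : ℕ} {p : ℝ≥0} (hp : p ≠ 0) (σ : ℝ) (G : E N → E N) :
    gagliardo σ p G = eLpNorm (diffQuot ((N + σ * p) / p) G) p volume := by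
  have hp' : (0 : ℝ) < p := by positivity
  simp only [gagliardo, eLpNorm_nnreal_eq_lintegral hp, enorm_diffQuot_rpow hp',
    div_mul_cancel₀ _ hp'.ne']

variable [MeasurableSpace V] [BorelSpace V] [SecondCountableTopology V]

theorem stronglyMeasurable_diffQuot (a : ℝ) {G : V → F} (hG : StronglyMeasurable G) :
    StronglyMeasurable (diffQuot a G) :=
  ((measurable_fst.sub measurable_snd).norm.pow_const (-a)).stronglyMeasurable.smul
    ((hG.comp_measurable measurable_fst).sub (hG.comp_measurable measurable_snd))

end DiffQuot

section DiffQuotMollify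

variable {V F : Type*} [NormedAddCommGroup V] [NormedSpace ℝ V] [FiniteDimensional ℝ V]
  [MeasureSpace V] [BorelSpace V] [(volume : Measure V).IsAddHaarMeasure] [NormedAddCommGroup F]
  [NormedSpace ℝ F] [CompleteSpace F]

theorem enorm_diffQuot_mollify_sub_self_le (a : ℝ) (b : ContDiffBump (0 : V)) {G : V → F}
    (hGm : StronglyMeasurable G) (hG : LocallyIntegrable G) (q : V × V) :
    ‖diffQuot a (mollify b G - G) q‖ₑ ≤
      ∫⁻ z, ‖diffQuot a G (q - (z, z)) - diffQuot a G q‖ₑ ∂(bumpMeasure b) := by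
  have haverage : diffQuot a (mollify b G - G) q = ∫ z, b.normed volume z •
      (diffQuot a G (q - (z, z)) - diffQuot a G q) := by
    rw [diffQuot, Pi.sub_apply, Pi.sub_apply, mollify_sub_self b hG, mollify_sub_self b hG,
      ← integral_sub (integrable_bump_smul_sub b hG _) (integrable_bump_smul_sub b hG _),
      ← integral_smul]
    congr 1 with z
    simp only [diffQuot, Prod.fst_sub, Prod.snd_sub, sub_sub_sub_cancel_right]
    module
  rw [haverage]
  exact enorm_integral_bump_smul_le b (((stronglyMeasurable_diffQuot a hGm).comp_measurable
    (measurable_const.sub (measurable_id.prodMk measurable_id))).sub stronglyMeasurable_const)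

variable {p : ℝ≥0} [hp : Fact (1 ≤ p)] {ε : ℝ}

theorem exists_eLpNorm_mollify_sub_self_le {f : V → F} (hfm : StronglyMeasurable f)
    (hf : MemLp f p volume) (hε : 0 < ε) :
    ∃ δ > 0, ∀ b : ContDiffBump (0 : V), b.rOut < δ →
      eLpNorm (mollify b f - f) p volume ≤ ENNReal.ofReal ε := by
  obtain ⟨δ, hδ, h⟩ :=
    exists_forall_eLpNorm_translate_sub_le volume ENNReal.coe_ne_top hf hε
  refine ⟨δ, hδ, fun b hb => eLpNorm_le_of_enorm_le_lintegral hp.out volume (bumpMeasure b)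
    (Φ := fun q => f (q.1 - q.2) - f q.1) ?_
    (enorm_mollify_sub_self_le b hfm (hf.locallyIntegrable Fact.out))
    ((bumpMeasure_ae_norm_lt b).mono fun z hz => h z (hz.trans hb))⟩
  exact (hfm.comp_measurable (measurable_fst.sub measurable_snd)).sub
    (hfm.comp_measurable measurable_fst)

theorem exists_eLpNorm_diffQuot_mollify_sub_self_le (a : ℝ) {G : V → F}
    (hGm : StronglyMeasurable G) (hG : LocallyIntegrable G)
    (hquot : MemLp (diffQuot a G) p volume) (hε : 0 < ε) :
    ∃ δ > 0, ∀ b : ContDiffBump (0 : V), b.rOut < δ →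
      eLpNorm (diffQuot a (mollify b G - G)) p volume ≤ ENNReal.ofReal ε := by
  have : (volume : Measure (V × V)).IsAddRightInvariant :=
    inferInstanceAs ((volume : Measure V).prod (volume : Measure V)).IsAddRightInvariant
  obtain ⟨δ, hδ, h⟩ :=
    exists_forall_eLpNorm_translate_sub_le volume ENNReal.coe_ne_top hquot hε
  refine ⟨δ, hδ, fun b hb => eLpNorm_le_of_enorm_le_lintegral hp.out volume (bumpMeasure b)
    (Φ := fun q => diffQuot a G (q.1 - (q.2, q.2)) - diffQuot a G q.1) ?_
    (enorm_diffQuot_mollify_sub_self_le a b hGm hG)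
    ((bumpMeasure_ae_norm_lt b).mono fun z hz => h (z, z) ?_)⟩
  · have hm := stronglyMeasurable_diffQuot a hGm
    exact (hm.comp_measurable (measurable_fst.sub
      (measurable_snd.prodMk measurable_snd))).sub (hm.comp_measurable measurable_fst)
  · simpa [Prod.norm_def] using hz.trans hb

end DiffQuotMollify

section MollifyBesov

variable {N : ℕ} {s : ℝ} {p : ℝ≥0} [hp : Fact (1 ≤ p)]

theorem Besov.grad_sub (u v : Besov N s p) : grad (u - v) = grad u - grad v := by
  rw [sub_eq_add_neg, ← neg_one_smul ℝ v, Besov.grad_add, Besov.grad_smul, neg_one_smul,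
    ← sub_eq_add_neg]

theorem Besov.lintegral_rpow_toLp_lt_top (w : Besov N s p) :
    ∫⁻ x, ‖(Besov.toLp w : E N → ℝ) x‖ₑ ^ (p : ℝ) < ∞ :=
  lintegral_rpow_enorm_lt_top_of_eLpNorm_lt_top
    (by exact_mod_cast (zero_lt_one.trans_le hp.out).ne') ENNReal.coe_ne_top
    (Lp.memLp (Besov.toLp w)).2

theorem Besov.locallyIntegrable_toLp (w : Besov N s p) :
    LocallyIntegrable (Besov.toLp w : E N → ℝ) :=
  (Lp.memLp _).locallyIntegrable Fact.out

theorem Besov.locallyIntegrable_grad (w : Besov N s p) :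
    LocallyIntegrable (Besov.grad w : E N → E N) :=
  (Lp.memLp _).locallyIntegrable Fact.out

theorem Besov.sobolevInt_mollify_lt_top (w : Besov N s p) (b : ContDiffBump (0 : E N)) :
    sobolevInt p (mollify b (Besov.toLp w)) < ∞ :=
  HessianDet.sobolevInt_mollify_lt_top b w.locallyIntegrable_toLp
    (Lp.stronglyMeasurable _).measurable (by exact_mod_cast hp.out) w.lintegral_rpow_toLp_lt_top

theorem Besov.exists_mollify (hN : N ≠ 0) (hs : 1 < s) (hs' : s < 2) (w : Besov N s p)
    (b : ContDiffBump (0 : E N)) :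
    ∃ w' : Besov N s p, (Besov.toLp w' : E N → ℝ) =ᵐ[volume] mollify b (Besov.toLp w) ∧
      (Besov.grad w' : E N → E N) =ᵐ[volume] mollify b (Besov.grad w) := by
  obtain ⟨C, -, hC⟩ := Besov.exists_of_sobolevInt (p := p) hN hs hs'
  obtain ⟨w', hw, hw', -⟩ := hC (mollify b (Besov.toLp w))
    (contDiff_mollify (n := 2) b w.locallyIntegrable_toLp)
    (w.sobolevInt_mollify_lt_top b)
  rw [w.hasWeakGradient_grad.gradient_mollify b w.locallyIntegrable_toLp
    w.locallyIntegrable_grad] at hw'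
  exact ⟨w', hw, hw'⟩

theorem Besov.grad_ae_eq_mollify (hN : N ≠ 0) (hs : 1 < s) (hs' : s < 2) (w : Besov N s p)
    {b : ContDiffBump (0 : E N)} {w' : Besov N s p}
    (hw' : (Besov.toLp w' : E N → ℝ) =ᵐ[volume] mollify b (Besov.toLp w)) :
    (Besov.grad w' : E N → E N) =ᵐ[volume] mollify b (Besov.grad w) := by
  obtain ⟨w'', hw, hgrad⟩ := w.exists_mollify hN hs hs' b
  rwa [Besov.toLp_injective (Lp.ext (hw'.trans hw.symm))]

theorem Besov.exists_gagliardo_mollify_sub_self_le (w : Besov N s p) {ε : ℝ} (hε : 0 < ε) :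
    ∃ δ > 0, ∀ b : ContDiffBump (0 : E N), b.rOut < δ →
      gagliardo (s - 1) p (mollify b (Besov.grad w) - ⇑(Besov.grad w)) ≤ ENNReal.ofReal ε := by
  have hp₀ : p ≠ 0 := (zero_lt_one.trans_le hp.out).ne'
  have hm : StronglyMeasurable (Besov.grad w : E N → E N) := Lp.stronglyMeasurable _
  have hfin := w.gagliardo_grad_lt_top
  simp only [gagliardo_eq_eLpNorm_diffQuot hp₀] at hfin ⊢
  exact exists_eLpNorm_diffQuot_mollify_sub_self_le _ hm w.locallyIntegrable_grad
    ⟨(stronglyMeasurable_diffQuot _ hm).aestronglyMeasurable, hfin⟩ hε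

theorem Besov.exists_norm_sub_le_of_ae_eq_mollify (hN : N ≠ 0) (hs : 1 < s) (hs' : s < 2)
    (w : Besov N s p) {ε : ℝ} (hε : 0 < ε) :
    ∃ δ > 0, ∀ b : ContDiffBump (0 : E N), b.rOut < δ → ∀ w' : Besov N s p,
      (Besov.toLp w' : E N → ℝ) =ᵐ[volume] mollify b (Besov.toLp w) → ‖w' - w‖ ≤ ε := by
  have hε₃ : 0 < ε / 3 := by positivity
  obtain ⟨δ₁, hδ₁, hval⟩ := exists_eLpNorm_mollify_sub_self_le
    (Lp.stronglyMeasurable (Besov.toLp w)) (Lp.memLp _) hε₃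
  obtain ⟨δ₂, hδ₂, hgrad⟩ := exists_eLpNorm_mollify_sub_self_le
    (Lp.stronglyMeasurable (Besov.grad w)) (Lp.memLp _) hε₃
  obtain ⟨δ₃, hδ₃, hgag⟩ := w.exists_gagliardo_mollify_sub_self_le hε₃
  refine ⟨min δ₁ (min δ₂ δ₃), lt_min hδ₁ (lt_min hδ₂ hδ₃), fun b hb w' hw => ?_⟩
  obtain ⟨hlt₁, hlt₂, hlt₃⟩ : b.rOut < δ₁ ∧ b.rOut < δ₂ ∧ b.rOut < δ₃ := by simpa using hb
  have hw' := w.grad_ae_eq_mollify hN hs hs' hw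
  have hwsub : (Besov.toLp (w' - w) : E N → ℝ) =ᵐ[volume]
      mollify b (Besov.toLp w) - ⇑(Besov.toLp w) := by
    rw [map_sub]
    exact (Lp.coeFn_sub _ _).trans (hw.sub .rfl)
  have hgradsub : (Besov.grad (w' - w) : E N → E N) =ᵐ[volume]
      mollify b (Besov.grad w) - ⇑(Besov.grad w) := by
    rw [Besov.grad_sub]
    exact (Lp.coeFn_sub _ _).trans (hw'.sub .rfl)
  rw [← ENNReal.ofReal_le_ofReal_iff hε.le, ofReal_norm, Besov.enorm_eq hwsub hgradsub]
  calc _ ≤ ENNReal.ofReal (ε / 3) + ENNReal.ofReal (ε / 3) + ENNReal.ofReal (ε / 3) := by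
        gcongr
        exacts [hval b hlt₁, hgrad b hlt₂, hgag b hlt₃]
    _ = ENNReal.ofReal ε := by
        rw [← ENNReal.ofReal_add hε₃.le hε₃.le, ← ENNReal.ofReal_add (by positivity) hε₃.le]
        ring_nf

end MollifyBesov

section Leibniz

variable {V : Type*} [NormedAddCommGroup V] [NormedSpace ℝ V]

theorem norm_iteratedFDeriv_comp_const_smul_le {f : V → ℝ} {i : ℕ} (hf : ContDiff ℝ i f) {c : ℝ}
    (hc : |c| ≤ 1) (x : V) :
    ‖iteratedFDeriv ℝ i (fun y => f (c • y)) x‖ ≤ ‖iteratedFDeriv ℝ i f (c • x)‖ := by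
  rw [iteratedFDeriv_comp_const_smul c hf, norm_smul, norm_pow]
  exact mul_le_of_le_one_left (norm_nonneg _) (pow_le_one₀ (norm_nonneg c) hc)

theorem norm_iteratedFDeriv_const_le (i : ℕ) (c : ℝ) (x : V) :
    ‖iteratedFDeriv ℝ i (fun _ : V => c) x‖ ≤ |c| := by
  obtain rfl | hi := eq_or_ne i 0
  · simp
  · simp [iteratedFDeriv_const_of_ne hi]

theorem exists_forall_norm_iteratedFDeriv_le {f : V → ℝ} {n : ℕ} (hf : ContDiff ℝ n f)
    (hc : HasCompactSupport f) : ∃ A : ℝ, ∀ i ≤ n, ∀ x, ‖iteratedFDeriv ℝ i f x‖ ≤ A := by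
  have hbound (i : ℕ) : ∃ A : ℝ, i ≤ n → ∀ x, ‖iteratedFDeriv ℝ i f x‖ ≤ A := by
    by_cases hi : i ≤ n
    · obtain ⟨A, hA⟩ := (hc.iteratedFDeriv i).exists_bound_of_continuous
        (hf.continuous_iteratedFDeriv (by exact_mod_cast hi))
      exact ⟨A, fun _ => hA⟩
    · exact ⟨0, fun h => absurd h hi⟩
  choose A hA using hbound
  exact ⟨(Finset.range (n + 1)).sup' ⟨0, by simp⟩ A, fun i hi x => (hA i hi x).trans
    (Finset.le_sup' A (Finset.mem_range_succ_iff.2 hi))⟩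

theorem norm_iteratedFDeriv_mul_le_sum {η v : V → ℝ} {n : ℕ} (hη : ContDiff ℝ n η)
    (hv : ContDiff ℝ n v) {A : ℝ} {x : V} (hA : ∀ i ≤ n, ‖iteratedFDeriv ℝ i η x‖ ≤ A) {k : ℕ}
    (hk : k ≤ n) :
    ‖iteratedFDeriv ℝ k (fun y => η y * v y) x‖ ≤
      2 ^ n * A * ∑ j ∈ Finset.range (n + 1), ‖iteratedFDeriv ℝ j v x‖ := by
  have hA₀ : 0 ≤ A := (norm_nonneg _).trans (hA 0 n.zero_le)
  set S := ∑ j ∈ Finset.range (n + 1), ‖iteratedFDeriv ℝ j v x‖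
  have hS {j : ℕ} (hj : j ≤ n) : ‖iteratedFDeriv ℝ j v x‖ ≤ S :=
    Finset.single_le_sum (f := fun j => ‖iteratedFDeriv ℝ j v x‖) (fun _ _ => norm_nonneg _)
      (Finset.mem_range_succ_iff.2 hj)
  have : 0 ≤ S := (norm_nonneg _).trans (hS n.zero_le)
  calc ‖iteratedFDeriv ℝ k (fun y => η y * v y) x‖
      ≤ ∑ i ∈ Finset.range (k + 1),
          (k.choose i : ℝ) * ‖iteratedFDeriv ℝ i η x‖ * ‖iteratedFDeriv ℝ (k - i) v x‖ :=
        norm_iteratedFDeriv_mul_le hη hv x (by exact_mod_cast hk)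
    _ ≤ ∑ i ∈ Finset.range (k + 1), (k.choose i : ℝ) * A * S := by
        gcongr with i hi
        · exact hA i ((Finset.mem_range_succ_iff.1 hi).trans hk)
        · exact hS ((k.sub_le i).trans hk)
    _ = 2 ^ k * A * S := by
        rw [← Finset.sum_mul, ← Finset.sum_mul]
        congr 2
        exact_mod_cast Nat.sum_range_choose k
    _ ≤ 2 ^ n * A * S := by
        gcongr
        norm_num

theorem enorm_iteratedFDeriv_mul_rpow_le {η v : V → ℝ} {n : ℕ} (hη : ContDiff ℝ n η)
    (hv : ContDiff ℝ n v) {A : ℝ} {x : V} (hA : ∀ i ≤ n, ‖iteratedFDeriv ℝ i η x‖ ≤ A) {k : ℕ}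
    (hk : k ≤ n) {p : ℝ} (hp : 1 ≤ p) :
    ‖iteratedFDeriv ℝ k (fun y => η y * v y) x‖ₑ ^ p ≤
      ENNReal.ofReal (2 ^ n * A) ^ p * (n + 1) ^ (p - 1) *
        ∑ j ∈ Finset.range (n + 1), ‖iteratedFDeriv ℝ j v x‖ₑ ^ p := by
  have hp₀ : 0 ≤ p := zero_le_one.trans hp
  have hA₀ : 0 ≤ A := (norm_nonneg _).trans (hA 0 n.zero_le)
  calc ‖iteratedFDeriv ℝ k (fun y => η y * v y) x‖ₑ ^ p
      ≤ ENNReal.ofReal (2 ^ n * A * ∑ j ∈ Finset.range (n + 1), ‖iteratedFDeriv ℝ j v x‖) ^ p := by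
        rw [← ofReal_norm]
        gcongr
        exact norm_iteratedFDeriv_mul_le_sum hη hv hA hk
    _ = ENNReal.ofReal (2 ^ n * A) ^ p *
          (∑ j ∈ Finset.range (n + 1), ‖iteratedFDeriv ℝ j v x‖ₑ) ^ p := by
        rw [ENNReal.ofReal_mul (by positivity), ENNReal.mul_rpow_of_nonneg _ _ hp₀,
          ENNReal.ofReal_sum_of_nonneg fun _ _ => norm_nonneg _]
        simp only [ofReal_norm]
    _ ≤ ENNReal.ofReal (2 ^ n * A) ^ p * ((n + 1) ^ (p - 1) *
          ∑ j ∈ Finset.range (n + 1), ‖iteratedFDeriv ℝ j v x‖ₑ ^ p) := by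
        gcongr
        simpa only [Finset.card_range, Nat.cast_add, Nat.cast_one] using
          ENNReal.rpow_sum_le_const_mul_sum_rpow (Finset.range (n + 1))
            (fun j => ‖iteratedFDeriv ℝ j v x‖ₑ) hp
    _ = _ := (mul_assoc _ _ _).symm

end Leibniz

section FarCutoff

variable {V : Type*} [NormedAddCommGroup V] [NormedSpace ℝ V] [FiniteDimensional ℝ V]

/-- The complement `x ↦ 1 - χ(x / R)` of a smooth cutoff function at scale `R`. -/
def farCutoff (R : ℝ) (x : V) : ℝ :=
  1 - (⟨1, 2, one_pos, one_lt_two⟩ : ContDiffBump (0 : V)) (R⁻¹ • x)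

theorem contDiff_farCutoff {n : ℕ∞} (R : ℝ) : ContDiff ℝ n (farCutoff R : V → ℝ) :=
  contDiff_const.sub ((ContDiffBump.contDiff _).comp (contDiff_const_smul R⁻¹))

theorem farCutoff_eq_zero {R : ℝ} (hR : 0 < R) {x : V} (hx : ‖x‖ ≤ R) : farCutoff R x = 0 := by
  rw [farCutoff, ContDiffBump.one_of_mem_closedBall, sub_self]
  rwa [mem_closedBall_zero_iff, norm_smul, norm_inv, Real.norm_of_nonneg hR.le,
    inv_mul_le_iff₀ hR, mul_one]

theorem farCutoff_eq_one {R : ℝ} (hR : 0 < R) {x : V} (hx : 2 * R ≤ ‖x‖) : farCutoff R x = 1 := by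
  rw [farCutoff, ContDiffBump.zero_of_le_dist, sub_zero]
  rwa [dist_zero_right, norm_smul, norm_inv, Real.norm_of_nonneg hR.le, le_inv_mul_iff₀ hR,
    mul_comm]

theorem hasCompactSupport_one_sub_farCutoff_mul {R : ℝ} (hR : 0 < R) (v : V → ℝ) :
    HasCompactSupport fun x => (1 - farCutoff R x) * v x := by
  refine HasCompactSupport.intro (isCompact_closedBall (0 : V) (2 * R)) fun x hx => ?_
  rw [mem_closedBall_zero_iff, not_le] at hx
  rw [farCutoff_eq_one hR hx.le, sub_self, zero_mul]

variable (V) in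
theorem exists_norm_iteratedFDeriv_farCutoff_le (n : ℕ) :
    ∃ A : ℝ, ∀ R : ℝ, 1 ≤ R → ∀ i ≤ n, ∀ x : V, ‖iteratedFDeriv ℝ i (farCutoff R) x‖ ≤ A := by
  set χ : ContDiffBump (0 : V) := ⟨1, 2, one_pos, one_lt_two⟩
  obtain ⟨A, hA⟩ := exists_forall_norm_iteratedFDeriv_le (n := n) χ.contDiff χ.hasCompactSupport
  refine ⟨1 + A, fun R hR i hi x => ?_⟩
  have hRinv : |R⁻¹| ≤ 1 := by
    rw [abs_inv, abs_of_nonneg (zero_le_one.trans hR)]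
    exact inv_le_one_of_one_le₀ hR
  have hχR : ContDiff ℝ i fun y => χ (R⁻¹ • y) := χ.contDiff.comp (contDiff_const_smul R⁻¹)
  calc ‖iteratedFDeriv ℝ i (farCutoff R) x‖
      ≤ ‖iteratedFDeriv ℝ i (fun _ : V => (1 : ℝ)) x‖ +
          ‖iteratedFDeriv ℝ i (fun y => χ (R⁻¹ • y)) x‖ := by
        rw [show farCutoff R = (fun _ : V => (1 : ℝ)) - fun y => χ (R⁻¹ • y) from rfl,
          iteratedFDeriv_sub_apply contDiff_const.contDiffAt hχR.contDiffAt]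
        exact norm_sub_le _ _
    _ ≤ 1 + A := by
        gcongr
        · simpa using norm_iteratedFDeriv_const_le i (1 : ℝ) x
        · exact (norm_iteratedFDeriv_comp_const_smul_le χ.contDiff hRinv x).trans (hA i hi _)

theorem iteratedFDeriv_farCutoff_mul_eq_zero {R : ℝ} (v : V → ℝ) {x : V} (hx : ‖x‖ < R) (k : ℕ) :
    iteratedFDeriv ℝ k (fun y => farCutoff R y * v y) x = 0 := by
  have hzero : (fun y => farCutoff R y * v y) =ᶠ[nhds x] fun _ => 0 := by
    filter_upwards [(isOpen_lt continuous_norm continuous_const).mem_nhds hx] with y hy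
    rw [farCutoff_eq_zero ((norm_nonneg x).trans_lt hx) (le_of_lt hy), zero_mul]
  rw [(hzero.iteratedFDeriv ℝ k).eq_of_nhds, iteratedFDeriv_fun_zero, Pi.zero_apply]

end FarCutoff

section SobolevTail

variable {V : Type*} [NormedAddCommGroup V]

theorem tendsto_setLIntegral_le_norm [MeasurableSpace V] [OpensMeasurableSpace V] {μ : Measure V}
    {J : V → ℝ≥0∞} (hJ : Measurable J) (hfin : ∫⁻ x, J x ∂μ ≠ ∞) :
    Filter.Tendsto (fun R : ℝ => ∫⁻ x in {x | R ≤ ‖x‖}, J x ∂μ) Filter.atTop (nhds 0) := by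
  have hmeas (R : ℝ) : MeasurableSet {x : V | R ≤ ‖x‖} :=
    (isClosed_le continuous_const continuous_norm).measurableSet
  simp only [← lintegral_indicator (hmeas _)]
  have hlim := tendsto_lintegral_filter_of_dominated_convergence (l := Filter.atTop) J
    (F := fun R : ℝ => {x | R ≤ ‖x‖}.indicator J) (f := fun _ => 0)
    (.of_forall fun R => hJ.indicator (hmeas R))
    (.of_forall fun R => .of_forall fun x => Set.indicator_le_self _ _ _) hfin
    (.of_forall fun x => tendsto_const_nhds.congr' ?_)
  · simpa using hlim
  · filter_upwards [Filter.eventually_gt_atTop ‖x‖] with R hR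
    exact (Set.indicator_of_notMem (s := {x | R ≤ ‖x‖}) (not_le.2 hR) J).symm

variable [NormedSpace ℝ V]

theorem norm_fderiv_fderiv (v : V → ℝ) (x : V) :
    ‖fderiv ℝ (fderiv ℝ v) x‖ = ‖iteratedFDeriv ℝ 2 v x‖ := by
  rw [← norm_iteratedFDeriv_one, norm_iteratedFDeriv_fderiv]

variable [MeasureSpace V]

theorem sobolevInt_eq_sum (p : ℝ) (v : V → ℝ) :
    sobolevInt p v = ∑ k ∈ Finset.range 3, ∫⁻ x, ‖iteratedFDeriv ℝ k v x‖ₑ ^ p := by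
  simp only [sobolevInt, Finset.sum_range_succ, Finset.sum_range_zero, zero_add, ← ofReal_norm,
    norm_iteratedFDeriv_zero, norm_iteratedFDeriv_one, norm_fderiv_fderiv]

variable [FiniteDimensional ℝ V] [BorelSpace V]

/-- The cutoff costs a factor independent of its scale `R ≥ 1`, and removes the ball of
radius `R`. -/
theorem tendsto_sobolevInt_farCutoff_mul {v : V → ℝ} (hv : ContDiff ℝ 2 v) {p : ℝ} (hp : 1 ≤ p)
    (hfin : sobolevInt p v < ∞) :
    Filter.Tendsto (fun R : ℝ => sobolevInt p fun x => farCutoff R x * v x) Filter.atTop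
      (nhds 0) := by
  obtain ⟨A, hA⟩ := exists_norm_iteratedFDeriv_farCutoff_le V 2
  have hmeas {k : ℕ} (hk : k ∈ Finset.range 3) :
      Measurable fun x => ‖iteratedFDeriv ℝ k v x‖ₑ ^ p := by
    have hcont := hv.continuous_iteratedFDeriv (m := k)
      (by exact_mod_cast Finset.mem_range_succ_iff.1 hk)
    exact hcont.enorm.measurable.pow_const _
  set J : V → ℝ≥0∞ := fun x => ∑ k ∈ Finset.range 3, ‖iteratedFDeriv ℝ k v x‖ₑ ^ p with hJ
  have hJint : ∫⁻ x, J x = sobolevInt p v := by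
    rw [sobolevInt_eq_sum, hJ, lintegral_finsetSum _ fun k hk => hmeas hk]
  set K : ℝ≥0∞ := ENNReal.ofReal (2 ^ 2 * A) ^ p * ((2 : ℕ) + 1) ^ (p - 1)
  have hKtop : K ≠ ∞ := ENNReal.mul_ne_top
    (ENNReal.rpow_ne_top_of_nonneg (by linarith) ENNReal.ofReal_ne_top)
    (ENNReal.rpow_ne_top_of_nonneg (by linarith) (by norm_num))
  have hpointwise {R : ℝ} (hR : 1 ≤ R) {k : ℕ} (hk : k ≤ 2) (x : V) :
      ‖iteratedFDeriv ℝ k (fun y => farCutoff R y * v y) x‖ₑ ^ p ≤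
        {x | R ≤ ‖x‖}.indicator (fun x => K * J x) x := by
    by_cases hx : R ≤ ‖x‖
    · rw [Set.indicator_of_mem (s := {x | R ≤ ‖x‖}) hx]
      exact enorm_iteratedFDeriv_mul_rpow_le (contDiff_farCutoff (n := 2) R) hv
        (fun i hi => hA R hR i hi x) hk hp
    · rw [← ofReal_norm, iteratedFDeriv_farCutoff_mul_eq_zero v (not_le.1 hx), norm_zero,
        ENNReal.ofReal_zero, ENNReal.zero_rpow_of_pos (by linarith)]
      exact zero_le
  have hbound {R : ℝ} (hR : 1 ≤ R) : sobolevInt p (fun x => farCutoff R x * v x) ≤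
      3 * (K * ∫⁻ x in {x | R ≤ ‖x‖}, J x) := by
    rw [sobolevInt_eq_sum, ← lintegral_const_mul' _ _ hKtop, ← lintegral_indicator
      (isClosed_le continuous_const continuous_norm).measurableSet]
    refine (Finset.sum_le_card_nsmul _ _ _ fun k hk => lintegral_mono
      (hpointwise hR (Finset.mem_range_succ_iff.1 hk))).trans_eq ?_
    simp
  have htail : Filter.Tendsto (fun R : ℝ => 3 * (K * ∫⁻ x in {x | R ≤ ‖x‖}, J x))
      Filter.atTop (nhds 0) := by
    simpa using ENNReal.Tendsto.const_mul (ENNReal.Tendsto.const_mul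
      (tendsto_setLIntegral_le_norm (Finset.measurable_sum _ fun k hk => hmeas hk)
        (hJint ▸ hfin.ne)) (.inr hKtop)) (.inr (by norm_num : (3 : ℝ≥0∞) ≠ ∞))
  exact tendsto_of_tendsto_of_tendsto_of_le_of_le' tendsto_const_nhds htail
    (.of_forall fun _ => zero_le) ((Filter.eventually_ge_atTop 1).mono fun R hR => hbound hR)

end SobolevTail

section Density

open scoped ContDiff

variable {N : ℕ} {s : ℝ} {p : ℝ≥0} [hp : Fact (1 ≤ p)]

theorem Besov.exists_cutoff_close (hN : N ≠ 0) (hs : 1 < s) (hs' : s < 2) {v : E N → ℝ}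
    (hv : ContDiff ℝ 2 v) (hfin : sobolevInt p v < ⊤) {ε : ℝ} (hε : 0 < ε) :
    ∃ R > 0, ∃ w : Besov N s p,
      (Besov.toLp w : E N → ℝ) =ᵐ[volume] (fun x => farCutoff R x * v x) ∧ ‖w‖ ≤ ε := by
  have hp₁ : (1 : ℝ) ≤ p := by exact_mod_cast hp.out
  obtain ⟨C, hC, hbesov⟩ := Besov.exists_of_sobolevInt (p := p) hN hs hs'
  have hlim := tendsto_sobolevInt_farCutoff_mul hv hp₁ hfin
  have hlim' : Filter.Tendsto
      (fun R : ℝ => C * sobolevInt p (fun x => farCutoff R x * v x) ^ (1 / (p : ℝ)))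
      Filter.atTop (nhds 0) := by
    have hpinv : (0 : ℝ) < 1 / p := by positivity
    simpa only [ENNReal.zero_rpow_of_pos hpinv, mul_zero] using
      ENNReal.Tendsto.const_mul (hlim.ennrpow_const (1 / (p : ℝ))) (.inr hC)
  obtain ⟨R, hR, hfinR, hεR⟩ := ((Filter.eventually_gt_atTop (0 : ℝ)).and
    ((hlim.eventually (gt_mem_nhds ENNReal.zero_lt_top)).and
      (hlim'.eventually (gt_mem_nhds (ENNReal.ofReal_pos.2 hε))))).exists
  obtain ⟨w, hw, -, hwle⟩ :=
    hbesov _ ((contDiff_farCutoff (n := 2) R).mul hv) hfinR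
  refine ⟨R, hR, w, hw, (ENNReal.ofReal_le_ofReal_iff hε.le).1 ?_⟩
  rw [ofReal_norm]
  exact hwle.trans hεR.le

theorem Besov.exists_smooth_close (hN : N ≠ 0) (hs : 1 < s) (hs' : s < 2) (w : Besov N s p)
    {ε : ℝ} (hε : 0 < ε) :
    ∃ (u : E N → ℝ) (w' : Besov N s p), ContDiff ℝ ∞ u ∧ HasCompactSupport u ∧
      (Besov.toLp w' : E N → ℝ) =ᵐ[volume] u ∧ ‖w' - w‖ ≤ ε := by
  obtain ⟨δ, hδ, hclose⟩ := w.exists_norm_sub_le_of_ae_eq_mollify hN hs hs' (half_pos hε)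
  let b : ContDiffBump (0 : E N) := ⟨δ / 4, δ / 2, by positivity, by linarith⟩
  obtain ⟨w₁, hw₁, -⟩ := w.exists_mollify hN hs hs' b
  have hw₁le := hclose b (half_lt_self hδ) w₁ hw₁
  obtain ⟨R, hR, w₂, hw₂, hw₂le⟩ := Besov.exists_cutoff_close hN hs hs'
    (contDiff_mollify (n := 2) b w.locallyIntegrable_toLp)
    (w.sobolevInt_mollify_lt_top b) (half_pos hε)
  refine ⟨fun x => (1 - farCutoff R x) * mollify b (Besov.toLp w) x, w₁ - w₂,
    (contDiff_const.sub (contDiff_farCutoff R)).mul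
      (contDiff_mollify b w.locallyIntegrable_toLp),
    hasCompactSupport_one_sub_farCutoff_mul hR _, ?_, ?_⟩
  · rw [map_sub]
    filter_upwards [Lp.coeFn_sub (Besov.toLp w₁) (Besov.toLp w₂), hw₁, hw₂] with x hsub h₁ h₂
    rw [hsub, Pi.sub_apply, h₁, h₂, sub_mul, one_mul]
  · calc ‖w₁ - w₂ - w‖ = ‖(w₁ - w) - w₂‖ := by rw [sub_right_comm]
      _ ≤ ‖w₁ - w‖ + ‖w₂‖ := norm_sub_le _ _
      _ ≤ ε := by linarith

end Density

section Difference

theorem exists_abs_eval_sub_eval_zero_le (q : Polynomial ℝ) :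
    ∃ L : ℝ, 0 ≤ L ∧ ∀ θ ∈ Set.Icc (0 : ℝ) 1, |q.eval θ - q.eval 0| ≤ L * θ := by
  obtain ⟨L, hL⟩ := isCompact_Icc.exists_bound_of_continuousOn
    (s := Set.Icc (0 : ℝ) 1) (f := fun θ => q.divX.eval θ) q.divX.continuous.continuousOn
  refine ⟨L, (norm_nonneg _).trans (hL 0 (by simp)), fun θ hθ => ?_⟩
  have hq : ∀ t, q.eval t = q.divX.eval t * t + q.coeff 0 := fun t => by
    conv_lhs => rw [← q.divX_mul_X_add]
    simp
  rw [hq θ, hq 0, mul_zero, zero_add, add_sub_cancel_right, abs_mul, abs_of_nonneg hθ.1]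
  exact mul_le_mul_of_nonneg_right (hL θ hθ) hθ.1

theorem exists_abs_eval_sub_eval_zero_le_of_natDegree_le (d : ℕ) :
    ∃ L : ℝ, 0 ≤ L ∧ ∀ (P : Polynomial ℝ) (B : ℝ), P.natDegree ≤ d →
      (∀ k ≤ d, |P.eval (k : ℝ)| ≤ B) →
        ∀ θ ∈ Set.Icc (0 : ℝ) 1, |P.eval θ - P.eval 0| ≤ L * B * θ := by
  choose L hL₀ hL using fun k : ℕ => exists_abs_eval_sub_eval_zero_le
    (Lagrange.basis (Finset.range (d + 1)) (fun k : ℕ => (k : ℝ)) k)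
  refine ⟨∑ k ∈ Finset.range (d + 1), L k, Finset.sum_nonneg fun k _ => hL₀ k,
    fun P B hP hB θ hθ => ?_⟩
  have hB₀ : 0 ≤ B := (abs_nonneg _).trans (hB 0 d.zero_le)
  rw [eval_eq_sum_lagrange hP θ, eval_eq_sum_lagrange hP 0, ← Finset.sum_sub_distrib,
    Finset.sum_mul, Finset.sum_mul]
  refine (Finset.abs_sum_le_sum_abs _ _).trans (Finset.sum_le_sum fun k hk => ?_)
  rw [← mul_sub, abs_mul, mul_comm (L k), mul_assoc]
  exact mul_le_mul (hB k (Finset.mem_range_succ_iff.1 hk)) (hL k θ hθ) (abs_nonneg _) hB₀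

/- Rescale by `(a + b) / b`, so that `P` is of size `(a + b) ^ (d + 1)` at the nodes `0, …, d + 1`
and the increment is evaluated at `b / (a + b)`. -/
theorem exists_abs_eval_one_sub_eval_zero_le (d : ℕ) :
    ∃ L : ℝ, 0 ≤ L ∧ ∀ (P : Polynomial ℝ) (C a b : ℝ), P.natDegree ≤ d + 1 → 0 ≤ C → 0 ≤ a →
      0 < b → (∀ θ, 0 ≤ θ → |P.eval θ| ≤ C * (a + θ * b) ^ (d + 1)) →
        |P.eval 1 - P.eval 0| ≤ L * C * b * (a + b) ^ d := by
  obtain ⟨L, hL₀, hL⟩ := exists_abs_eval_sub_eval_zero_le_of_natDegree_le (d + 1)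
  refine ⟨L * (d + 2) ^ (d + 1), by positivity, fun P C a b hdeg hC ha hb hP => ?_⟩
  have hab : 0 < a + b := by positivity
  set Q : Polynomial ℝ := P.comp (Polynomial.C ((a + b) / b) * Polynomial.X)
  have hQ (θ : ℝ) : Q.eval θ = P.eval ((a + b) / b * θ) := by simp [Q]
  have hQdeg : Q.natDegree ≤ d + 1 :=
    Polynomial.natDegree_comp_le.trans <| (Nat.mul_le_mul hdeg
      ((Polynomial.natDegree_C_mul_le _ _).trans Polynomial.natDegree_X_le)).trans_eq
      (mul_one _)
  have hnode : ∀ k ≤ d + 1, |Q.eval (k : ℝ)| ≤ C * ((d + 2) * (a + b)) ^ (d + 1) := by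
    intro k hk
    have hk' : (k : ℝ) ≤ d + 1 := by exact_mod_cast hk
    rw [hQ]
    refine (hP _ (by positivity)).trans ?_
    gcongr
    calc a + (a + b) / b * k * b = a + k * (a + b) := by field_simp
      _ ≤ (a + b) + (d + 1) * (a + b) := by gcongr; linarith
      _ = (d + 2) * (a + b) := by ring
  have hθ : b / (a + b) ∈ Set.Icc (0 : ℝ) 1 :=
    ⟨by positivity, (div_le_one hab).2 (by linarith)⟩
  have h := hL Q _ hQdeg hnode _ hθ
  rw [hQ, hQ, mul_zero, div_mul_div_cancel₀ hb.ne', div_self hab.ne'] at h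
  calc _ ≤ L * (C * ((d + 2) * (a + b)) ^ (d + 1)) * (b / (a + b)) := h
    _ = L * (d + 2) ^ (d + 1) * C * b * (a + b) ^ d := by
        rw [mul_pow, pow_succ (a + b)]
        field_simp

theorem norm_add_norm_sub_pow_le {V : Type*} [SeminormedAddCommGroup V] (v w : V) (d : ℕ) :
    (‖w‖ + ‖v - w‖) ^ d ≤ 2 ^ d * 2 ^ (d - 1) * (‖v‖ ^ d + ‖w‖ ^ d) := by
  have hsub : ‖v - w‖ ≤ ‖v‖ + ‖w‖ := norm_sub_le _ _
  calc (‖w‖ + ‖v - w‖) ^ d ≤ (2 * (‖v‖ + ‖w‖)) ^ d := by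
        gcongr; linarith [norm_nonneg v]
    _ = 2 ^ d * (‖v‖ + ‖w‖) ^ d := mul_pow _ _ _
    _ ≤ 2 ^ d * (2 ^ (d - 1) * (‖v‖ ^ d + ‖w‖ ^ d)) := by
        gcongr; exact add_pow_le (norm_nonneg _) (norm_nonneg _) _
    _ = 2 ^ d * 2 ^ (d - 1) * (‖v‖ ^ d + ‖w‖ ^ d) := (mul_assoc _ _ _).symm

end Difference

section HessianIntegral

variable {N : ℕ} {u v φ : E N → ℝ}

theorem abs_hessian_le (u : E N → ℝ) (x : E N) (i j : Fin N) :
    |hessian u x i j| ≤ ‖iteratedFDeriv ℝ 2 u x‖ := by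
  have h := (iteratedFDeriv ℝ 2 u x).le_opNorm
    ![EuclideanSpace.single i 1, EuclideanSpace.single j 1]
  simpa [hessian, Fin.prod_univ_two] using h

theorem supNormD2_nonneg (φ : E N → ℝ) : 0 ≤ supNormD2 φ := ENNReal.toReal_nonneg

theorem ae_abs_hessian_le_supNormD2 (hφ : ContDiff ℝ 2 φ) (hc : HasCompactSupport φ) :
    ∀ᵐ x, ∀ i j, |hessian φ x i j| ≤ supNormD2 φ := by
  have hmem : MemLp (iteratedFDeriv ℝ 2 φ) ∞ volume :=
    (hφ.continuous_iteratedFDeriv (m := 2) le_rfl).memLp_of_hasCompactSupport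
      (hc.iteratedFDeriv 2)
  filter_upwards [ae_le_eLpNormEssSup (f := iteratedFDeriv ℝ 2 φ) (μ := volume)] with x hx i j
  rw [← eLpNorm_exponent_top] at hx
  refine (abs_hessian_le φ x i j).trans ?_
  rw [supNormD2, ← toReal_enorm]
  exact ENNReal.toReal_mono hmem.2.ne hx

theorem supNormD2_le {M : ℝ} (h : ∀ x, ‖iteratedFDeriv ℝ 2 φ x‖ ≤ M) : supNormD2 φ ≤ M := by
  rw [supNormD2, eLpNorm_exponent_top]
  exact ENNReal.toReal_le_of_le_ofReal ((norm_nonneg _).trans (h 0))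
    (eLpNormEssSup_le_of_ae_bound (Filter.Eventually.of_forall h))

theorem continuous_hessian (hu : ContDiff ℝ 2 u) (i j : Fin N) :
    Continuous fun x => hessian u x i j :=
  contDiff_zero.1 (contDiff_hessian (m := 0) hu (by norm_num) i j)

theorem hessian_add_smul (hu : ContDiff ℝ 2 u) (hv : ContDiff ℝ 2 v) (c : ℝ) (x : E N) :
    hessian (u + c • v) x = hessian u x + c • hessian v x := by
  have hcv : ContDiff ℝ 2 (c • v) := hv.const_smul c
  ext i j
  simp only [hessian, Matrix.of_apply, Matrix.add_apply, Matrix.smul_apply]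
  rw [iteratedFDeriv_add_apply hu.contDiffAt hcv.contDiffAt,
    iteratedFDeriv_const_smul_apply hv.contDiffAt]
  rfl

theorem continuous_det_hessian (hu : ContDiff ℝ 2 u) : Continuous fun x => (hessian u x).det :=
  (continuous_matrix fun i j => continuous_hessian hu i j).matrix_det

theorem integrable_det_hessian_mul (hu : ContDiff ℝ 2 u) (hφ : Continuous φ)
    (hc : HasCompactSupport φ) : Integrable fun x => (hessian u x).det * φ x :=
  ((continuous_det_hessian hu).mul hφ).integrable_of_hasCompactSupport hc.mul_left

theorem exists_polynomial_integral_det_hessian_add_smul (hu : ContDiff ℝ 2 u)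
    (hv : ContDiff ℝ 2 v) (hφ : Continuous φ) (hc : HasCompactSupport φ) :
    ∃ P : Polynomial ℝ, P.natDegree ≤ N ∧
      ∀ θ : ℝ, P.eval θ = ∫ x, (hessian (u + θ • v) x).det * φ x := by
  let ℓ (k : ℕ) : Polynomial ℝ := Lagrange.basis (Finset.range (N + 1)) (fun k : ℕ => (k : ℝ)) k
  have hdeg : ∀ k ∈ Finset.range (N + 1), (ℓ k).natDegree ≤ N := fun k hk =>
    Polynomial.natDegree_le_of_degree_le
      (by rw [Lagrange.degree_basis Nat.cast_injective.injOn hk, Finset.card_range,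
        Nat.add_sub_cancel])
  refine ⟨∑ k ∈ Finset.range (N + 1),
    Polynomial.C (∫ x, (hessian (u + (k : ℝ) • v) x).det * φ x) * ℓ k,
    Polynomial.natDegree_sum_le_of_forall_le _ _ fun k hk =>
      (Polynomial.natDegree_C_mul_le _ _).trans (hdeg k hk), fun θ => ?_⟩
  simp only [Polynomial.eval_finsetSum, Polynomial.eval_mul, Polynomial.eval_C,
    ← integral_mul_const]
  have hint (k : ℕ) : Integrable fun x =>
      (hessian (u + (k : ℝ) • v) x).det * φ x * (ℓ k).eval θ :=
    (integrable_det_hessian_mul (hu.add (hv.const_smul (k : ℝ))) hφ hc).mul_const _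
  rw [← integral_finsetSum _ fun k _ => hint k]
  refine integral_congr_ae (Filter.Eventually.of_forall fun x => ?_)
  simp only [hessian_add_smul hu hv]
  rw [det_add_smul_eq_sum_lagrange, Finset.sum_mul, Fintype.card_fin]
  exact Finset.sum_congr rfl fun k _ => mul_right_comm _ _ _

end HessianIntegral

section SmoothRep

open scoped ContDiff

variable {N : ℕ} {s : ℝ} {p : ℝ≥0} [Fact (1 ≤ p)]

/-- `u` is a `C_c^∞` representative of the element `w` of `B(s, p)`. -/
structure IsSmoothRep (w : Besov N s p) (u : E N → ℝ) : Prop where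
  contDiff : ContDiff ℝ ∞ u
  hasCompactSupport : HasCompactSupport u
  ae_eq : (Besov.toLp w : E N → ℝ) =ᵐ[volume] u

namespace IsSmoothRep

variable {w w' : Besov N s p} {u u' : E N → ℝ}

theorem contDiff_nat (h : IsSmoothRep w u) (n : ℕ) : ContDiff ℝ n u :=
  contDiff_infty.1 h.contDiff n

theorem add_smul (h : IsSmoothRep w u) (h' : IsSmoothRep w' u') (c : ℝ) :
    IsSmoothRep (w + c • w') (u + c • u') where
  contDiff := h.contDiff.add (h'.contDiff.const_smul c)
  hasCompactSupport := h.hasCompactSupport.add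
    (h'.hasCompactSupport.comp_left (g := fun y => c • y) (smul_zero c))
  ae_eq := by
    rw [map_add, map_smul]
    exact (Lp.coeFn_add _ _).trans
      (h.ae_eq.add ((Lp.coeFn_smul _ _).trans (h'.ae_eq.const_smul c)))

theorem unique (h : IsSmoothRep w u) (h' : IsSmoothRep w u') : u = u' :=
  (h.contDiff.continuous.ae_eq_iff_eq volume h'.contDiff.continuous).1
    (h.ae_eq.symm.trans h'.ae_eq)

theorem grad_ae_eq (h : IsSmoothRep w u) : (Besov.grad w : E N → E N) =ᵐ[volume] gradient u := by
  have hu : ContDiff ℝ 1 u := h.contDiff_nat 1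
  exact ((Besov.hasWeakGradient_grad w).congr h.ae_eq .rfl).unique
    (hasWeakGradient_gradient hu) (Lp.memLp _)
    ((continuous_gradient hu).memLp_of_hasCompactSupport
      ((h.hasCompactSupport.fderiv ℝ).comp_left (map_zero _)))

theorem gagliardo_gradient_le_enorm (h : IsSmoothRep w u) :
    gagliardo (s - 1) p (gradient u) ≤ ‖w‖ₑ := by
  rw [Besov.enorm_eq h.ae_eq h.grad_ae_eq]
  exact le_add_self

end IsSmoothRep

end SmoothRep

section SmoothEstimate

variable {N : ℕ} [hN : Fact (3 ≤ N)]

theorem lintegral_fderiv_sub_le_enorm_pow {w : CriticalBesov N} {u : E N → ℝ}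
    (h : IsSmoothRep w u) :
    ∫⁻ z : E N × E N, ‖fderiv ℝ u z.1 - fderiv ℝ u z.2‖ₑ ^ (N : ℝ) /
      ‖z.1 - z.2‖ₑ ^ (2 * N - 2 : ℝ) ≤ ‖w‖ₑ ^ N := by
  have hN₀ : (0 : ℝ) < N := by exact_mod_cast (by decide : 0 < 3).trans_le hN.out
  have hexp : (N : ℝ) + (2 - 2 / (N : ℝ) - 1) * N = 2 * N - 2 := by field_simp; ring
  have hle := h.gagliardo_gradient_le_enorm
  rw [gagliardo_gradient, NNReal.coe_natCast, hexp] at hle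
  have hpow := ENNReal.rpow_le_rpow hle hN₀.le
  rwa [← ENNReal.rpow_mul, one_div_mul_cancel hN₀.ne', ENNReal.rpow_one,
    ENNReal.rpow_natCast] at hpow

variable (N) in
theorem exists_abs_integral_det_hessian_le :
    ∃ C : ℝ, 0 ≤ C ∧ ∀ (w : CriticalBesov N) (u φ : E N → ℝ), IsSmoothRep w u → ContDiff ℝ 2 φ →
      HasCompactSupport φ →
      |∫ x, (hessian u x).det * φ x| ≤ C * ‖w‖ ^ N * supNormD2 φ := by
  obtain ⟨C, hC, h⟩ := exists_enorm_integral_det_hessian_le (N := N)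
    ((by decide : 2 ≤ 3).trans hN.out)
  refine ⟨C.toReal, ENNReal.toReal_nonneg, fun w u φ hu hφ hc => ?_⟩
  have henorm : ‖∫ x, (hessian u x).det * φ x‖ₑ ≤
      C * ENNReal.ofReal (supNormD2 φ) * ‖w‖ₑ ^ N :=
    (h u φ (supNormD2 φ) (hu.contDiff_nat 3) hu.hasCompactSupport hφ hc
      (ae_abs_hessian_le_supNormD2 hφ hc)).trans
      (by gcongr; exact lintegral_fderiv_sub_le_enorm_pow hu)
  have hreal := ENNReal.toReal_mono (ENNReal.mul_ne_top (ENNReal.mul_ne_top hC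
    ENNReal.ofReal_ne_top) (ENNReal.pow_ne_top enorm_ne_top)) henorm
  rwa [toReal_enorm, Real.norm_eq_abs, ENNReal.toReal_mul, ENNReal.toReal_mul,
    ENNReal.toReal_ofReal (supNormD2_nonneg φ), ENNReal.toReal_pow, toReal_enorm,
    mul_right_comm] at hreal

variable (N) in
theorem exists_abs_integral_det_hessian_sub_le :
    ∃ C : ℝ, 0 ≤ C ∧ ∀ (w₁ w₂ : CriticalBesov N) (u₁ u₂ φ : E N → ℝ), IsSmoothRep w₁ u₁ →
      IsSmoothRep w₂ u₂ → ContDiff ℝ 2 φ → HasCompactSupport φ →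
      |(∫ x, (hessian u₁ x).det * φ x) - ∫ x, (hessian u₂ x).det * φ x| ≤
        C * ‖w₁ - w₂‖ * (‖w₁‖ ^ (N - 1) + ‖w₂‖ ^ (N - 1)) * supNormD2 φ := by
  obtain ⟨C, hC, hbound⟩ := exists_abs_integral_det_hessian_le N
  obtain ⟨L, hL₀, hL⟩ := exists_abs_eval_one_sub_eval_zero_le (N - 1)
  have hN₁ : N - 1 + 1 = N := Nat.sub_add_cancel ((by decide : 1 ≤ 3).trans hN.out)
  rw [hN₁] at hL
  refine ⟨L * C * (2 ^ (N - 1) * 2 ^ (N - 1 - 1)), by positivity,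
    fun w₁ w₂ u₁ u₂ φ h₁ h₂ hφ hc => ?_⟩
  have hS := supNormD2_nonneg φ
  rcases eq_or_ne w₁ w₂ with rfl | hne
  · rw [h₁.unique h₂, sub_self, abs_zero]
    positivity
  have hdiff : IsSmoothRep (w₁ + (-1 : ℝ) • w₂) (u₁ + (-1 : ℝ) • u₂) := h₁.add_smul h₂ _
  obtain ⟨P, hdeg, hP⟩ := exists_polynomial_integral_det_hessian_add_smul (h₂.contDiff_nat 2)
    (hdiff.contDiff_nat 2) hφ.continuous hc
  have hPle (θ : ℝ) (hθ : 0 ≤ θ) :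
      |P.eval θ| ≤ C * supNormD2 φ * (‖w₂‖ + θ * ‖w₁ - w₂‖) ^ N := by
    rw [hP, mul_right_comm]
    refine (hbound _ _ φ (h₂.add_smul hdiff θ) hφ hc).trans ?_
    gcongr
    refine (norm_add_le _ _).trans_eq ?_
    rw [norm_smul, Real.norm_of_nonneg hθ, neg_one_smul, ← sub_eq_add_neg]
  have hP₁ : P.eval 1 = ∫ x, (hessian u₁ x).det * φ x := by
    rw [hP, one_smul, neg_one_smul, add_comm, neg_add_cancel_right]
  have hP₀ : P.eval 0 = ∫ x, (hessian u₂ x).det * φ x := by rw [hP, zero_smul, add_zero]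
  rw [← hP₁, ← hP₀]
  calc _ ≤ L * (C * supNormD2 φ) * ‖w₁ - w₂‖ * (‖w₂‖ + ‖w₁ - w₂‖) ^ (N - 1) :=
        hL P _ _ _ hdeg (by positivity) (norm_nonneg _) (norm_pos_iff.2 (sub_ne_zero.2 hne)) hPle
    _ ≤ L * (C * supNormD2 φ) * ‖w₁ - w₂‖ *
          (2 ^ (N - 1) * 2 ^ (N - 1 - 1) * (‖w₁‖ ^ (N - 1) + ‖w₂‖ ^ (N - 1))) := by
        gcongr
        exact norm_add_norm_sub_pow_le w₁ w₂ _
    _ = _ := by ring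

end SmoothEstimate

section MollifyHessian

theorem exists_contDiffBump_tendsto_rOut (V : Type*) [NormedAddCommGroup V] :
    ∃ b : ℕ → ContDiffBump (0 : V), Filter.Tendsto (fun n => (b n).rOut) Filter.atTop (nhds 0) :=
  ⟨fun n => ⟨1 / (n + 2), 1 / (n + 1), by positivity, by gcongr; norm_num⟩,
    tendsto_one_div_add_atTop_nhds_zero_nat⟩

section

variable {V : Type*} [NormedAddCommGroup V] [NormedSpace ℝ V] [FiniteDimensional ℝ V]
  [MeasureSpace V] [BorelSpace V] [(volume : Measure V).IsAddHaarMeasure] {f g : V → ℝ}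
  (b : ContDiffBump (0 : V))

theorem mollify_congr_ae (h : f =ᵐ[volume] g) : mollify b f = mollify b g :=
  convolution_congr _ .rfl h

theorem hasCompactSupport_mollify (hf : HasCompactSupport f) : HasCompactSupport (mollify b f) :=
  HasCompactSupport.convolution _ b.hasCompactSupport_normed hf

theorem dirDeriv_mollify (hf : ContDiff ℝ 1 f) (hc : HasCompactSupport f) (v : V) :
    dirDeriv v (mollify b f) = mollify b (dirDeriv v f) := by
  ext x
  have hρ : LocallyIntegrable (b.normed volume) := b.continuous_normed.locallyIntegrable
  rw [dirDeriv, mollify,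
    (hc.hasFDerivAt_convolution_right (ContinuousLinearMap.lsmul ℝ ℝ) hρ hf x).fderiv,
    convolution_precompR_apply _ hρ (hc.fderiv ℝ) (hf.continuous_fderiv one_ne_zero)]
  rfl

theorem abs_mollify_le {M : ℝ} (hf : ∀ x, |f x| ≤ M) (x : V) : |mollify b f x| ≤ M := by
  rw [mollify_apply, ← Real.norm_eq_abs]
  calc _ ≤ ∫ z, b.normed volume z * M := by
        refine norm_integral_le_of_norm_le (b.integrable_normed.mul_const M)
          (Filter.Eventually.of_forall fun z => ?_)
        rw [norm_smul, Real.norm_of_nonneg (b.nonneg_normed z)]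
        exact mul_le_mul_of_nonneg_left (hf _) (b.nonneg_normed z)
    _ = M := by rw [integral_mul_const, b.integral_normed, one_mul]

end

variable {N : ℕ} {u φ : E N → ℝ}

theorem hessian_mollify (b : ContDiffBump (0 : E N)) (hu : ContDiff ℝ 2 u)
    (hc : HasCompactSupport u) (x : E N) (i j : Fin N) :
    hessian (mollify b u) x i j = mollify b (fun y => hessian u y i j) x := by
  have hdu : ContDiff ℝ 1 (dirDeriv (stdVec j) u) := contDiff_dirDeriv hu (by norm_num) _
  rw [hessian_apply (contDiff_mollify (n := 2) b hu.continuous.locallyIntegrable),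
    dirDeriv_mollify b (hu.of_le one_le_two) hc,
    dirDeriv_mollify b hdu (hasCompactSupport_dirDeriv hc _)]
  simp only [hessian_apply hu]

variable {ι : Type*} {l : Filter ι} {b : ι → ContDiffBump (0 : E N)}

theorem tendsto_hessian_mollify (hb : Filter.Tendsto (fun i => (b i).rOut) l (nhds 0))
    (hu : ContDiff ℝ 2 u) (hc : HasCompactSupport u) (x : E N) :
    Filter.Tendsto (fun i => hessian (mollify (b i) u) x) l (nhds (hessian u x)) := by
  refine tendsto_pi_nhds.2 fun j => tendsto_pi_nhds.2 fun k => ?_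
  simp only [hessian_mollify _ hu hc]
  exact ContDiffBump.convolution_tendsto_right_of_continuous hb (continuous_hessian hu j k) x

theorem tendsto_integral_det_hessian_mollify [l.IsCountablyGenerated]
    (hb : Filter.Tendsto (fun i => (b i).rOut) l (nhds 0)) (hu : ContDiff ℝ 2 u)
    (hc : HasCompactSupport u) (hφ : Continuous φ) (hφc : HasCompactSupport φ) :
    Filter.Tendsto (fun i => ∫ x, (hessian (mollify (b i) u) x).det * φ x) l
      (nhds (∫ x, (hessian u x).det * φ x)) := by
  obtain ⟨M, hM⟩ := (hc.iteratedFDeriv (𝕜 := ℝ) 2).exists_bound_of_continuous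
    (hu.continuous_iteratedFDeriv (m := 2) le_rfl)
  refine tendsto_integral_filter_of_dominated_convergence
    (fun x => ((Fintype.card (Fin N)).factorial * M ^ Fintype.card (Fin N)) * |φ x|)
    (.of_forall fun i => ?_) (.of_forall fun i => .of_forall fun x => ?_)
    ((hφ.integrable_of_hasCompactSupport hφc).abs.const_mul _) (.of_forall fun x => ?_)
  · exact ((continuous_det_hessian (contDiff_mollify (n := 2) _
      hu.continuous.locallyIntegrable)).mul hφ).aestronglyMeasurable
  · rw [norm_mul, Real.norm_eq_abs, Real.norm_eq_abs]
    refine mul_le_mul_of_nonneg_right (abs_det_le fun j k => ?_) (abs_nonneg _)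
    rw [hessian_mollify _ hu hc]
    exact abs_mollify_le _ (fun y => (abs_hessian_le u y j k).trans (hM y)) x
  · exact (((Continuous.matrix_det continuous_id).tendsto _).comp
      (tendsto_hessian_mollify hb hu hc x)).mul_const _

end MollifyHessian

section Approximation

variable {N : ℕ} {s : ℝ} {p : ℝ≥0} [Fact (1 ≤ p)] {ι : Type*} {l : Filter ι}

theorem Besov.exists_toLp_ae_eq (hN : N ≠ 0) (hs : 1 < s) (hs' : s < 2) {u : E N → ℝ}
    (hu : ContDiff ℝ 2 u) (hc : HasCompactSupport u) :
    ∃ w : Besov N s p, (Besov.toLp w : E N → ℝ) =ᵐ[volume] u := by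
  have hp : (0 : ℝ) < p := by exact_mod_cast zero_lt_one.trans_le (Fact.out : 1 ≤ p)
  obtain ⟨C, -, hC⟩ := Besov.exists_of_sobolevInt (p := p) hN hs hs'
  obtain ⟨w, hw, -, -⟩ := hC u hu (sobolevInt_lt_top_of_hasCompactSupport hu hc hp)
  exact ⟨w, hw⟩

theorem Besov.tendsto_of_ae_eq_mollify (hN : N ≠ 0) (hs : 1 < s) (hs' : s < 2)
    {w : Besov N s p} {v : ι → Besov N s p} {b : ι → ContDiffBump (0 : E N)}
    (hb : Filter.Tendsto (fun i => (b i).rOut) l (nhds 0))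
    (hv : ∀ i, (Besov.toLp (v i) : E N → ℝ) =ᵐ[volume] mollify (b i) (Besov.toLp w)) :
    Filter.Tendsto v l (nhds w) := by
  refine Metric.nhds_basis_closedBall.tendsto_right_iff.2 fun ε hε => ?_
  obtain ⟨δ, hδ, hclose⟩ := w.exists_norm_sub_le_of_ae_eq_mollify hN hs hs' hε
  filter_upwards [hb.eventually (gt_mem_nhds hδ)] with i hi
  rw [mem_closedBall_iff_norm]
  exact hclose (b i) hi (v i) (hv i)

/-- The elements `v i` of `B(s, p)` converge to `w` along `l` and have the `C_c^∞`
representatives `u i`. -/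
structure IsApprox (l : Filter ι) (w : Besov N s p) (v : ι → Besov N s p) (u : ι → E N → ℝ) :
    Prop where
  isSmoothRep : ∀ i, IsSmoothRep (v i) (u i)
  tendsto : Filter.Tendsto v l (nhds w)

theorem IsApprox.comp {w : Besov N s p} {v : ι → Besov N s p} {u : ι → E N → ℝ}
    (h : IsApprox l w v u) {κ : Type*} {l' : Filter κ} {k : κ → ι} (hk : Filter.Tendsto k l' l) :
    IsApprox l' w (v ∘ k) (u ∘ k) where
  isSmoothRep i := h.isSmoothRep (k i)
  tendsto := h.tendsto.comp hk

theorem exists_isApprox (hN : N ≠ 0) (hs : 1 < s) (hs' : s < 2) (w : Besov N s p) :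
    ∃ (v : ℕ → Besov N s p) (u : ℕ → E N → ℝ), IsApprox Filter.atTop w v u := by
  choose u v hu hc hv hclose using fun n : ℕ =>
    Besov.exists_smooth_close hN hs hs' w (Nat.one_div_pos_of_nat (α := ℝ) (n := n))
  exact ⟨v, u, fun n => ⟨hu n, hc n, hv n⟩, tendsto_iff_norm_sub_tendsto_zero.2
    (squeeze_zero (fun _ => norm_nonneg _) hclose tendsto_one_div_add_atTop_nhds_zero_nat)⟩

theorem exists_isApprox_mollify (hN : N ≠ 0) (hs : 1 < s) (hs' : s < 2) {w : Besov N s p}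
    {u : E N → ℝ} (hw : (Besov.toLp w : E N → ℝ) =ᵐ[volume] u) (hc : HasCompactSupport u)
    {b : ι → ContDiffBump (0 : E N)} (hb : Filter.Tendsto (fun i => (b i).rOut) l (nhds 0)) :
    ∃ v : ι → Besov N s p, IsApprox l w v fun i => mollify (b i) u := by
  choose v hv _ using fun i => w.exists_mollify hN hs hs' (b i)
  refine ⟨v, fun i => ⟨?_, hasCompactSupport_mollify _ hc, ?_⟩,
    Besov.tendsto_of_ae_eq_mollify hN hs hs' hb hv⟩
  · rw [← mollify_congr_ae _ hw]
    exact contDiff_mollify (b i) w.locallyIntegrable_toLp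
  · rw [← mollify_congr_ae _ hw]
    exact hv i

end Approximation

section Extension

variable {N : ℕ} [hN : Fact (3 ≤ N)]

theorem ne_zero_of_fact_three_le (N : ℕ) [hN : Fact (3 ≤ N)] : N ≠ 0 :=
  ((by decide : 0 < 3).trans_le hN.out).ne'

theorem one_lt_criticalExponent (N : ℕ) [hN : Fact (3 ≤ N)] : 1 < 2 - 2 / (N : ℝ) := by
  have hN₃ : (3 : ℝ) ≤ N := by exact_mod_cast hN.out
  have hlt : 2 / (N : ℝ) < 1 := (div_lt_one (by linarith)).2 (by linarith)
  linarith

theorem criticalExponent_lt_two (N : ℕ) [Fact (3 ≤ N)] : 2 - 2 / (N : ℝ) < 2 := by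
  have hN₀ := ne_zero_of_fact_three_le N
  have hpos : 0 < 2 / (N : ℝ) := by positivity
  linarith

theorem CriticalBesov.exists_isApprox (w : CriticalBesov N) :
    ∃ (v : ℕ → CriticalBesov N) (u : ℕ → E N → ℝ), IsApprox Filter.atTop w v u :=
  HessianDet.exists_isApprox (ne_zero_of_fact_three_le N) (one_lt_criticalExponent N)
    (criticalExponent_lt_two N) w

theorem tendsto_norm_sub_mul_add_pow {V ι : Type*} [SeminormedAddCommGroup V] {l : Filter ι}
    {v₁ v₂ : ι → V} {w₁ w₂ : V} (h₁ : Filter.Tendsto v₁ l (nhds w₁))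
    (h₂ : Filter.Tendsto v₂ l (nhds w₂)) (C M : ℝ) (d : ℕ) :
    Filter.Tendsto (fun i => C * ‖v₁ i - v₂ i‖ * (‖v₁ i‖ ^ d + ‖v₂ i‖ ^ d) * M) l
      (nhds (C * ‖w₁ - w₂‖ * (‖w₁‖ ^ d + ‖w₂‖ ^ d) * M)) :=
  (((h₁.sub h₂).norm.const_mul C).mul ((h₁.norm.pow _).add (h₂.norm.pow _))).mul_const M

theorem IsApprox.tendsto_integral_det_hessian_sub {ι : Type*} {l : Filter ι}
    {w : CriticalBesov N} {v v' : ι → CriticalBesov N} {u u' : ι → E N → ℝ}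
    (h : IsApprox l w v u) (h' : IsApprox l w v' u') {φ : E N → ℝ} (hφ : ContDiff ℝ 2 φ)
    (hc : HasCompactSupport φ) :
    Filter.Tendsto (fun i => (∫ x, (hessian (u i) x).det * φ x) -
      ∫ x, (hessian (u' i) x).det * φ x) l (nhds 0) := by
  obtain ⟨C, -, hC⟩ := exists_abs_integral_det_hessian_sub_le N
  refine squeeze_zero_norm (fun i => hC (v i) (v' i) (u i) (u' i) φ (h.isSmoothRep i)
    (h'.isSmoothRep i) hφ hc) ?_
  simpa using tendsto_norm_sub_mul_add_pow h.tendsto h'.tendsto C (supNormD2 φ) (N - 1)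

theorem exists_tendsto_integral_det_hessian (w : CriticalBesov N) {φ : E N → ℝ}
    (hφ : ContDiff ℝ 2 φ) (hc : HasCompactSupport φ) :
    ∃ t : ℝ, ∀ v u, IsApprox Filter.atTop w v u →
      Filter.Tendsto (fun n : ℕ => ∫ x, (hessian (u n) x).det * φ x) Filter.atTop (nhds t) := by
  obtain ⟨v₀, u₀, h₀⟩ := CriticalBesov.exists_isApprox w
  have hcauchy : CauchySeq fun n => ∫ x, (hessian (u₀ n) x).det * φ x := by
    rw [cauchySeq_iff_tendsto_dist_atTop_0, ← Filter.prod_atTop_atTop_eq]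
    simpa only [Real.dist_eq, abs_zero, Function.comp_apply] using
      ((h₀.comp Filter.tendsto_fst).tendsto_integral_det_hessian_sub
        (h₀.comp Filter.tendsto_snd) hφ hc).abs
  obtain ⟨t, ht⟩ := cauchySeq_tendsto_of_complete hcauchy
  refine ⟨t, fun v u h => ?_⟩
  simpa using (h.tendsto_integral_det_hessian_sub h₀ hφ hc).add ht

/-- The value of the extension of `det D²` at `w`, tested against a `C_c^2` function. -/
def detPairing (w : CriticalBesov N) (φ : 𝓓^{2}((⊤ : Opens (E N)), ℝ)) : ℝ :=
  (exists_tendsto_integral_det_hessian w φ.contDiff φ.hasCompactSupport).choose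

theorem IsApprox.tendsto_detPairing {w : CriticalBesov N} {v : ℕ → CriticalBesov N}
    {u : ℕ → E N → ℝ} (h : IsApprox Filter.atTop w v u) (φ : 𝓓^{2}((⊤ : Opens (E N)), ℝ)) :
    Filter.Tendsto (fun n => ∫ x, (hessian (u n) x).det * φ x) Filter.atTop
      (nhds (detPairing w φ)) :=
  (exists_tendsto_integral_det_hessian w φ.contDiff φ.hasCompactSupport).choose_spec v u h

variable (N) in
theorem exists_abs_detPairing_sub_le :
    ∃ C : ℝ, 0 ≤ C ∧ ∀ (w₁ w₂ : CriticalBesov N) (φ : 𝓓^{2}((⊤ : Opens (E N)), ℝ)),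
      |detPairing w₁ φ - detPairing w₂ φ| ≤
        C * ‖w₁ - w₂‖ * (‖w₁‖ ^ (N - 1) + ‖w₂‖ ^ (N - 1)) * supNormD2 φ := by
  obtain ⟨C, hC₀, hC⟩ := exists_abs_integral_det_hessian_sub_le N
  refine ⟨C, hC₀, fun w₁ w₂ φ => ?_⟩
  obtain ⟨v₁, u₁, h₁⟩ := CriticalBesov.exists_isApprox w₁
  obtain ⟨v₂, u₂, h₂⟩ := CriticalBesov.exists_isApprox w₂
  exact le_of_tendsto_of_tendsto' ((h₁.tendsto_detPairing φ).sub (h₂.tendsto_detPairing φ)).abs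
    (tendsto_norm_sub_mul_add_pow h₁.tendsto h₂.tendsto C (supNormD2 φ) (N - 1)) fun n =>
      hC _ _ _ _ φ (h₁.isSmoothRep n) (h₂.isSmoothRep n) φ.contDiff φ.hasCompactSupport

variable (N) in
theorem exists_abs_detPairing_le :
    ∃ C : ℝ, 0 ≤ C ∧ ∀ (w : CriticalBesov N) (φ : 𝓓^{2}((⊤ : Opens (E N)), ℝ)),
      |detPairing w φ| ≤ C * ‖w‖ ^ N * supNormD2 φ := by
  obtain ⟨C, hC₀, hC⟩ := exists_abs_integral_det_hessian_le N
  refine ⟨C, hC₀, fun w φ => ?_⟩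
  obtain ⟨v, u, h⟩ := CriticalBesov.exists_isApprox w
  exact le_of_tendsto_of_tendsto' (h.tendsto_detPairing φ).abs
    (((h.tendsto.norm.pow N).const_mul C).mul_const (supNormD2 φ)) fun n =>
      hC _ _ φ (h.isSmoothRep n) φ.contDiff φ.hasCompactSupport

theorem detPairing_add (w : CriticalBesov N) (φ ψ : 𝓓^{2}((⊤ : Opens (E N)), ℝ)) :
    detPairing w (φ + ψ) = detPairing w φ + detPairing w ψ := by
  obtain ⟨v, u, h⟩ := CriticalBesov.exists_isApprox w
  have hint (χ : 𝓓^{2}((⊤ : Opens (E N)), ℝ)) (n : ℕ) :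
      Integrable fun x => (hessian (u n) x).det * χ x :=
    integrable_det_hessian_mul ((h.isSmoothRep n).contDiff_nat 2) χ.continuous
      χ.hasCompactSupport
  refine tendsto_nhds_unique (h.tendsto_detPairing (φ + ψ))
    (((h.tendsto_detPairing φ).add (h.tendsto_detPairing ψ)).congr fun n => ?_)
  rw [← integral_add (hint φ n) (hint ψ n)]
  exact integral_congr_ae (.of_forall fun x => (mul_add _ (φ x) (ψ x)).symm)

theorem detPairing_smul (w : CriticalBesov N) (c : ℝ) (φ : 𝓓^{2}((⊤ : Opens (E N)), ℝ)) :
    detPairing w (c • φ) = c * detPairing w φ := by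
  obtain ⟨v, u, h⟩ := CriticalBesov.exists_isApprox w
  refine tendsto_nhds_unique (h.tendsto_detPairing (c • φ))
    (((h.tendsto_detPairing φ).const_mul c).congr fun n => ?_)
  rw [← integral_const_mul]
  exact integral_congr_ae (.of_forall fun x => mul_left_comm c _ (φ x))

end Extension

section SecondDerivative

variable {V : Type*} [NormedAddCommGroup V] [NormedSpace ℝ V] {Ω : Opens V} {F : Type*}
  [NormedAddCommGroup F] [NormedSpace ℝ F]

variable (Ω F) in
theorem exists_continuous_norm_le (n : ℕ∞) :
    ∃ q : 𝓓^{n}(Ω, F) → ℝ, Continuous q ∧ q 0 = 0 ∧ ∀ (f : 𝓓^{n}(Ω, F)) (x : V), ‖f x‖ ≤ q f :=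
  ⟨fun f => ‖TestFunction.toBoundedContinuousFunctionCLM ℝ f‖,
    (ContinuousLinearMap.continuous _).norm, by simp only [map_zero, norm_zero],
    fun f => (TestFunction.toBoundedContinuousFunctionCLM ℝ f).norm_coe_le_norm⟩

variable (Ω F) in
theorem exists_continuous_norm_fderiv_le {n k : ℕ∞} (hk : k + 1 ≤ n) :
    ∃ q : 𝓓^{n}(Ω, F) → ℝ, Continuous q ∧ q 0 = 0 ∧
      ∀ (f : 𝓓^{n}(Ω, F)) (x : V), ‖fderiv ℝ f x‖ ≤ q f := by
  obtain ⟨q, hq, hq₀, hle⟩ := exists_continuous_norm_le Ω (V →L[ℝ] F) k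
  refine ⟨fun f => q (TestFunction.fderivCLM ℝ n k f), hq.comp (ContinuousLinearMap.continuous _),
    by simp only [map_zero, hq₀], fun f x => ?_⟩
  rw [← TestFunction.fderivCLM_apply_of_le (𝕜 := ℝ) f hk]
  exact hle _ x

variable (Ω F) in
theorem exists_continuous_norm_iteratedFDeriv_two_le :
    ∃ q : 𝓓^{2}(Ω, F) → ℝ, Continuous q ∧ q 0 = 0 ∧
      ∀ (f : 𝓓^{2}(Ω, F)) (x : V), ‖iteratedFDeriv ℝ 2 f x‖ ≤ q f := by
  obtain ⟨q, hq, hq₀, hle⟩ := exists_continuous_norm_fderiv_le Ω (V →L[ℝ] F) (n := 1) (k := 0)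
    (zero_add 1).le
  refine ⟨fun f => q (TestFunction.fderivCLM ℝ 2 1 f), hq.comp (ContinuousLinearMap.continuous _),
    by simp only [map_zero, hq₀], fun f x => ?_⟩
  rw [← norm_iteratedFDeriv_fderiv, norm_iteratedFDeriv_one,
    ← TestFunction.fderivCLM_apply_of_le (𝕜 := ℝ) f one_add_one_eq_two.le]
  exact hle _ x

theorem coe_monoCLM {n k : ℕ∞} (hk : k ≤ n) (f : 𝓓^{n}(Ω, F)) :
    ((TestFunction.monoCLM ℝ f : 𝓓^{k}(Ω, F)) : V → F) = f := by
  rw [TestFunction.monoCLM_apply, if_pos ⟨hk, le_rfl⟩]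

end SecondDerivative

section Distribution

variable {N : ℕ}

variable (N) in
theorem exists_continuous_supNormD2_le :
    ∃ q : 𝓓^{2}((⊤ : Opens (E N)), ℝ) → ℝ, Continuous q ∧ q 0 = 0 ∧
      ∀ φ : 𝓓^{2}((⊤ : Opens (E N)), ℝ), supNormD2 φ ≤ q φ := by
  obtain ⟨q, hq, hq₀, hle⟩ := exists_continuous_norm_iteratedFDeriv_two_le (⊤ : Opens (E N)) ℝ
  exact ⟨q, hq, hq₀, fun φ => supNormD2_le (hle φ)⟩

variable [hN : Fact (3 ≤ N)]

/-- The pairing of the extension of `det D²` at `w` with `C_c^2` functions, as a linear map. -/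
def detPairingLinearMap (w : CriticalBesov N) : 𝓓^{2}((⊤ : Opens (E N)), ℝ) →ₗ[ℝ] ℝ where
  toFun := detPairing w
  map_add' := detPairing_add w
  map_smul' := detPairing_smul w

theorem continuous_detPairingLinearMap (w : CriticalBesov N) :
    Continuous (detPairingLinearMap w) := by
  obtain ⟨C, hC₀, hC⟩ := exists_abs_detPairing_le N
  obtain ⟨q, hq, hq₀, hle⟩ := exists_continuous_supNormD2_le N
  refine continuous_of_continuousAt_zero (detPairingLinearMap w) ?_
  rw [ContinuousAt, map_zero]
  refine squeeze_zero_norm (a := fun φ => C * ‖w‖ ^ N * q φ) (fun φ => ?_) ?_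
  · exact (hC w φ).trans (mul_le_mul_of_nonneg_left (hle φ) (by positivity))
  · simpa only [hq₀, mul_zero] using (hq.tendsto 0).const_mul (C * ‖w‖ ^ N)

/-- The extension of `det D²` to `B(2 - 2/N, N)`, as a distribution of order at most two. -/
def detDistribution (w : CriticalBesov N) : 𝓓'^{2}((⊤ : Opens (E N)), ℝ) :=
  ContinuousLinearMap.toUniformConvergenceCLM (RingHom.id ℝ) ℝ _
    ⟨detPairingLinearMap w, continuous_detPairingLinearMap w⟩

theorem detDistribution_apply (w : CriticalBesov N) (φ : 𝓓^{2}((⊤ : Opens (E N)), ℝ)) :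
    detDistribution w φ = detPairing w φ := rfl

theorem continuous_detDistribution :
    Continuous (detDistribution : CriticalBesov N → 𝓓'^{2}((⊤ : Opens (E N)), ℝ)) := by
  obtain ⟨C, hC₀, hC⟩ := exists_abs_detPairing_sub_le N
  obtain ⟨q, hq, -, hle⟩ := exists_continuous_supNormD2_le N
  refine continuous_iff_continuousAt.2 fun w => ?_
  rw [ContinuousAt, UniformConvergenceCLM.tendsto_iff_tendstoUniformlyOn]
  intro S hS
  obtain ⟨M, hM⟩ := hS.exists_bound_of_continuousOn hq.continuousOn
  have hlim : Filter.Tendsto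
      (fun w' => C * ‖w - w'‖ * (‖w‖ ^ (N - 1) + ‖w'‖ ^ (N - 1)) * M) (nhds w) (nhds 0) := by
    simpa only [sub_self, norm_zero, mul_zero, zero_mul, id] using
      tendsto_norm_sub_mul_add_pow (tendsto_const_nhds (x := w)) (Filter.tendsto_id (x := nhds w))
        C M (N - 1)
  rw [Metric.tendstoUniformlyOn_iff]
  intro ε hε
  filter_upwards [hlim.eventually (gt_mem_nhds hε)] with w' hw' φ hφ
  refine lt_of_le_of_lt ((hC w w' φ).trans ?_) hw'
  exact mul_le_mul_of_nonneg_left ((hle φ).trans ((le_abs_self _).trans (hM φ hφ)))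
    (by positivity)

/-- The extension of `det D²` to `B(2 - 2/N, N)`. -/
def hessianDet (w : CriticalBesov N) : 𝓓'((⊤ : Opens (E N)), ℝ) :=
  (TestFunction.monoCLM ℝ : 𝓓((⊤ : Opens (E N)), ℝ) →L[ℝ]
    𝓓^{2}((⊤ : Opens (E N)), ℝ)).precompCompactConvergenceCLM ℝ (detDistribution w)

theorem hessianDet_apply (w : CriticalBesov N) (φ : 𝓓((⊤ : Opens (E N)), ℝ)) :
    hessianDet w φ = detPairing w (TestFunction.monoCLM ℝ φ) := rfl

theorem continuous_hessianDet :
    Continuous (hessianDet : CriticalBesov N → 𝓓'((⊤ : Opens (E N)), ℝ)) :=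
  (ContinuousLinearMap.continuous _).comp continuous_detDistribution

theorem IsApprox.tendsto_hessianDet {w : CriticalBesov N} {v : ℕ → CriticalBesov N}
    {u : ℕ → E N → ℝ} (h : IsApprox Filter.atTop w v u) (φ : 𝓓((⊤ : Opens (E N)), ℝ)) :
    Filter.Tendsto (fun n => ∫ x, (hessian (u n) x).det * φ x) Filter.atTop
      (nhds (hessianDet w φ)) := by
  simpa only [hessianDet_apply, coe_monoCLM le_top] using
    h.tendsto_detPairing (TestFunction.monoCLM ℝ φ)

theorem extendsHessianDet_hessianDet :
    ExtendsHessianDet (hessianDet : CriticalBesov N → 𝓓'((⊤ : Opens (E N)), ℝ)) := by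
  intro u
  have hN₀ := ne_zero_of_fact_three_le N
  have hs := one_lt_criticalExponent N
  have hs' := criticalExponent_lt_two N
  obtain ⟨w, hw⟩ := Besov.exists_toLp_ae_eq (p := N) hN₀ hs hs' u.contDiff u.hasCompactSupport
  obtain ⟨b, hb⟩ := exists_contDiffBump_tendsto_rOut (E N)
  obtain ⟨v, hv⟩ := exists_isApprox_mollify hN₀ hs hs' hw u.hasCompactSupport hb
  exact ⟨w, hw, fun φ => tendsto_nhds_unique (hv.tendsto_hessianDet φ)
    (tendsto_integral_det_hessian_mollify hb u.contDiff u.hasCompactSupport φ.continuous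
      φ.hasCompactSupport)⟩

theorem ExtendsHessianDet.eq_hessianDet {H : CriticalBesov N → 𝓓'((⊤ : Opens (E N)), ℝ)}
    (hH : ExtendsHessianDet H) (hc : Continuous H) : H = hessianDet := by
  ext w φ
  obtain ⟨v, u, h⟩ := CriticalBesov.exists_isApprox w
  have hlim : Filter.Tendsto (fun n => H (v n) φ) Filter.atTop (nhds (H w φ)) :=
    (((continuous_eval_const φ).comp hc).tendsto w).comp h.tendsto
  refine tendsto_nhds_unique (hlim.congr fun n => ?_) (h.tendsto_hessianDet φ)
  have hr := h.isSmoothRep n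
  obtain ⟨w', hw', hval⟩ := hH ⟨u n, hr.contDiff_nat 2, hr.hasCompactSupport, Set.subset_univ _⟩
  rw [← show w' = v n from Besov.toLp_injective (Lp.ext (hw'.trans hr.ae_eq.symm))]
  exact hval φ

end Distribution

end HessianDet

end

open HessianDet in
theorem corollary1 (N : ℕ) [Fact (3 ≤ N)] :
    ∃ H : CriticalBesov N → 𝓓'((⊤ : Opens (E N)), ℝ),
      -- `H` is a continuous extension of `u ↦ det(D²u)`, and the only one
      Continuous H ∧ ExtendsHessianDet H ∧
      (∀ H' : CriticalBesov N → 𝓓'((⊤ : Opens (E N)), ℝ),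
        Continuous H' → ExtendsHessianDet H' → H' = H) ∧
      -- the estimate, with a constant that depends only on `N`
      ∃ C : ℝ,
        (∀ (u₁ u₂ : CriticalBesov N) (φ : 𝓓((⊤ : Opens (E N)), ℝ)),
          |(H u₁ - H u₂) φ| ≤
            C * ‖u₁ - u₂‖ * (‖u₁‖ ^ (N - 1) + ‖u₂‖ ^ (N - 1)) * supNormD2 φ) ∧
        -- each `H u` has order at most two, and the estimate holds for `φ ∈ C_c^2` as well
        ∃ T : CriticalBesov N → 𝓓'^{2}((⊤ : Opens (E N)), ℝ),
          (∀ (u : CriticalBesov N) (φ : 𝓓^{2}((⊤ : Opens (E N)), ℝ))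
            (ψ : 𝓓((⊤ : Opens (E N)), ℝ)), (φ : E N → ℝ) = ψ → T u φ = H u ψ) ∧
          ∀ (u₁ u₂ : CriticalBesov N) (φ : 𝓓^{2}((⊤ : Opens (E N)), ℝ)),
            |(T u₁ - T u₂) φ| ≤
              C * ‖u₁ - u₂‖ * (‖u₁‖ ^ (N - 1) + ‖u₂‖ ^ (N - 1)) * supNormD2 φ := by
  obtain ⟨C, -, hC⟩ := exists_abs_detPairing_sub_le N
  refine ⟨hessianDet, continuous_hessianDet, extendsHessianDet_hessianDet,
    fun H' hc hH' => hH'.eq_hessianDet hc, C, fun u₁ u₂ φ => ?_, detDistribution,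
    fun u φ ψ hφψ => ?_, hC⟩
  · have hφ := hC u₁ u₂ (TestFunction.monoCLM ℝ φ)
    rwa [coe_monoCLM le_top] at hφ
  · have hφ : φ = TestFunction.monoCLM ℝ ψ :=
      DFunLike.coe_injective (hφψ.trans (coe_monoCLM le_top ψ).symm)
    rw [hφ, detDistribution_apply, hessianDet_apply]
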